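/- \textbf{Definitions.} Let $R$ be a Dedekind domain with fraction field $K$. A \emph{lattice} over $R$ is a finitely generated torsion-free $R$-module. A \emph{quintic ring} over $R$ is a commutative $R$-algebra $Q$ that is a lattice of rank $5$; put $L=Q/R$ and $Q_K=Q\otimes_R K$. The ring $Q$ is \emph{very degenerate} if the $K$-algebra $Q_K$ has subspaces $Q_3\subseteq Q_4$ of dimensions $3$ and $4$ with $Q_4Q_3=0$. For a module $M$, the quadratic map $\mu\mapsto\mu^\square$ from $\Lambda^2M$ to $\Lambda^4M$ is given by $(\sum_i v_i\wedge w_i)^\square=\sum_{i<j}v_i\wedge w_i\wedge v_j\wedge w_j$. For $\alpha,\beta\in\Lambda^4M$ and $\mu\in\Lambda^2M$, the contraction $\mu(\alpha,\beta)\in(\Lambda^5M)^{\otimes2}$ is linear in $\mu$, with $(v\wedge w)(\alpha,\beta)=(\alpha\wedge v)\otimes(\beta\wedge w)-(\alpha\wedge w)\otimes(\beta\wedge v)$. A \emph{resolvent} of $Q$ is a lattice $M$ of rank $5$ with linear maps $\varphi:\Lambda^4L\otimes L\to\Lambda^2M$ and $\theta:\Lambda^5M\to(\Lambda^4L)^{\otimes3}$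 such that $$\theta^{\otimes2}\bigl[\varphi(\lambda_1x)\bigl(\varphi(\lambda_2y)^\square,\varphi(\lambda_3z)^\square\bigr)\bigr]=\lambda_1\lambda_2^2\lambda_3^2\,(x\wedge y\wedge z\wedge yz)$$ for all $x,y,z\in L$ and $\lambda_i\in\Lambda^4L$, where $yz$ is the product in $Q$ of any lifts of $y$ and $z$. It is \emph{numerical} if $\theta$ is an isomorphism. Two resolvents are isomorphic if there is an isomorphism of their modules $M$ compatible with $\varphi$ and $\theta$; resolvents are counted up to isomorphism. The same definitions apply over $K$. Put $$F(a,b,c,d,e)=(a\wedge b\wedge c\wedge bc)(a\wedge d\wedge e\wedge de)+(a\wedge b\wedge d\wedge bd)(a\wedge e\wedge c\wedge ec)+(a\wedge b\wedge e\wedge be)(a\wedge c\wedge d\wedge cd)\in(\Lambda^4L)^{\otimes2},$$ and let $\mathfrak c$ be the index ideal $[(\Lambda^4L)^{\otimes2}:\langle F(a,b,c,d,e):a,b,c,d,e\in L\rangle]$ of $R$. (For rank-one lattices $A,B$ in a one-dimensional $K$-space, $[A:B]=\{r\in R: rA\subseteq B\}$ when $B\subseteq A$.) \textbf{Theorem.}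 Let $Q$ be a quintic ring over $R$ that is not very degenerate. (1) $\mathfrak c\neq0$, and for every resolvent $(M_K,\varphi,\theta)$ of $Q_K$ we have $\mathfrak c=[\Lambda^5M_0:\theta^{-1}((\Lambda^4L)^{\otimes3})]$, where $M_0\subset M_K$ is the dual of the lattice spanned by $\varphi^\square(\Lambda^4L\otimes L)\otimes(\theta^{-1}((\Lambda^4L)^{\otimes3}))^{\otimes-1}$ in $\Lambda^4M_K\otimes(\Lambda^5M_K)^{\otimes-1}\cong M_K^*$; that is, $M_0$ is the set of $v\in M_K$ with $\theta(\varphi(a)^\square\wedge v)\in(\Lambda^4L)^{\otimes3}$ for all $a\in\Lambda^4L\otimes L$. (2) If $N(\mathfrak p)=|R/\mathfrak p|$ is finite for every prime $\mathfrak p$ dividing $\mathfrak c$, then up to isomorphism $Q$ has at most $$\prod_{\mathfrak p^n\parallel\mathfrak c}\left(\frac{N(\mathfrak p)^5-1}{N(\mathfrak p)-1}\right)^n$$ numerical resolvents; in particular their number is finite. (3) Consequently, a quintic ring over the ring of integers of a number field that is not very degenerate has only finitely many numerical resolvents up to isomorphism. -/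

import Mathlib

open scoped TensorProduct

universe u v w k

noncomputable section

namespace QuinticResolvent

/-! ## Multilinear algebra -/

section Multilinear

variable {R : Type u} [CommRing R] {M : Type v} [AddCommGroup M] [Module R M]

/-- The wedge product of an element of `⋀ᵐ M` with an element of `⋀ⁿ M`. -/
def wedge {m n : ℕ} (a : ⋀[R]^m M) (b : ⋀[R]^n M) : ⋀[R]^(m + n) M :=
  ⟨(a : ExteriorAlgebra R M) * (b : ExteriorAlgebra R M), by
    have h := Submodule.mul_mem_mul a.2 b.2
    rwa [← pow_add] at h⟩

@[simp] theorem coe_wedge {m n : ℕ} (a : ⋀[R]^m M) (b : ⋀[R]^n M) :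
    (wedge a b : ExteriorAlgebra R M) = (a : ExteriorAlgebra R M) * b := rfl

/-- The linear map `v ↦ α ∧ v` from `M` to `⋀⁵ M`, for `α` in `⋀⁴ M`. -/
def wedgeVec (α : ⋀[R]^4 M) : M →ₗ[R] ⋀[R]^5 M where
  toFun x := wedge α (exteriorPower.ιMulti R 1 ![x])
  map_add' x y := by
    ext; simp [ExteriorAlgebra.ιMulti_apply, mul_add]
  map_smul' r x := by
    ext; simp [ExteriorAlgebra.ιMulti_apply]

theorem ιMulti_two (f : Fin 2 → M) :
    ExteriorAlgebra.ιMulti R 2 f = ExteriorAlgebra.ι R (f 0) * ExteriorAlgebra.ι R (f 1) := by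
  simp [ExteriorAlgebra.ιMulti_apply, Matrix.vecTail]

/-- The bivector `a ∧ b`. -/
abbrev bivec (a b : M) : ⋀[R]^2 M := exteriorPower.ιMulti R 2 ![a, b]

theorem bivec_mul_comm (μ ν : ⋀[R]^2 M) :
    (μ : ExteriorAlgebra R M) * ν = (ν : ExteriorAlgebra R M) * μ := by
  have key : ∀ a b c d : M,
      ExteriorAlgebra.ι R a * ExteriorAlgebra.ι R b *
          (ExteriorAlgebra.ι R c * ExteriorAlgebra.ι R d) =
        ExteriorAlgebra.ι R c * ExteriorAlgebra.ι R d *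
          (ExteriorAlgebra.ι R a * ExteriorAlgebra.ι R b) := by
    intro a b c d
    have sw : ∀ x y : M, ExteriorAlgebra.ι R x * ExteriorAlgebra.ι R y =
        -(ExteriorAlgebra.ι R y * ExteriorAlgebra.ι R x) := fun x y =>
      eq_neg_of_add_eq_zero_left (ExteriorAlgebra.ι_add_mul_swap x y)
    have sw' : ∀ (x y : M) (t : ExteriorAlgebra R M),
        ExteriorAlgebra.ι R x * (ExteriorAlgebra.ι R y * t) =
        -(ExteriorAlgebra.ι R y * (ExteriorAlgebra.ι R x * t)) := fun x y t => by
      rw [← mul_assoc, sw x y, neg_mul, mul_assoc]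
    simp only [mul_assoc]
    rw [sw' b c, mul_neg, sw' a c, neg_neg, sw b d, mul_neg, mul_neg, sw' a d, mul_neg, neg_neg]
  have hspan : ∀ ξ : ⋀[R]^2 M,
      ξ ∈ Submodule.span R (Set.range (exteriorPower.ιMulti R 2 (M := M))) := by
    intro ξ; rw [exteriorPower.ιMulti_span]; trivial
  induction hspan μ using Submodule.span_induction with
  | mem x hx =>
    obtain ⟨f, rfl⟩ := hx
    induction hspan ν using Submodule.span_induction with
    | mem y hy =>
      obtain ⟨g, rfl⟩ := hy
      simpa [-ExteriorAlgebra.ιMulti_succ_apply, ιMulti_two] using key (f 0) (f 1) (g 0) (g 1)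
    | zero => simp
    | add x y _ _ hx hy => simp only [Submodule.coe_add, mul_add, add_mul, hx, hy]
    | smul r x _ hx =>
      simp only [Submodule.coe_smul, mul_smul_comm, smul_mul_assoc, hx]
  | zero => simp
  | add x y _ _ hx hy => simp only [Submodule.coe_add, mul_add, add_mul, hx, hy]
  | smul r x _ hx => simp only [Submodule.coe_smul, mul_smul_comm, smul_mul_assoc, hx]

/-- Auxiliary module for the construction of `box`: pairs `(μ, β)` with `μ ∧ μ = 2 β`. The sum is
`(μ, β) + (ν, γ) = (μ + ν, β + γ + μ ∧ ν)` and the scalar action is `r (μ, β) = (r μ, r² β)`. -/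
@[ext] structure BoxPair (R : Type u) [CommRing R] (M : Type v) [AddCommGroup M] [Module R M] where
  fst : ⋀[R]^2 M
  snd : ⋀[R]^4 M
  rel : wedge fst fst = (2 : R) • snd

namespace BoxPair

theorem rel' (p : BoxPair R M) :
    (p.fst : ExteriorAlgebra R M) * p.fst = (2 : R) • (p.snd : ExteriorAlgebra R M) :=
  congrArg Subtype.val p.rel

theorem ext' {p q : BoxPair R M} (h1 : (p.fst : ExteriorAlgebra R M) = q.fst)
    (h2 : (p.snd : ExteriorAlgebra R M) = q.snd) : p = q :=
  BoxPair.ext (Subtype.ext h1) (Subtype.ext h2)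

instance : Zero (BoxPair R M) := ⟨⟨0, 0, by ext; simp⟩⟩

instance : Add (BoxPair R M) :=
  ⟨fun p q => ⟨p.fst + q.fst, p.snd + q.snd + wedge p.fst q.fst, by
    ext
    have h := bivec_mul_comm p.fst q.fst
    simp only [coe_wedge, Submodule.coe_add, mul_add, add_mul, rel', h,
      smul_add, two_smul]
    abel⟩⟩

instance : SMul R (BoxPair R M) :=
  ⟨fun r p => ⟨r • p.fst, (r ^ 2) • p.snd, by
    ext
    simp only [coe_wedge, Submodule.coe_smul, smul_mul_assoc, mul_smul_comm, rel', smul_smul]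
    ring_nf⟩⟩

instance : Neg (BoxPair R M) := ⟨fun p => (-1 : R) • p⟩

@[simp] theorem zero_fst : (0 : BoxPair R M).fst = 0 := rfl
@[simp] theorem zero_snd : (0 : BoxPair R M).snd = 0 := rfl
@[simp] theorem add_fst (p q : BoxPair R M) : (p + q).fst = p.fst + q.fst := rfl
@[simp] theorem add_snd (p q : BoxPair R M) :
    (p + q).snd = p.snd + q.snd + wedge p.fst q.fst := rfl
@[simp] theorem smul_fst (r : R) (p : BoxPair R M) : (r • p).fst = r • p.fst := rfl
@[simp] theorem smul_snd (r : R) (p : BoxPair R M) : (r • p).snd = (r ^ 2) • p.snd := rfl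
theorem neg_def (p : BoxPair R M) : -p = (-1 : R) • p := rfl

instance : AddCommGroup (BoxPair R M) where
  add_assoc p q r := by
    apply ext'
    · simp [add_assoc]
    · simp only [add_fst, add_snd, Submodule.coe_add, coe_wedge, mul_add, add_mul]
      abel
  zero_add p := by apply ext' <;> simp
  add_zero p := by apply ext' <;> simp
  add_comm p q := by
    apply ext'
    · simp [add_comm]
    · simp only [add_snd, Submodule.coe_add, coe_wedge, bivec_mul_comm p.fst q.fst]
      abel
  neg_add_cancel p := by
    apply ext'
    · simp [neg_def]
    · simp [neg_def, rel', two_smul]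
  nsmul := nsmulRec
  zsmul := zsmulRec

instance : Module R (BoxPair R M) where
  one_smul p := by apply ext' <;> simp
  mul_smul r s p := by
    apply ext'
    · simp [mul_smul]
    · simp [mul_smul, mul_pow]
  smul_zero r := by apply ext' <;> simp
  smul_add r p q := by
    apply ext'
    · simp
    · simp [smul_smul, pow_two]
  add_smul r s p := by
    apply ext'
    · simp [add_smul]
    · simp only [smul_snd, add_snd, smul_fst, Submodule.coe_add, Submodule.coe_smul, coe_wedge,
        smul_mul_assoc, mul_smul_comm, rel', smul_smul, ← add_smul]
      congr 1; ring
  zero_smul p := by apply ext' <;> simp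

/-- The alternating map `(a, b) ↦ (a ∧ b, 0)`. -/
def ofVec : M [⋀^Fin 2]→ₗ[R] BoxPair R M :=
  { toFun := fun f => ⟨exteriorPower.ιMulti R 2 f, 0, by
      ext
      have h : ∀ a b c : M, ExteriorAlgebra.ι R a * (ExteriorAlgebra.ι R b *
          (ExteriorAlgebra.ι R a * ExteriorAlgebra.ι R c)) = 0 := fun a b c => by
        have := ExteriorAlgebra.ι_add_mul_swap (R := R) b a
        rw [← mul_assoc (ExteriorAlgebra.ι R b), eq_neg_of_add_eq_zero_left this, neg_mul,
          mul_neg, mul_assoc, ← mul_assoc, ExteriorAlgebra.ι_sq_zero]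
        simp
      simpa [-ExteriorAlgebra.ιMulti_succ_apply, ιMulti_two, mul_assoc] using h (f 0) (f 1) (f 1)⟩
    map_update_add' := by
      intro _ f i x y
      have h : ∀ a b c : M, ExteriorAlgebra.ι R a * (ExteriorAlgebra.ι R b *
          (ExteriorAlgebra.ι R a * ExteriorAlgebra.ι R c)) = 0 := fun a b c => by
        have := ExteriorAlgebra.ι_add_mul_swap (R := R) b a
        rw [← mul_assoc (ExteriorAlgebra.ι R b), eq_neg_of_add_eq_zero_left this, neg_mul,
          mul_neg, mul_assoc, ← mul_assoc, ExteriorAlgebra.ι_sq_zero]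
        simp
      have h' : ∀ a b c : M, ExteriorAlgebra.ι R a * (ExteriorAlgebra.ι R b *
          (ExteriorAlgebra.ι R c * ExteriorAlgebra.ι R b)) = 0 := fun a b c => by
        have := ExteriorAlgebra.ι_add_mul_swap (R := R) c b
        rw [eq_neg_of_add_eq_zero_left this, mul_neg,
          ← mul_assoc (ExteriorAlgebra.ι R b), ExteriorAlgebra.ι_sq_zero]
        simp
      apply ext'
      · simp
      · fin_cases i <;>
          simp [-ExteriorAlgebra.ιMulti_succ_apply, ιMulti_two, mul_assoc, h, h']
    map_update_smul' := by
      intro _ f i r x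
      apply ext' <;> simp
    map_eq_zero_of_eq' := by
      intro f i j hij hne
      apply ext'
      · have := (exteriorPower.ιMulti R 2 (M := M)).map_eq_zero_of_eq f hij hne
        simpa using congrArg Subtype.val this
      · simp }

/-- The section `μ ↦ (μ, μ^□)`. -/
def lift : ⋀[R]^2 M →ₗ[R] BoxPair R M := exteriorPower.alternatingMapLinearEquiv ofVec

theorem lift_bivec (a b : M) : lift (bivec a b : ⋀[R]^2 M) = ofVec ![a, b] :=
  exteriorPower.alternatingMapLinearEquiv_apply_ιMulti _ _

end BoxPair

/-- The quadratic map `μ ↦ μ^□` from `⋀² M` to `⋀⁴ M`; see `box_sum` for the defining formula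
`(∑ aᵢ ∧ bᵢ)^□ = ∑_{i < j} aᵢ ∧ bᵢ ∧ aⱼ ∧ bⱼ`. -/
def box (μ : ⋀[R]^2 M) : ⋀[R]^4 M := (BoxPair.lift μ).snd

theorem BoxPair.lift_fst (μ : ⋀[R]^2 M) : (BoxPair.lift μ).fst = μ := by
  let F : BoxPair R M →ₗ[R] ⋀[R]^2 M :=
    { toFun := BoxPair.fst, map_add' := fun _ _ => rfl, map_smul' := fun _ _ => rfl }
  have : F ∘ₗ BoxPair.lift = LinearMap.id := by
    apply exteriorPower.linearMap_ext
    ext f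
    simp [F, BoxPair.lift, BoxPair.ofVec]
  exact LinearMap.congr_fun this μ

theorem box_bivec (a b : M) : box (bivec a b : ⋀[R]^2 M) = 0 := by
  rw [box, BoxPair.lift_bivec]; rfl

theorem box_add (μ ν : ⋀[R]^2 M) : box (μ + ν) = box μ + box ν + wedge μ ν := by
  simp [box, BoxPair.lift_fst]

theorem box_smul (r : R) (μ : ⋀[R]^2 M) : box (r • μ) = r ^ 2 • box μ := by
  simp [box]

theorem box_sum (n : ℕ) (a b : Fin n → M) :
    box (∑ i, bivec (a i) (b i) : ⋀[R]^2 M) =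
      ∑ j, ∑ i ∈ Finset.univ.filter (· < j),
        exteriorPower.ιMulti R 4 ![a i, b i, a j, b j] := by
  induction n with
  | zero => simp [box]
  | succ n ih =>
    rw [Fin.sum_univ_castSucc, box_add, ih (fun i => a i.castSucc) (fun i => b i.castSucc),
      box_bivec, add_zero, Fin.sum_univ_castSucc]
    congr 1
    · refine Finset.sum_congr rfl fun j _ => ?_
      simp only [Finset.sum_filter, Fin.sum_univ_castSucc, Fin.castSucc_lt_castSucc_iff]
      simp [not_lt.mpr (Fin.le_last _)]
    · simp only [Finset.sum_filter, Fin.sum_univ_castSucc]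
      simp only [Fin.castSucc_lt_last, if_true, lt_irrefl, if_false, add_zero]
      ext
      simp [ExteriorAlgebra.ιMulti_apply, Finset.sum_mul, mul_assoc]

/-- The contraction `μ(α, β)` for `α, β` in `⋀⁴ M`, as a linear map of `μ` in `⋀² M`. Here `α` and
`β` are viewed as the functionals `α ∧ ·` and `β ∧ ·` on `M` with values in `⋀⁵ M`, and
`(f ∧ g)(a ∧ b) = f a ⊗ g b - f b ⊗ g a`. -/
def contraction (α β : ⋀[R]^4 M) : ⋀[R]^2 M →ₗ[R] (⋀[R]^5 M) ⊗[R] (⋀[R]^5 M) :=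
  exteriorPower.alternatingMapLinearEquiv
    { toFun := fun f =>
        wedgeVec α (f 0) ⊗ₜ[R] wedgeVec β (f 1) - wedgeVec α (f 1) ⊗ₜ[R] wedgeVec β (f 0)
      map_update_add' := by
        intro _ f i x y
        fin_cases i <;> simp [TensorProduct.add_tmul, TensorProduct.tmul_add] <;> abel
      map_update_smul' := by
        intro _ f i r x
        fin_cases i <;> simp [TensorProduct.smul_tmul', smul_sub]
      map_eq_zero_of_eq' := by
        intro f i j hij hne
        have h01 : f 0 = f 1 := by
          fin_cases i <;> fin_cases j <;> first | exact absurd rfl hne | exact hij | exact hij.symm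
        simp [h01] }

theorem contraction_bivec (α β : ⋀[R]^4 M) (a b : M) :
    contraction α β (bivec a b) =
      wedgeVec α a ⊗ₜ[R] wedgeVec β b - wedgeVec α b ⊗ₜ[R] wedgeVec β a :=
  exteriorPower.alternatingMapLinearEquiv_apply_ιMulti _ _

end Multilinear

/-! ## Quintic rings and their resolvents -/

/-- A quintic ring over `R`: a commutative `R`-algebra that is a lattice of rank `5`. -/
structure IsQuinticRing (R : Type u) [CommRing R] (Q : Type v) [CommRing Q] [Algebra R Q] :
    Prop where
  finite : Module.Finite R Q
  torsionFree : Module.IsTorsionFree R Q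
  rank : Module.finrank R Q = 5

/-- An algebra `A` over a field `K` (used for `A` of dimension `5`) is very degenerate if it has
subspaces `Q₃ ⊆ Q₄` of dimensions `3` and `4` with `Q₄ Q₃ = 0`. -/
def IsVeryDegenerate (K : Type u) [Field K] (A : Type v) [CommRing A] [Algebra K A] : Prop :=
  ∃ Q₃ Q₄ : Submodule K A, Q₃ ≤ Q₄ ∧ Module.finrank K Q₃ = 3 ∧ Module.finrank K Q₄ = 4 ∧
    ∀ x ∈ Q₄, ∀ y ∈ Q₃, x * y = 0

section Ring

variable (R : Type u) [CommRing R] (Q : Type v) [CommRing Q] [Algebra R Q]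

/-- The quotient module `L = Q / R`. -/
abbrev L : Type v := Q ⧸ (1 : Submodule R Q)

/-- The projection `Q → L`. -/
abbrev toL : Q →ₗ[R] L R Q := (1 : Submodule R Q).mkQ

/-- The rank one module `D = ⋀⁴ L`. -/
abbrev D : Type (max u v) := ⋀[R]^4 (L R Q)

variable {Q}

/-- The element `x ∧ y ∧ z ∧ yz` of `⋀⁴ L`, in terms of lifts of `x, y, z` to `Q`. -/
def wedgeProd (x y z : Q) : D R Q :=
  exteriorPower.ιMulti R 4 ![toL R Q x, toL R Q y, toL R Q z, toL R Q (y * z)]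

/-- The pentaquadratic form `F(a, b, c, d, e)` with values in `(⋀⁴ L)^{⊗ 2}`. -/
def pentaForm (a b c d e : Q) : D R Q ⊗[R] D R Q :=
  wedgeProd R a b c ⊗ₜ[R] wedgeProd R a d e + wedgeProd R a b d ⊗ₜ[R] wedgeProd R a e c +
    wedgeProd R a b e ⊗ₜ[R] wedgeProd R a c d

variable (Q)

/-- The ideal `[(⋀⁴ L)^{⊗ 2} : ⟨F(a, b, c, d, e)⟩]`. Since `(⋀⁴ L)^{⊗ 2}` is a lattice of rank one,
the index ideal is the ideal of all `r` that carry it into the span of the values of `F`. -/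
def indexIdeal : Ideal R :=
  (Submodule.span R {t : D R Q ⊗[R] D R Q | ∃ a b c d e : Q, t = pentaForm R a b c d e}).colon
    Set.univ

/-- A resolvent of `Q`: a lattice `M` of rank `5` with linear maps `φ : ⋀⁴ L ⊗ L → ⋀² M` and
`θ : ⋀⁵ M → (⋀⁴ L)^{⊗ 3}` such that
`θ^{⊗ 2}[φ(λ₁ x)(φ(λ₂ y)^□, φ(λ₃ z)^□)] = λ₁ λ₂² λ₃² (x ∧ y ∧ z ∧ yz)` in `(⋀⁴ L)^{⊗ 6}`. -/
structure Resolvent where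
  M : Type w
  [addCommGroup : AddCommGroup M]
  [module : Module R M]
  finite : Module.Finite R M
  torsionFree : Module.IsTorsionFree R M
  rank : Module.finrank R M = 5
  φ : D R Q ⊗[R] L R Q →ₗ[R] ⋀[R]^2 M
  θ : ⋀[R]^5 M →ₗ[R] D R Q ⊗[R] (D R Q ⊗[R] D R Q)
  identity : ∀ (l₁ l₂ l₃ : D R Q) (x y z : Q),
    TensorProduct.map θ θ
        (contraction (box (φ (l₂ ⊗ₜ[R] toL R Q y))) (box (φ (l₃ ⊗ₜ[R] toL R Q z)))
          (φ (l₁ ⊗ₜ[R] toL R Q x))) =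
      (l₁ ⊗ₜ[R] (l₂ ⊗ₜ[R] l₂)) ⊗ₜ[R] (l₃ ⊗ₜ[R] (l₃ ⊗ₜ[R] wedgeProd R x y z))

attribute [instance] Resolvent.addCommGroup Resolvent.module

variable {R Q}

/-- A resolvent is numerical if `θ` is an isomorphism. -/
def Resolvent.IsNumerical (ρ : Resolvent.{u, v, w} R Q) : Prop := Function.Bijective ρ.θ

/-- Two resolvents of `Q` are isomorphic if there is an isomorphism of the modules `M` that is
compatible with `φ` and `θ`. -/
def Resolvent.IsIso (ρ σ : Resolvent.{u, v, w} R Q) : Prop :=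
  ∃ f : ρ.M ≃ₗ[R] σ.M,
    exteriorPower.map 2 f.toLinearMap ∘ₗ ρ.φ = σ.φ ∧
      σ.θ ∘ₗ exteriorPower.map 5 f.toLinearMap = ρ.θ

variable (R Q)

/-- Isomorphism of numerical resolvents, as an equivalence relation. -/
def numericalSetoid : Setoid {ρ : Resolvent.{u, v, w} R Q // ρ.IsNumerical} where
  r ρ σ := ρ.1.IsIso σ.1
  iseqv :=
    { refl := fun ρ => ⟨LinearEquiv.refl R _, by
        constructor
        · ext1; simp [exteriorPower.map_id]
        · simp [exteriorPower.map_id]⟩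
      symm := by
        rintro ρ σ ⟨f, h1, h2⟩
        refine ⟨f.symm, ?_, ?_⟩
        · rw [← h1, ← LinearMap.comp_assoc, ← exteriorPower.map_comp]
          simp [exteriorPower.map_id]
        · rw [← h2, LinearMap.comp_assoc, ← exteriorPower.map_comp]
          simp [exteriorPower.map_id]
      trans := by
        rintro ρ σ τ ⟨f, h1, h2⟩ ⟨g, h3, h4⟩
        refine ⟨f.trans g, ?_, ?_⟩
        · rw [← h3, ← h1, ← LinearMap.comp_assoc, ← exteriorPower.map_comp]
          rfl
        · rw [← h2, ← h4, LinearMap.comp_assoc, ← exteriorPower.map_comp]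
          rfl }

/-- The isomorphism classes of numerical resolvents of `Q` (with `M` in a given universe). -/
def NumericalResolventClass : Type _ := Quotient (numericalSetoid.{u, v, w} R Q)

end Ring

/-! ## The bounding lattice -/

section Lattice

variable (R : Type u) [CommRing R] (K : Type k) [Field K] [Algebra R K]
  (Q : Type v) [CommRing Q] [Algebra R Q]

/-- The algebra `Q_K = K ⊗ Q`. -/
abbrev baseChange : Type (max k v) := K ⊗[R] Q

/-- The image of `L = Q / R` in `L_K = Q_K / K`. -/
def latL : Submodule R (L K (baseChange R K Q)) :=
  Submodule.span R {t | ∃ q : Q, t = toL K (baseChange R K Q) (1 ⊗ₜ[R] q)}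

/-- The lattice `⋀⁴ L` in `⋀⁴ L_K`. -/
def latD : Submodule R (D K (baseChange R K Q)) :=
  Submodule.span R {t | ∃ x : Fin 4 → L K (baseChange R K Q),
    (∀ i, x i ∈ latL R K Q) ∧ t = exteriorPower.ιMulti K 4 x}

/-- The lattice `⋀⁴ L ⊗ L` in `⋀⁴ L_K ⊗ L_K`. -/
def latDL : Submodule R (D K (baseChange R K Q) ⊗[K] L K (baseChange R K Q)) :=
  Submodule.span R {t | ∃ d ∈ latD R K Q, ∃ x ∈ latL R K Q, t = d ⊗ₜ[K] x}

/-- The lattice `(⋀⁴ L)^{⊗ 3}` in `(⋀⁴ L_K)^{⊗ 3}`. -/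
def latD3 : Submodule R (D K (baseChange R K Q) ⊗[K]
    (D K (baseChange R K Q) ⊗[K] D K (baseChange R K Q))) :=
  Submodule.span R {t | ∃ d₁ ∈ latD R K Q, ∃ d₂ ∈ latD R K Q, ∃ d₃ ∈ latD R K Q,
    t = d₁ ⊗ₜ[K] (d₂ ⊗ₜ[K] d₃)}

variable {K Q}

/-- The lattice `θ⁻¹((⋀⁴ L)^{⊗ 3})` in `⋀⁵ M_K`, for a resolvent `(M_K, φ, θ)` of `Q_K`. -/
def Resolvent.thetaLattice (ρ : Resolvent.{k, max k v, w} K (baseChange R K Q))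
    [Module R ρ.M] [IsScalarTower R K ρ.M] : Submodule R (⋀[K]^5 ρ.M) :=
  (latD3 R K Q).comap (ρ.θ.restrictScalars R)

/-- The bounding lattice `M₀` in `M_K`, for a resolvent `(M_K, φ, θ)` of `Q_K`: the dual of the
lattice in `M_K^* ≅ ⋀⁴ M_K ⊗ (⋀⁵ M_K)^{⊗ -1}` that is spanned by
`φ^□(⋀⁴ L ⊗ L) ⊗ (θ⁻¹((⋀⁴ L)^{⊗ 3}))^{⊗ -1}`. As `θ⁻¹((⋀⁴ L)^{⊗ 3})` has rank one, `v` pairs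
integrally with this lattice when each `φ(a)^□ ∧ v` lies in `θ⁻¹((⋀⁴ L)^{⊗ 3})`. -/
def Resolvent.boundingLattice (ρ : Resolvent.{k, max k v, w} K (baseChange R K Q))
    [Module R ρ.M] [IsScalarTower R K ρ.M] : Submodule R ρ.M where
  carrier := {x | ∀ a ∈ latDL R K Q, wedgeVec (box (ρ.φ a)) x ∈ ρ.thetaLattice R}
  zero_mem' := fun a _ => by simp
  add_mem' := fun hx hy a ha => by
    rw [map_add]; exact add_mem (hx a ha) (hy a ha)
  smul_mem' := fun r x hx a ha => by
    rw [← algebraMap_smul K r x, map_smul, algebraMap_smul]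
    exact Submodule.smul_mem _ r (hx a ha)

/-- The ideal `[⋀⁵ M₀ : θ⁻¹((⋀⁴ L)^{⊗ 3})]`: both are lattices of rank one in `⋀⁵ M_K`, and the
index ideal consists of all `r` that carry the first into the second. -/
def Resolvent.boundingIndex (ρ : Resolvent.{k, max k v, w} K (baseChange R K Q))
    [Module R ρ.M] [IsScalarTower R K ρ.M] : Ideal R :=
  (ρ.thetaLattice R).colon
    (Submodule.span R {t : ⋀[K]^5 ρ.M | ∃ x : Fin 5 → ρ.M,
      (∀ i, x i ∈ ρ.boundingLattice R) ∧ t = exteriorPower.ιMulti K 5 x} :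
        Submodule R (⋀[K]^5 ρ.M))

end Lattice

open Classical in
/-- The number `∏_{𝔭ⁿ ∥ 𝔠} ((N(𝔭)⁵ - 1) / (N(𝔭) - 1))ⁿ` for a nonzero ideal `𝔠`, where
`N(𝔭) = |R / 𝔭|`. -/
def resolventBound {R : Type u} [CommRing R] [IsDedekindDomain R] (c : Ideal R) : ℚ :=
  ∏ p ∈ (UniqueFactorizationMonoid.normalizedFactors c).toFinset,
    (((Nat.card (R ⧸ p) : ℚ) ^ 5 - 1) / ((Nat.card (R ⧸ p) : ℚ) - 1)) ^
      (UniqueFactorizationMonoid.normalizedFactors c).count p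

end QuinticResolvent

end

noncomputable section

namespace QuinticResolvent

/-! ## Very degenerate algebras -/

section VeryDegenerate

variable {K : Type u} [Field K] {A : Type v} [CommRing A] [Algebra K A]

open Module

/-! Fix an embedding `δ` of `D = ⋀⁴ L` in `K`, and put 𝔡 = δ(D) and η = δ^{⊗3} ∘ θ. A resolvent
attaches to each `x` in `Q` the functional P_x = δ(l)⁻² η(φ(l ⊗ x)^□ ∧ ·) on `M`
(`Resolvent.functional`), which does not depend on `l`. The resolvent identity then says φ(l ⊗
x)(P_y, P_z) = δ(l) δ(x ∧ y ∧ z ∧ yz). A Laplace expansion (`det_cons_wedgeVec`) and the Pfaffian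
formula for φ(l ⊗ a)^□ (`detPairing_box`) turn this into the key formula P_a ∧ P_b ∧ P_c ∧ P_d ∧ P_e
= F(a, b, c, d, e) η (`Resolvent.det_functional`).

If F(X) ≠ 0 for one quintuple X, the five functionals P_{X_i} are coordinates on `M`, and by
Cramer's rule the coefficients of every P_x in them are quotients of values of F. They depend on `Q`
alone. Hence every resolvent is a lattice in one coordinate space K⁵, and φ and θ can be recovered
from that lattice (`Resolvent.isIso_of_range_coordMap_eq`). Integrality of θ forces P_x(M) ⊆ 𝔡 for
all x, so `M` lies in a lattice M₀ that depends only on `Q` and X (`coordDual`). Let 𝔤 = 𝔠 𝔡² be the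
span of the values of F. By duality M₀ has determinant F(X) 𝔡⁵ 𝔤⁻¹, while a numerical `M` has
determinant F(X) 𝔡³, and the quotient of the two is 𝔠. It remains to count sublattices of index 𝔠.
Such a sublattice is reached through a chain of sublattices of prime index, and one of index 𝔭 is
the kernel of a functional to R/𝔭, which matters only up to units (`ncard_sublattices_le`).

That F ≠ 0 unless `Q_K` is very degenerate is an argument on alternating forms
(`isVeryDegenerate_of_pfaff_eq_zero`). If F = 0, the forms B_a(b, c) = a ∧ b ∧ c ∧ bc all have rank
at most two. A linear space of such forms has a common factor or is supported on three covectors. As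
B_a(a, ·) = 0 and A/K has dimension four, either case yields a non-scalar a with B_a = 0. A
translate of a then spans an ideal, modulo which the product is trivial on a complement of the
constants. So the product on some hyperplane N of A is a symmetric form times a, and F = 0 forces
this form to have rank at most one. N and a hyperplane of N in the radical show that A is very
degenerate. -/

theorem mem_span_one_pair {a x : A} :
    x ∈ Submodule.span K {1, a} ↔ ∃ k l : K, k • 1 + l • a = x := by
  rw [Submodule.mem_span_pair]

theorem exists_notMem_of_finrank_lt [Module.Finite K A] {P : Submodule K A}
    (h : finrank K P < finrank K A) : ∃ x, x ∉ P := by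
  by_contra hc
  push Not at hc
  have : P = ⊤ := by ext; simp [hc]
  rw [this, finrank_top] at h
  exact lt_irrefl _ h

theorem finrank_span_pair_le (a b : A) :
    finrank K (Submodule.span K {a, b} : Submodule K A) ≤ 2 := by
  classical
  have := finrank_span_finset_le_card (R := K) ({a, b} : Finset A)
  rw [Finset.coe_pair] at this
  exact this.trans Finset.card_le_two

theorem finrank_span_singleton_le_one (a : A) : finrank K (K ∙ a) ≤ 1 := by
  have := finrank_span_finset_le_card (R := K) ({a} : Finset A)
  rwa [Finset.coe_singleton, Finset.card_singleton] at this

/-- Multiplication by `a` acts on `A / P`, where `P` is the span of `1` and `a`, and every vector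
there is an eigenvector. Such a map is a scalar. -/
theorem exists_scalar_mod_span [Module.Finite K A] (hA : 4 ≤ finrank K A) (a : A)
    (h : ∀ c, c ∉ Submodule.span K {1, a} → ∃ k : K, a * c - k • c ∈ Submodule.span K {1, a}) :
    ∃ γ : K, ∀ c, a * c - γ • c ∈ Submodule.span K {1, a} := by
  set P := Submodule.span K {1, a} with hP
  have hP2 : finrank K P ≤ 2 := finrank_span_pair_le 1 a
  have h1P : (1 : A) ∈ P := Submodule.subset_span (by simp)
  have haP : a ∈ P := Submodule.subset_span (by simp)
  -- This makes `P` stable under `a`. Otherwise, comparing `c` with `c + a` makes `a * a` a multiple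
  -- modulo `P` of every `c` outside `P`, so that `A = P + K a²` has dimension at most three.
  have haa : a * a ∈ P := by
    by_contra hc
    have key : ∀ c, c ∉ P → ∃ k : K, a * a - k • c ∈ P := by
      intro c hcP
      obtain ⟨k, hk⟩ := h c hcP
      obtain ⟨l, hl⟩ := h (c + a) (fun h' => hcP (by simpa using P.sub_mem h' haP))
      refine ⟨l - k, ?_⟩
      have := P.add_mem (P.sub_mem hl hk) (P.smul_mem l haP)
      convert this using 1
      rw [mul_add, smul_add, sub_smul]; abel
    have hle : finrank K (P ⊔ K ∙ (a * a) : Submodule K A) < finrank K A := by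
      have := Submodule.finrank_add_le_finrank_add_finrank P (K ∙ (a * a))
      have := finrank_span_singleton_le_one (K := K) (a * a)
      omega
    obtain ⟨c, hcP⟩ := exists_notMem_of_finrank_lt hle
    obtain ⟨k, hk⟩ := key c (fun h' => hcP (Submodule.mem_sup_left h'))
    have hk0 : k ≠ 0 := by
      rintro rfl; exact hc (by simpa using hk)
    apply hcP
    have : c = -(k⁻¹ • (a * a - k • c)) + k⁻¹ • (a * a) := by
      rw [smul_sub, smul_smul, inv_mul_cancel₀ hk0, one_smul]; abel
    rw [this]
    exact add_mem (Submodule.mem_sup_left (P.neg_mem (P.smul_mem _ hk)))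
      (Submodule.mem_sup_right (Submodule.smul_mem _ _ (Submodule.mem_span_singleton_self _)))
  have hst : P ≤ P.comap (LinearMap.mulLeft K a) := by
    rw [hP, Submodule.span_le]
    rintro x (rfl | rfl)
    · simpa using haP
    · simpa using haa
  obtain ⟨γ, hγ⟩ := LinearMap.exists_eq_smul_id_of_forall_notLinearIndependent
    (f := P.mapQ P (LinearMap.mulLeft K a) hst) (by
      intro v hv
      obtain ⟨c, rfl⟩ := P.mkQ_surjective v
      by_cases hc : c ∈ P
      · have := hv.ne_zero 0
        simp [hc] at this
      · obtain ⟨k, hk⟩ := h c hc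
        rw [LinearIndependent.pair_iff] at hv
        have := hv (-k) 1 (by
          rw [← Submodule.Quotient.mk_eq_zero P] at hk
          simp only [Submodule.mkQ_apply, Submodule.mapQ_apply, LinearMap.mulLeft_apply, one_smul]
          rw [← hk, Submodule.Quotient.mk_sub, Submodule.Quotient.mk_smul]
          simp [sub_eq_add_neg, add_comm])
        simp at this)
  refine ⟨γ, fun c => ?_⟩
  rw [← Submodule.Quotient.mk_eq_zero P, Submodule.Quotient.mk_sub, sub_eq_zero]
  exact LinearMap.congr_fun hγ (P.mkQ c)

/-- An algebra in which `yz` lies in the span of `1, y, z` has a trivial product on a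
complement of the constants. -/
theorem exists_square_zero_complement [Module.Finite K A] (hA : 4 ≤ finrank K A)
    (h : ∀ b c : A, c ∉ Submodule.span K {1, b} →
      ∃ k : K, b * c - k • c ∈ Submodule.span K {1, b}) :
    ∃ γ : A →ₗ[K] K, γ 1 = 1 ∧ ∀ x y, γ x = 0 → γ y = 0 → x * y = 0 := by
  have : Nontrivial A := by
    by_contra hn
    rw [not_nontrivial_iff_subsingleton] at hn
    have := finrank_zero_of_subsingleton (R := K) (M := A)
    omega
  -- `γ b` is the scalar by which `b` acts modulo the span of `1` and `b`. It is unique, and testing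
  -- on a vector outside the span of `1, b, b'` shows that `γ` is additive.
  choose γ hγ using fun b => exists_scalar_mod_span hA b (h b)
  have hle : ∀ b b' : A, finrank K (Submodule.span K {1, b} ⊔ K ∙ b' : Submodule K A) <
      finrank K A := by
    intro b b'
    have := Submodule.finrank_add_le_finrank_add_finrank (Submodule.span K {1, b}) (K ∙ b')
    have := finrank_span_singleton_le_one (K := K) b'
    have := finrank_span_pair_le (K := K) 1 b
    omega
  have smul_notMem : ∀ {W : Submodule K A} {c : A} {t : K}, c ∉ W → t • c ∈ W → t = 0 := by
    intro W c t hc ht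
    by_contra ht0
    exact hc ((W.smul_mem_iff ht0).mp ht)
  have uniq : ∀ b γ', (∀ c, b * c - γ' • c ∈ Submodule.span K {1, b}) → γ b = γ' := by
    intro b γ' hb
    obtain ⟨c, hc⟩ := exists_notMem_of_finrank_lt (hle b 0)
    have : (γ' - γ b) • c ∈ Submodule.span K {1, b} ⊔ K ∙ (0 : A) := by
      have := Submodule.sub_mem _ (hγ b c) (hb c)
      refine Submodule.mem_sup_left ?_
      convert this using 1
      rw [sub_smul]; abel
    exact (sub_eq_zero.mp (smul_notMem hc this)).symm
  have hmem : ∀ b b' x : A, x ∈ Submodule.span K {1, b'} →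
      x ∈ Submodule.span K {1, b} ⊔ K ∙ b' := by
    intro b b' x hx
    obtain ⟨k, l, rfl⟩ := mem_span_one_pair.mp hx
    exact add_mem (Submodule.mem_sup_left
      (Submodule.smul_mem _ _ (Submodule.subset_span (by simp))))
      (Submodule.mem_sup_right (Submodule.smul_mem _ _ (Submodule.mem_span_singleton_self _)))
  let γl : A →ₗ[K] K :=
    { toFun := γ
      map_add' := by
        intro b b'
        obtain ⟨c, hc⟩ := exists_notMem_of_finrank_lt (hle b b')
        have h1 := hγ (b + b') c
        have h1' : (b + b') * c - γ (b + b') • c ∈ Submodule.span K {1, b} ⊔ K ∙ b' := by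
          obtain ⟨k, l, hkl⟩ := mem_span_one_pair.mp h1
          rw [← hkl, smul_add, ← add_assoc]
          refine add_mem (Submodule.mem_sup_left ?_) (Submodule.mem_sup_right
            (Submodule.smul_mem _ _ (Submodule.mem_span_singleton_self _)))
          exact mem_span_one_pair.mpr ⟨k, l, rfl⟩
        have h2 := Submodule.mem_sup_left (T := K ∙ b') (hγ b c)
        have h3 := hmem b b' _ (hγ b' c)
        have : (γ (b + b') - (γ b + γ b')) • c ∈ Submodule.span K {1, b} ⊔ K ∙ b' := by
          convert Submodule.sub_mem _ (Submodule.add_mem _ h2 h3) h1' using 1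
          rw [sub_smul, add_smul, add_mul]; abel
        exact sub_eq_zero.mp (smul_notMem hc this)
      map_smul' := by
        intro r b
        refine uniq _ _ fun c => ?_
        rcases eq_or_ne r 0 with rfl | hr
        · simp
        have : Submodule.span K {1, b} ≤ Submodule.span K {1, r • b} := by
          rw [Submodule.span_le]
          rintro x (rfl | rfl)
          · exact Submodule.subset_span (by simp)
          · exact (Submodule.smul_mem_iff _ hr).mp (Submodule.subset_span (by simp))
        have := this (Submodule.smul_mem _ r (hγ b c))
        convert this using 1
        simp [smul_sub, mul_smul] }
  have hγ1 : γl 1 = 1 := uniq _ _ fun c => by simp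
  have hmulmem : ∀ x y, γl x = 0 → x * y ∈ Submodule.span K {1, x} := by
    intro x y hx
    have := hγ x y
    have hx' : γ x = 0 := hx
    simpa [hx'] using this
  -- The product lies in the span of `1, x` and in that of `1, y`, and these meet in `K`.
  have hconst : ∀ x y, γl x = 0 → γl y = 0 → y ∉ K ∙ x → ∃ t : K, x * y = t • 1 := by
    intro x y hx hy hxy
    obtain ⟨k, l, hkl⟩ := mem_span_one_pair.mp (hmulmem x y hx)
    obtain ⟨k', l', hkl'⟩ := mem_span_one_pair.mp (hmulmem y x hy)
    rw [mul_comm y x, ← hkl] at hkl'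
    have hk : k' = k := by
      have := congrArg γl hkl'
      simpa [hx, hy, hγ1] using this
    subst hk
    have hl : l' • y = l • x := by simpa using hkl'
    have hl' : l' = 0 := smul_notMem hxy
      (hl ▸ Submodule.smul_mem _ _ (Submodule.mem_span_singleton_self _))
    refine ⟨k', ?_⟩
    rw [← hkl, ← hl, hl']; simp
  have hker : finrank K (LinearMap.ker γl) + 1 = finrank K A := by
    have := LinearMap.finrank_range_add_finrank_ker γl
    have hs : LinearMap.range γl = ⊤ := LinearMap.range_eq_top.mpr
      (fun t => ⟨t • 1, by simp [hγ1]⟩)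
    rw [hs, finrank_top, finrank_self] at this
    omega
  have hex : ∀ x y : A, ∃ z, γl z = 0 ∧ z ∉ Submodule.span K {x, y} := by
    intro x y
    by_contra hc
    push Not at hc
    have h1 := Submodule.finrank_mono (R := K) (s := LinearMap.ker γl)
      (t := Submodule.span K {x, y}) (fun z hz => hc z hz)
    have h2 := finrank_span_pair_le (K := K) x y
    omega
  -- With a third vector `z`, associativity `(xy)z = x(yz)` reads `s z = t x`, hence `s = 0`.
  have hzero : ∀ x y, γl x = 0 → γl y = 0 → x ≠ 0 → y ∉ K ∙ x → x * y = 0 := by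
    intro x y hx hy hx0 hxy
    obtain ⟨z, hz, hzxy⟩ := hex x y
    have hzy : z ∉ K ∙ y := fun h' => hzxy (Submodule.span_mono (by simp) h')
    obtain ⟨s, hs⟩ := hconst x y hx hy hxy
    obtain ⟨t, ht⟩ := hconst y z hy hz hzy
    have e : s • z = t • x := by
      have := mul_assoc x y z
      rwa [hs, ht, smul_mul_assoc, one_mul, mul_smul_comm, mul_one] at this
    have hzx : z ∉ K ∙ x := fun h' => hzxy (Submodule.span_mono (by simp) h')
    have := smul_notMem (t := s) hzx (by
      rw [e]; exact Submodule.smul_mem _ _ (Submodule.mem_span_singleton_self _))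
    rw [hs, this, zero_smul]
  refine ⟨γl, hγ1, fun x y hx hy => ?_⟩
  rcases eq_or_ne x 0 with rfl | hx0
  · simp
  have hsq : x * x = 0 := by
    obtain ⟨z, hz, hzx⟩ := hex x x
    have hzx' : z ∉ K ∙ x := by simpa using hzx
    have h1 := hzero x z hx hz hx0 hzx'
    have h2 := hzero x (z + x) hx (by simp [hx, hz]) hx0 (fun h' => hzx' (by
      simpa using Submodule.sub_mem _ h' (Submodule.mem_span_singleton_self x)))
    rwa [mul_add, h1, zero_add] at h2
  by_cases hyx : y ∈ K ∙ x
  · obtain ⟨t, rfl⟩ := Submodule.mem_span_singleton.mp hyx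
    simp [hsq]
  · exact hzero x y hx hy hx0 hyx

end VeryDegenerate

/-! ### From a non-scalar `a` with `a ∧ b ∧ c ∧ bc = 0` to a very degenerate algebra. -/

section VeryDegenerate

variable {K : Type u} [Field K] {A : Type v} [CommRing A] [Algebra K A]

open Module

section Quad
variable {W : Type v} [AddCommGroup W] [Module K W] (vol : W [⋀^Fin 4]→ₗ[K] K)

theorem vol_add_fst (a a' b c d : W) :
    vol ![a + a', b, c, d] = vol ![a, b, c, d] + vol ![a', b, c, d] := by
  have := vol.map_update_add ![a, b, c, d] 0 a a'
  convert this using 3 <;> ext i <;> fin_cases i <;> rfl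

theorem vol_add_snd (a b b' c d : W) :
    vol ![a, b + b', c, d] = vol ![a, b, c, d] + vol ![a, b', c, d] := by
  have := vol.map_update_add ![a, b, c, d] 1 b b'
  convert this using 3 <;> ext i <;> fin_cases i <;> rfl

theorem vol_add_trd (a b c c' d : W) :
    vol ![a, b, c + c', d] = vol ![a, b, c, d] + vol ![a, b, c', d] := by
  have := vol.map_update_add ![a, b, c, d] 2 c c'
  convert this using 3 <;> ext i <;> fin_cases i <;> rfl

theorem vol_add_fth (a b c d d' : W) :
    vol ![a, b, c, d + d'] = vol ![a, b, c, d] + vol ![a, b, c, d'] := by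
  have := vol.map_update_add ![a, b, c, d] 3 d d'
  convert this using 3 <;> ext i <;> fin_cases i <;> rfl

theorem vol_smul_fst (t : K) (a b c d : W) : vol ![t • a, b, c, d] = t * vol ![a, b, c, d] := by
  have := vol.map_update_smul ![a, b, c, d] 0 t a
  rw [← smul_eq_mul]
  convert this using 3 <;> ext i <;> fin_cases i <;> rfl

theorem vol_smul_snd (t : K) (a b c d : W) : vol ![a, t • b, c, d] = t * vol ![a, b, c, d] := by
  have := vol.map_update_smul ![a, b, c, d] 1 t b
  rw [← smul_eq_mul]
  convert this using 3 <;> ext i <;> fin_cases i <;> rfl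

theorem vol_smul_trd (t : K) (a b c d : W) : vol ![a, b, t • c, d] = t * vol ![a, b, c, d] := by
  have := vol.map_update_smul ![a, b, c, d] 2 t c
  rw [← smul_eq_mul]
  convert this using 3 <;> ext i <;> fin_cases i <;> rfl

theorem vol_smul_fth (t : K) (a b c d : W) : vol ![a, b, c, t • d] = t * vol ![a, b, c, d] := by
  have := vol.map_update_smul ![a, b, c, d] 3 t d
  rw [← smul_eq_mul]
  convert this using 3 <;> ext i <;> fin_cases i <;> rfl

theorem vol_eq_zero_01 (a c d : W) : vol ![a, a, c, d] = 0 :=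
  vol.map_eq_zero_of_eq ![a, a, c, d] (i := 0) (j := 1) rfl (by decide)

theorem vol_eq_zero_02 (a b d : W) : vol ![a, b, a, d] = 0 :=
  vol.map_eq_zero_of_eq ![a, b, a, d] (i := 0) (j := 2) rfl (by decide)

theorem vol_eq_zero_12 (a b d : W) : vol ![a, b, b, d] = 0 :=
  vol.map_eq_zero_of_eq ![a, b, b, d] (i := 1) (j := 2) rfl (by decide)

theorem vol_swap_12 (a b c d : W) : vol ![a, c, b, d] = -vol ![a, b, c, d] := by
  have := vol.map_swap ![a, b, c, d] (i := 1) (j := 2) (by decide)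
  rw [← this]
  congr 1; ext i; fin_cases i <;> rfl

theorem vol_swap_02 (a b c d : W) : vol ![c, b, a, d] = -vol ![a, b, c, d] := by
  have := vol.map_swap ![a, b, c, d] (i := 0) (j := 2) (by decide)
  rw [← this]
  congr 1; ext i; fin_cases i <;> rfl

end Quad

/-- The form `x ∧ y ∧ z ∧ yz`, in terms of a volume form on `A / K`. -/
def volProd (vol : L K A [⋀^Fin 4]→ₗ[K] K) (x y z : A) : K :=
  vol ![toL K A x, toL K A y, toL K A z, toL K A (y * z)]

variable {vol : L K A [⋀^Fin 4]→ₗ[K] K}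

theorem toL_eq_zero {x : A} : toL K A x = 0 ↔ ∃ k : K, k • (1 : A) = x := by
  rw [Submodule.mkQ_apply, Submodule.Quotient.mk_eq_zero, Submodule.mem_one]
  simp [Algebra.algebraMap_eq_smul_one]

theorem exists_dependence_of_vol_eq_zero (hvol : ∀ v, LinearIndependent K v → vol v ≠ 0)
    {x y z t : A} (h : vol ![toL K A x, toL K A y, toL K A z, toL K A t] = 0) :
    ∃ k g₀ g₁ g₂ g₃ : K, k • (1 : A) = g₀ • x + g₁ • y + g₂ • z + g₃ • t ∧
      (g₀ ≠ 0 ∨ g₁ ≠ 0 ∨ g₂ ≠ 0 ∨ g₃ ≠ 0) := by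
  have hn : ¬ LinearIndependent K ![toL K A x, toL K A y, toL K A z, toL K A t] :=
    fun h' => hvol _ h' h
  rw [Fintype.not_linearIndependent_iff] at hn
  obtain ⟨g, hg, i, hi⟩ := hn
  simp only [Fin.sum_univ_four] at hg
  have hg' : toL K A (g 0 • x + g 1 • y + g 2 • z + g 3 • t) = 0 := by
    simp only [map_add, map_smul]; exact hg
  obtain ⟨k, hk⟩ := toL_eq_zero.mp hg'
  refine ⟨k, g 0, g 1, g 2, g 3, hk, ?_⟩
  fin_cases i <;> simp_all

/-- A nonzero trivector on the four-dimensional space `A / K` has a nonzero wedge with some vector.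
So `1, a, c, t` are dependent, and `t` must occur in the relation because `1, a, c` are independent.
-/
theorem exists_smul_sub_mem_of_vol_eq_zero (hA : finrank K A = 5)
    (hvol : ∀ v, LinearIndependent K v → vol v ≠ 0) {a c t : A}
    (ha : toL K A a ≠ 0)
    (h : ∀ x, vol ![x, toL K A a, toL K A c, toL K A t] = 0) (hc : c ∉ Submodule.span K {1, a}) :
    ∃ k : K, t - k • c ∈ Submodule.span K {1, a} := by
  by_contra! hn
  have : Module.Finite K A := Module.finite_of_finrank_pos (by omega)
  have : Nontrivial A := Module.nontrivial_of_finrank_pos (R := K) (by omega)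
  have hL : 4 ≤ finrank K (L K A) := by
    have h1 : finrank K (L K A) + finrank K (1 : Submodule K A) = finrank K A :=
      Submodule.finrank_quotient_add_finrank (1 : Submodule K A)
    have h2 : finrank K (1 : Submodule K A) ≤ 1 := by
      rw [Submodule.one_eq_span]; exact finrank_span_singleton_le_one 1
    omega
  have hli : LinearIndependent K ![toL K A a, toL K A c, toL K A t] := by
    rw [Fintype.linearIndependent_iff]
    intro g hg
    simp only [Fin.sum_univ_three] at hg
    have hg' : toL K A (g 0 • a + g 1 • c + g 2 • t) = 0 := by
      simp only [map_add, map_smul]; exact hg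
    obtain ⟨k, hk⟩ := toL_eq_zero.mp hg'
    have hg2 : g 2 = 0 := by
      by_contra h2
      apply hn (-((g 2)⁻¹ * g 1))
      rw [mem_span_one_pair]
      refine ⟨(g 2)⁻¹ * k, -((g 2)⁻¹ * g 0), ?_⟩
      rw [mul_smul, hk]
      simp only [smul_add, smul_smul, inv_mul_cancel₀ h2, neg_smul, one_smul]
      abel
    have hg1 : g 1 = 0 := by
      by_contra h1
      apply hc
      rw [mem_span_one_pair]
      refine ⟨(g 1)⁻¹ * k, -((g 1)⁻¹ * g 0), ?_⟩
      rw [mul_smul, hk, hg2]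
      simp only [smul_add, smul_smul, inv_mul_cancel₀ h1, neg_smul, one_smul, zero_smul, smul_zero]
      abel
    have hg0 : g 0 = 0 := by
      rw [hg1, hg2, zero_smul, zero_smul, add_zero, add_zero] at hg'
      rw [map_smul] at hg'
      exact (smul_eq_zero.mp hg').resolve_right ha
    intro i
    fin_cases i <;> assumption
  obtain ⟨x, hx⟩ := exists_linearIndependent_cons_of_lt_finrank hli (by omega)
  exact hvol _ hx (h x)

/-- If `a ∧ b ∧ c ∧ bc = 0` for all `b` and `c`, then a translate of `a` by a scalar spans an
ideal. -/
theorem exists_mul_mem_span (hA : finrank K A = 5)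
    (hvol : ∀ v, LinearIndependent K v → vol v ≠ 0) {a : A} (ha : toL K A a ≠ 0)
    (h : ∀ b c, volProd vol a b c = 0) :
    ∃ a' : A, toL K A a' = toL K A a ∧ ∀ c, a' * c ∈ K ∙ a' := by
  have : Module.Finite K A := Module.finite_of_finrank_pos (by omega)
  -- Polarization: replacing `b` by `b + a` isolates the term with `ac` in place of `bc`.
  have h1 : ∀ x c, vol ![x, toL K A a, toL K A c, toL K A (a * c)] = 0 := by
    intro x c
    obtain ⟨b, rfl⟩ := (1 : Submodule K A).mkQ_surjective x
    have e := h (b + a) c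
    have e' := h b c
    simp only [volProd, map_add, add_mul, vol_add_snd, vol_add_fth, vol_eq_zero_01] at e e'
    rw [e', zero_add, zero_add, add_zero] at e
    have := vol.map_swap ![toL K A a, toL K A b, toL K A c, toL K A (a * c)]
      (i := 0) (j := 1) (by decide)
    rw [e, neg_zero] at this
    convert this using 2
    ext i; fin_cases i <;> rfl
  obtain ⟨γ, hγ⟩ := exists_scalar_mod_span (K := K) (by omega) a fun c hc =>
    exists_smul_sub_mem_of_vol_eq_zero hA hvol ha (fun x => h1 x c) hc
  set a' := a - γ • 1 with ha'
  have hL : toL K A a' = toL K A a := by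
    rw [ha', map_sub, sub_eq_self]
    exact toL_eq_zero.mpr ⟨γ, rfl⟩
  have hP : ∀ c, ∃ k l : K, k • 1 + l • a' = a' * c := by
    intro c
    obtain ⟨k, l, hkl⟩ := mem_span_one_pair.mp (hγ c)
    refine ⟨k + l * γ, l, ?_⟩
    rw [ha', sub_mul, smul_mul_assoc, one_mul, ← hkl, smul_sub, smul_smul, add_smul]
    abel
  refine ⟨a', hL, fun c => ?_⟩
  obtain ⟨k, l, hkl⟩ := hP c
  by_cases hk : k = 0
  · rw [← hkl, hk, zero_smul, zero_add]
    exact Submodule.smul_mem _ _ (Submodule.mem_span_singleton_self _)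
  -- A constant term `k ≠ 0` makes `a'` a unit, and then `A = a' A` lies in the span of `1, a'`.
  exfalso
  have hu : a' * (k⁻¹ • (c - l • 1)) = 1 := by
    rw [mul_smul_comm, mul_sub, ← hkl, mul_smul_comm, mul_one, add_sub_cancel_right, smul_smul,
      inv_mul_cancel₀ hk, one_smul]
  have htop : Submodule.span K {1, a'} = ⊤ := by
    rw [eq_top_iff]
    intro x _
    obtain ⟨k', l', h'⟩ := hP (k⁻¹ • (c - l • 1) * x)
    rw [mem_span_one_pair]
    refine ⟨k', l', ?_⟩
    rw [h', ← mul_assoc, hu, one_mul]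
  have := finrank_span_pair_le (K := K) 1 a'
  rw [htop, finrank_top] at this
  omega

theorem finrank_inf_ker [Module.Finite K A] {n : ℕ} {W : Submodule K A} {g : A →ₗ[K] K}
    (hW : finrank K W = n + 1) {w : A} (hw : w ∈ W) (hg : g w ≠ 0) :
    finrank K (W ⊓ LinearMap.ker g : Submodule K A) = n := by
  have h1 := LinearMap.finrank_range_add_finrank_ker g
  have h2 : LinearMap.range g = ⊤ := LinearMap.range_eq_top.mpr (fun t => ⟨(t / g w) • w, by
    simp [hg]⟩)
  rw [h2, finrank_top, finrank_self] at h1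
  have h3 := Submodule.finrank_sup_add_finrank_inf_eq W (LinearMap.ker g)
  have h4 : LinearMap.ker g < W ⊔ LinearMap.ker g := by
    refine lt_of_le_of_ne le_sup_right fun h => hg ?_
    have : w ∈ LinearMap.ker g := h ▸ Submodule.mem_sup_left hw
    simpa using this
  have h5 := Submodule.finrank_lt_finrank_of_lt h4
  have h6 := Submodule.finrank_le (W ⊔ LinearMap.ker g)
  omega

/-- The pentaquadratic form, in terms of a volume form on `A / K`. -/
def pfaff {X : Type*} (f : X → X → X → K) (a b c d e : X) : K :=
  f a b c * f a d e + f a b d * f a e c + f a b e * f a c d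

/-- Evaluate F at `(x, y, z, y + x, z + x)`. Wedging with `x` reduces `y + x` and `z + x` to `y` and
`z`, so that only the products notice the shift. What is left is a 2×2 minor of the form `ℓ(xy)`,
times the square of a volume that is nonzero because `1, x, y, z, a` are independent. -/
theorem mul_form_minor (hvol : ∀ v, LinearIndependent K v → vol v ≠ 0)
    (hF : ∀ a b c d e : A, pfaff (volProd vol) a b c d e = 0) {a : A} {γ ℓ : A →ₗ[K] K}
    (hγ1 : γ 1 = 1) (hγa : γ a = 0) (hℓ : ∀ x y, γ x = 0 → γ y = 0 → x * y = ℓ (x * y) • a)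
    {x y z : A} (hx : γ x = 0) (hy : γ y = 0) (hz : γ z = 0)
    (hli : LinearIndependent K ![z, y, x, a]) :
    ℓ (x * x) * ℓ (y * z) = ℓ (x * y) * ℓ (x * z) := by
  have hV : vol ![toL K A x, toL K A y, toL K A z, toL K A a] ≠ 0 := by
    rw [vol_swap_02, neg_ne_zero]
    refine hvol _ ?_
    rw [Fintype.linearIndependent_iff] at hli ⊢
    intro g hg
    apply hli
    have hg' : toL K A (g 0 • z + g 1 • y + g 2 • x + g 3 • a) = 0 := by
      simp only [map_add, map_smul]; rw [Fin.sum_univ_four] at hg; exact hg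
    obtain ⟨k, hk⟩ := toL_eq_zero.mp hg'
    have := congrArg γ hk
    simp only [map_add, map_smul, hx, hy, hz, hγa, hγ1, mul_zero, add_zero, smul_eq_mul,
      mul_one] at this
    rw [this, zero_smul] at hk
    rw [Fin.sum_univ_four]
    exact hk.symm
  have hf : ∀ p q : A, γ p = 0 → γ q = 0 → volProd vol x p q =
      ℓ (p * q) * vol ![toL K A x, toL K A p, toL K A q, toL K A a] := by
    intro p q hp hq
    rw [volProd, ← vol_smul_fth, ← map_smul, ← hℓ p q hp hq]
  have hyx : γ (y + x) = 0 := by rw [map_add, hx, hy, add_zero]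
  have hzx : γ (z + x) = 0 := by rw [map_add, hx, hz, add_zero]
  have key := hF x y z (y + x) (z + x)
  rw [pfaff, hf y z hy hz, hf _ _ hyx hzx, hf _ _ hy hyx, hf _ _ hzx hz, hf _ _ hy hzx,
    hf _ _ hz hyx] at key
  simp only [map_add, vol_add_snd, vol_add_trd, vol_eq_zero_01, vol_eq_zero_02,
    vol_eq_zero_12, vol_swap_12 vol (toL K A x) (toL K A y) (toL K A z)] at key
  simp only [mul_add, add_mul, map_add, mul_comm y x, mul_comm z x, mul_comm z y] at key
  have : (ℓ (x * x) * ℓ (y * z) - ℓ (x * y) * ℓ (x * z)) *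
      vol ![toL K A x, toL K A y, toL K A z, toL K A a] ^ 2 = 0 := by
    linear_combination key
  rcases mul_eq_zero.mp this with h | h
  · exact sub_eq_zero.mp h
  · exact absurd (pow_eq_zero_iff (two_ne_zero) |>.mp h) hV

/-- On `N = ker γ` the product is the symmetric form `ℓ(xy)` times `a`. The form has rank at most
one, by associativity if `a² ≠ 0` and by the minors otherwise. A hyperplane of `N` inside its
radical serves as `Q₃`, and `N` as `Q₄`. -/
theorem isVeryDegenerate_of_mul_form (hA : finrank K A = 5)
    (hvol : ∀ v, LinearIndependent K v → vol v ≠ 0)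
    (hF : ∀ a b c d e : A, pfaff (volProd vol) a b c d e = 0) {a : A} {γ ℓ : A →ₗ[K] K}
    (hγ1 : γ 1 = 1) (hγa : γ a = 0) (hℓa : ℓ a = 1)
    (hprod : ∀ x y, γ x = 0 → γ y = 0 → x * y = ℓ (x * y) • a) : IsVeryDegenerate K A := by
  have : Module.Finite K A := Module.finite_of_finrank_pos (by omega)
  have ha0 : a ≠ 0 := by rintro rfl; simp at hℓa
  set N := LinearMap.ker γ with hN
  have hNd : finrank K N = 4 := by
    have := finrank_inf_ker (K := K) (A := A) (n := 4) (W := ⊤) (g := γ) (by rw [finrank_top, hA])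
      (w := 1) trivial (by rw [hγ1]; exact one_ne_zero)
    rwa [top_inf_eq] at this
  have concl : ∀ w, γ w = 0 → ℓ (w * w) ≠ 0 ∨ (∃ v, γ v = 0 ∧ ℓ (w * v) ≠ 0) →
      (∀ y z, γ y = 0 → γ z = 0 → ℓ (w * y) = 0 → ℓ (y * z) = 0) → IsVeryDegenerate K A := by
    intro w hw hne hz
    obtain ⟨v, hv, hwv⟩ : ∃ v, γ v = 0 ∧ ℓ (w * v) ≠ 0 := hne.elim (fun h => ⟨w, hw, h⟩) id
    refine ⟨N ⊓ LinearMap.ker (ℓ ∘ₗ LinearMap.mulLeft K w), N, inf_le_left, ?_, hNd, ?_⟩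
    · exact finrank_inf_ker hNd (w := v) hv hwv
    · rintro x hx y ⟨hy, hy'⟩
      rw [hprod x y hx hy, mul_comm, hz y x hy hx hy', zero_smul]
  by_cases haa : a * a = 0
  swap
  -- Here associativity suffices: `ay = 0` gives `ℓ(yz) a² = ayz = 0`.
  · refine concl a hγa (Or.inl ?_) ?_
    · intro h0
      rw [hprod a a hγa hγa, h0, zero_smul] at haa
      exact haa rfl
    · intro y z hy hz hay
      have h1 : a * y = 0 := by rw [hprod a y hγa hy, hay, zero_smul]
      have h2 : ℓ (y * z) • (a * a) = 0 := by
        rw [← mul_smul_comm, ← hprod y z hy hz, ← mul_assoc, h1, zero_mul]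
      exact (smul_eq_zero.mp h2).resolve_right haa
  -- If `ax = ta` then `a x² = t² a`, while `x²` is a multiple of `a` and `a² = 0`; so `t = 0`. Thus
  -- `a` is in the radical of the form.
  have haN : ∀ x, γ x = 0 → ℓ (a * x) = 0 := by
    intro x hx
    have h1 : a * x = ℓ (a * x) • a := hprod a x hγa hx
    have h2 : (ℓ (a * x) * ℓ (a * x)) • a = 0 := by
      have h3 : a * (x * x) = 0 := by
        rw [hprod x x hx hx, mul_smul_comm, haa, smul_zero]
      rw [← mul_assoc, h1, smul_mul_assoc, h1, smul_smul] at h3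
      simpa [hℓa] using h3
    simpa using (smul_eq_zero.mp h2).resolve_right ha0
  have haN' : ∀ x, γ x = 0 → ℓ (x * a) = 0 := fun x hx => by rw [mul_comm]; exact haN x hx
  have minor := @mul_form_minor K _ A _ _ vol hvol hF a γ ℓ hγ1 hγa hprod
  have hpick : ∀ x y : A, γ x = 0 → γ y = 0 → x ∉ K ∙ a → y ∉ Submodule.span K {x, a} →
      ∃ z, γ z = 0 ∧ z ∉ Submodule.span K {y, x, a} ∧
        ∀ z, z ∉ Submodule.span K {y, x, a} → LinearIndependent K ![z, y, x, a] := by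
    intro x y hx hy hxa hyx
    have hli : LinearIndependent K ![y, x, a] := by
      refine linearIndependent_finCons.mpr ⟨linearIndependent_finCons.mpr
        ⟨linearIndependent_unique_iff.mpr ha0, ?_⟩, ?_⟩
      · simpa using hxa
      · rwa [show Set.range ![x, a] = {x, a} by simp only [Matrix.range_cons,
          Matrix.range_empty, Set.union_empty, Set.singleton_union]]
    have hr : Set.range ![y, x, a] = {y, x, a} := by
      simp only [Matrix.range_cons, Matrix.range_empty, Set.union_empty, Set.singleton_union]
    have h3 := finrank_span_eq_card hli
    rw [hr, Fintype.card_fin] at h3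
    obtain ⟨z, hz, hz'⟩ : ∃ z, z ∈ N ∧ z ∉ Submodule.span K {y, x, a} := by
      by_contra! hc
      have := Submodule.finrank_mono (R := K) (s := N) (t := Submodule.span K {y, x, a}) hc
      omega
    exact ⟨z, hz, hz', fun z hz => linearIndependent_finCons.mpr ⟨hli, by rwa [hr]⟩⟩
  -- A functional that vanishes on the part of `N` outside a subspace not containing `N` vanishes on
  -- `N`: translate by `z₀`. It removes the independence hypothesis of the minors.
  have hker : ∀ (g : A →ₗ[K] K) (W : Submodule K A) (z₀ : A), γ z₀ = 0 → z₀ ∉ W →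
      (∀ z, γ z = 0 → z ∉ W → g z = 0) → ∀ z, γ z = 0 → g z = 0 := by
    intro g W z₀ h0 h0W hg z hz
    by_cases hzW : z ∈ W
    · have h1 := hg (z + z₀) (by rw [map_add, hz, h0, add_zero])
        (fun h' => h0W (by simpa using W.sub_mem h' hzW))
      rwa [map_add, hg z₀ h0 h0W, add_zero] at h1
    · exact hg z hz hzW
  by_cases hx : ∃ x, γ x = 0 ∧ ℓ (x * x) ≠ 0
  · obtain ⟨x, hx, hxx⟩ := hx
    refine concl x hx (Or.inl hxx) fun y z hy hz hxy => ?_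
    have hxa : x ∉ K ∙ a := fun h' => by
      obtain ⟨t, rfl⟩ := Submodule.mem_span_singleton.mp h'
      simp [haa] at hxx
    by_cases hyx : y ∈ Submodule.span K {x, a}
    · obtain ⟨k, l, rfl⟩ := Submodule.mem_span_pair.mp hyx
      rw [mul_add, map_add, mul_smul_comm, mul_smul_comm, map_smul, map_smul, haN' x hx, smul_zero,
        add_zero] at hxy
      rw [(smul_eq_zero.mp hxy).resolve_right hxx, zero_smul, zero_add, smul_mul_assoc, map_smul,
        haN z hz, smul_zero]
    · obtain ⟨z₀, hz₀, hz₀', hli⟩ := hpick x y hx hy hxa hyx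
      refine hker (ℓ ∘ₗ LinearMap.mulLeft K y) _ z₀ hz₀ hz₀' (fun z hz hz' => ?_) z hz
      have := minor hx hy hz (hli z hz')
      rw [hxy, zero_mul] at this
      exact (mul_eq_zero.mp this).resolve_left hxx
  -- A nonzero form with all `ℓ(xx) = 0` could exist only in characteristic two. The minors exclude
  -- it: they give `ℓ(xy) ℓ(xz) = 0` for generic `z`.
  · push Not at hx
    have hall : ∀ x y, γ x = 0 → γ y = 0 → ℓ (x * y) = 0 := by
      intro x y hx' hy
      by_contra hxy
      have hxa : x ∉ K ∙ a := fun h' => by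
        obtain ⟨t, rfl⟩ := Submodule.mem_span_singleton.mp h'
        simp [haN y hy] at hxy
      have hyx : y ∉ Submodule.span K {x, a} := fun h' => by
        obtain ⟨k, l, rfl⟩ := Submodule.mem_span_pair.mp h'
        simp [mul_add, hx x hx', haN' x hx'] at hxy
      obtain ⟨z₀, hz₀, hz₀', hli⟩ := hpick x y hx' hy hxa hyx
      refine hxy (hker (ℓ ∘ₗ LinearMap.mulLeft K x) _ z₀ hz₀ hz₀' (fun z hz hz' => ?_) y hy)
      have := minor hx' hy hz (hli z hz')
      rw [hx x hx', zero_mul, zero_eq_mul] at this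
      exact this.resolve_left hxy
    obtain ⟨g, hg⟩ : ∃ g : A →ₗ[K] K, g a ≠ 0 := ⟨ℓ, by rw [hℓa]; exact one_ne_zero⟩
    refine ⟨N ⊓ LinearMap.ker g, N, inf_le_left, finrank_inf_ker hNd (w := a) hγa hg, hNd, ?_⟩
    rintro x hx y ⟨hy, -⟩
    rw [hprod x y hx hy, hall x y hx hy, zero_smul]

/-- Modulo the ideal `I = K a`, the relation `a ∧ b ∧ c ∧ bc = 0` puts `bc` in the span of `1, b, c`
or makes `1, b, c` dependent. So `A / I` has a square-zero complement of the constants, and its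
preimage `N` satisfies `N N ⊆ K a`. -/
theorem isVeryDegenerate_of_mul_mem_span (hA : finrank K A = 5)
    (hvol : ∀ v, LinearIndependent K v → vol v ≠ 0)
    (hF : ∀ a b c d e : A, pfaff (volProd vol) a b c d e = 0) {a : A} (ha : toL K A a ≠ 0)
    (hmul : ∀ c, a * c ∈ K ∙ a) (h : ∀ b c, volProd vol a b c = 0) : IsVeryDegenerate K A := by
  have : Module.Finite K A := Module.finite_of_finrank_pos (by omega)
  have ha0 : a ≠ 0 := fun h0 => ha (by rw [h0, map_zero])
  let I : Ideal A := Ideal.span {a}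
  have hI : ∀ x, x ∈ I ↔ ∃ t : K, t • a = x := by
    intro x
    rw [Ideal.mem_span_singleton']
    constructor
    · rintro ⟨c, rfl⟩
      rw [mul_comm]
      exact Submodule.mem_span_singleton.mp (hmul c)
    · rintro ⟨t, rfl⟩
      exact ⟨t • 1, by simp⟩
  let π := (Ideal.Quotient.mkₐ K I).toLinearMap
  have hπ0 : ∀ x, π x = 0 ↔ ∃ t : K, t • a = x := fun x => by
    rw [← hI]; exact Ideal.Quotient.eq_zero_iff_mem
  have hπs : Function.Surjective π := Ideal.Quotient.mkₐ_surjective K I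
  have hπm : ∀ x y, π (x * y) = π x * π y := fun x y => map_mul (Ideal.Quotient.mkₐ K I) x y
  have hπ1 : π 1 = 1 := map_one (Ideal.Quotient.mkₐ K I)
  have hdim : 4 ≤ finrank K (A ⧸ I) := by
    have h1 := LinearMap.finrank_range_add_finrank_ker π
    rw [LinearMap.range_eq_top.mpr hπs, finrank_top] at h1
    have h2 : LinearMap.ker π ≤ K ∙ a := fun x hx => by
      rw [Submodule.mem_span_singleton]; exact (hπ0 x).mp hx
    have h3 := Submodule.finrank_mono h2
    have := finrank_span_singleton_le_one (K := K) a
    omega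
  have : Module.Finite K (A ⧸ I) := Module.Finite.of_surjective π hπs
  obtain ⟨γ', hγ1', hγ'⟩ := exists_square_zero_complement (K := K) (A := A ⧸ I) hdim (by
    intro b c hbc
    obtain ⟨b, rfl⟩ := hπs b
    obtain ⟨c, rfl⟩ := hπs c
    obtain ⟨k, g₀, g₁, g₂, g₃, hk, hne⟩ := exists_dependence_of_vol_eq_zero hvol (h b c)
    have hk' := congrArg π hk
    have hπa : π a = 0 := (hπ0 a).mpr ⟨1, one_smul _ _⟩
    simp only [map_add, map_smul, hπm, hπ1, hπa, smul_zero, zero_add] at hk'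
    have hspan : ∀ k l : K, k • 1 + l • π b ∈ Submodule.span K {1, π b} := fun k l =>
      mem_span_one_pair.mpr ⟨k, l, rfl⟩
    by_cases h3 : g₃ = 0
    · rw [h3, zero_smul, add_zero] at hk'
      by_cases h2 : g₂ = 0
      · rw [h2, zero_smul, add_zero] at hk'
        by_cases h1 : g₁ = 0
        · exfalso
          have h0 : g₀ ≠ 0 := by simp_all
          rw [h1, h2, h3] at hk
          apply ha
          refine toL_eq_zero.mpr ⟨g₀⁻¹ * k, ?_⟩
          rw [mul_smul, hk]
          simp [smul_smul, h0]
        · refine ⟨g₁⁻¹ * k, ?_⟩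
          have hb : π b = (g₁⁻¹ * k) • 1 := by
            rw [mul_smul, hk', smul_smul, inv_mul_cancel₀ h1, one_smul]
          rw [hb, smul_mul_assoc, one_mul, sub_self]
          exact zero_mem _
      · exfalso
        apply hbc
        have : π c = (g₂⁻¹ * k) • 1 + (-(g₂⁻¹ * g₁)) • π b := by
          rw [mul_smul, hk']
          simp only [smul_add, smul_smul, inv_mul_cancel₀ h2, neg_smul, one_smul]
          abel
        rw [this]; exact hspan _ _
    · refine ⟨-(g₃⁻¹ * g₂), ?_⟩
      have : π b * π c - (-(g₃⁻¹ * g₂)) • π c = (g₃⁻¹ * k) • 1 + (-(g₃⁻¹ * g₁)) • π b := by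
        rw [mul_smul, hk']
        simp only [smul_add, smul_smul, inv_mul_cancel₀ h3, neg_smul, one_smul]
        abel
      rw [this]; exact hspan _ _)
  set γ := γ' ∘ₗ π with hγd
  have hγ1 : γ 1 = 1 := by rw [hγd, LinearMap.comp_apply, hπ1, hγ1']
  have hγa : γ a = 0 := by
    rw [hγd, LinearMap.comp_apply, (hπ0 a).mpr ⟨1, one_smul _ _⟩, map_zero]
  obtain ⟨ℓ, hℓa⟩ : ∃ ℓ : A →ₗ[K] K, ℓ a = 1 := by
    obtain ⟨ℓ, hℓ⟩ : ∃ ℓ : A →ₗ[K] K, ℓ a ≠ 0 := by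
      by_contra! hc
      exact ha0 ((Module.forall_dual_apply_eq_zero_iff K a).mp hc)
    exact ⟨(ℓ a)⁻¹ • ℓ, by simp [hℓ]⟩
  have hprod : ∀ x y, γ x = 0 → γ y = 0 → x * y = ℓ (x * y) • a := by
    intro x y hx hy
    have := hγ' _ _ hx hy
    rw [← hπm] at this
    obtain ⟨t, ht⟩ := (hπ0 _).mp this
    rw [← ht, map_smul, hℓa, smul_eq_mul, mul_one]
  exact isVeryDegenerate_of_mul_form hA hvol hF hγ1 hγa hℓa hprod

theorem isVeryDegenerate_of_volProd_eq_zero (hA : finrank K A = 5)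
    (hvol : ∀ v, LinearIndependent K v → vol v ≠ 0)
    (hF : ∀ a b c d e : A, pfaff (volProd vol) a b c d e = 0)
    {a : A} (ha : toL K A a ≠ 0) (h : ∀ b c, volProd vol a b c = 0) :
    IsVeryDegenerate K A := by
  obtain ⟨a', ha', hmul⟩ := exists_mul_mem_span hA hvol ha h
  refine isVeryDegenerate_of_mul_mem_span hA hvol hF (ha' ▸ ha) hmul fun b c => ?_
  have := h b c
  rwa [volProd, ← ha'] at this

end VeryDegenerate

/-! ### Linear families of alternating forms of rank at most two. -/

section VeryDegenerate

variable {K : Type u} [Field K] {A : Type v} [CommRing A] [Algebra K A]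

open Module

/-- A linear family of alternating forms `B a` of rank at most two, with `B a a = 0`, vanishes for
some `a` that is not a scalar. -/
theorem exists_eq_zero_of_pfaff_eq_zero (hA : finrank K A = 5) (B : A →ₗ[K] (A → A → K))
    (alt : ∀ a b c, B a b c = -B a c b) (alt' : ∀ a b, B a b b = 0) (self : ∀ a c, B a a c = 0)
    (one : ∀ a b c, toL K A b = 0 → B a b c = 0)
    (pf : ∀ a b c d e, B a b c * B a d e - B a b d * B a c e + B a b e * B a c d = 0) :
    ∃ a, toL K A a ≠ 0 ∧ B a = 0 := by
  by_contra! hB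
  have : Module.Finite K A := Module.finite_of_finrank_pos (by omega)
  have hadd : ∀ a a' b c, B (a + a') b c = B a b c + B a' b c := fun a a' b c => by
    rw [map_add]; rfl
  -- The Plücker relation `B a ∧ B a = 0`, polarized in `a`: `B a ∧ B a' = 0`.
  have mix : ∀ a a' b c d e, B a b c * B a' d e + B a' b c * B a d e - B a b d * B a' c e
      - B a' b d * B a c e + B a b e * B a' c d + B a' b e * B a c d = 0 := by
    intro a a' b c d e
    have h := pf (a + a') b c d e
    simp only [hadd] at h
    linear_combination h - pf a b c d e - pf a' b c d e
  have hsmall : ∀ g : A →ₗ[K] (Fin 3 → K), ∃ a, toL K A a ≠ 0 ∧ g a = 0 := by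
    intro g
    by_contra! hc
    have h1 := LinearMap.finrank_range_add_finrank_ker g
    have h2 : finrank K (LinearMap.range g) ≤ 3 := by
      simpa using Submodule.finrank_le (LinearMap.range g)
    have h3 : LinearMap.ker g ≤ K ∙ (1 : A) := fun x hx => by
      by_contra hx1
      refine hc x (fun h0 => hx1 ?_) hx
      exact Submodule.mem_span_singleton.mpr (toL_eq_zero.mp h0)
    have h4 := Submodule.finrank_mono h3
    have := finrank_span_singleton_le_one (K := K) (1 : A)
    omega
  obtain ⟨a₀, ha₀, -⟩ := hsmall 0
  obtain ⟨p, q, hpq⟩ : ∃ p q, B a₀ p q ≠ 0 := by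
    by_contra! hc
    exact hB a₀ ha₀ (by ext b c; exact hc b c)
  -- With this normalization `B a₁ = u ∧ w`. The relation of `B a` with `B a₁` gives `B a = s u ∧ w
  -- + u ∧ β + α ∧ w` (`E2`), and the other relations say that the pairs `(α a, β a)` form a linear
  -- space of 2-row matrices of rank at most one (`E3`, `E4`).
  obtain ⟨a₁, h1⟩ : ∃ a₁, B a₁ p q = 1 := ⟨(B a₀ p q)⁻¹ • a₀, by
    rw [map_smul]; exact inv_mul_cancel₀ hpq⟩
  obtain ⟨u, hu⟩ : ∃ u : A → K, ∀ x, B a₁ p x = u x := ⟨_, fun _ => rfl⟩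
  obtain ⟨w, hw⟩ : ∃ w : A → K, ∀ x, B a₁ q x = w x := ⟨_, fun _ => rfl⟩
  obtain ⟨s, hs⟩ : ∃ s : A → K, ∀ a, B a p q = s a := ⟨_, fun _ => rfl⟩
  obtain ⟨α, hα⟩ : ∃ α : A → A → K, ∀ a x, B a p x = α a x + s a * u x :=
    ⟨fun a x => B a p x - s a * u x, fun _ _ => by ring⟩
  obtain ⟨β, hβ⟩ : ∃ β : A → A → K, ∀ a x, B a q x = β a x + s a * w x :=
    ⟨fun a x => B a q x - s a * w x, fun _ _ => by ring⟩
  have hup : u p = 0 := by rw [← hu, alt']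
  have huq : u q = 1 := by rw [← hu, h1]
  have hwp : w p = -1 := by rw [← hw, alt, h1]
  have hwq : w q = 0 := by rw [← hw, alt']
  have E1 : ∀ b c, B a₁ b c = u b * w c - u c * w b := by
    intro b c
    have h := pf a₁ p q b c
    rw [h1, hu, hu, hw, hw] at h
    linear_combination h
  have E2 : ∀ a b c, B a b c = s a * (u b * w c - u c * w b) + (u b * β a c - u c * β a b) +
      (α a b * w c - α a c * w b) := by
    intro a b c
    have h := mix a₁ a p q b c
    rw [h1, hs, E1, hu, hu, hw, hw, hα, hα, hβ, hβ] at h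
    linear_combination h
  have E3 : ∀ a b c, α a b * β a c - α a c * β a b = 0 := by
    intro a b c
    have h := pf a p q b c
    rw [hs, E2, hα, hα, hβ, hβ] at h
    linear_combination -h
  have E4 : ∀ a a' b c, α a b * β a' c + α a' b * β a c - α a c * β a' b - α a' c * β a b = 0 := by
    intro a a' b c
    have h := mix a a' p q b c
    rw [hs, hs, E2, E2, hα, hα, hα, hα, hβ, hβ, hβ, hβ] at h
    linear_combination -h
  -- Proportional rows give all `B a` the common factor `f = μ u - κ w`. If `B a = f ∧ g` and `B a a
  -- = 0`, then `f(a) B a = 0`, so `f` vanishes at every non-scalar `a`. Its values at `p` and `q`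
  -- are `κ` and `μ`.
  have hcommon : ∀ κ μ : K, (∀ a x, μ * α a x = κ * β a x) → κ = 0 ∧ μ = 0 := by
    intro κ μ h
    have hv : ∀ a, toL K A a ≠ 0 → μ * u a - κ * w a = 0 := by
      intro a ha
      obtain ⟨b, c, hbc⟩ : ∃ b c, B a b c ≠ 0 := by
        by_contra! hc
        exact hB a ha (by ext b c; exact hc b c)
      have e : (μ * u a - κ * w a) * B a b c = 0 := by
        have e1 := self a b
        have e2 := self a c
        have e3 := h a a
        have e4 := h a b
        have e5 := h a c
        have e6 := E2 a b c
        rw [E2] at e1 e2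
        rw [e6]
        linear_combination (μ * u b - κ * w b) * e2 - (μ * u c - κ * w c) * e1 -
          (u b * w c - u c * w b) * e3 + (u a * w c - u c * w a) * e4 -
          (u a * w b - u b * w a) * e5
      exact (mul_eq_zero.mp e).resolve_right hbc
    have hp := hv p fun h0 => by
      have := one a₁ p q h0
      rw [h1] at this; exact one_ne_zero this
    have hq := hv q fun h0 => by
      have := one a₁ q p h0
      rw [alt, h1] at this; exact one_ne_zero (neg_eq_zero.mp this)
    rw [hup, hwp] at hp
    rw [huq, hwq] at hq
    exact ⟨by linear_combination hp, by linear_combination hq⟩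
  by_cases hα0 : ∀ a x, α a x = 0
  · exact one_ne_zero (hcommon 0 1 fun a x => by rw [hα0]; ring).2
  push Not at hα0
  obtain ⟨a₂, r, hr⟩ := hα0
  obtain ⟨t, ht⟩ : ∃ t, β a₂ r = t * α a₂ r := ⟨β a₂ r / α a₂ r, by field_simp⟩
  have F1 : ∀ x, β a₂ x = t * α a₂ x := by
    intro x
    have := E3 a₂ r x
    rw [ht] at this
    refine mul_left_cancel₀ hr ?_
    linear_combination this
  have F2 : ∀ a x, α a₂ r * (β a x - t * α a x) = (β a r - t * α a r) * α a₂ x := by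
    intro a x
    have := E4 a₂ a r x
    rw [F1, F1] at this
    linear_combination this
  -- Either `β = t α` for all `a`, which is a common factor, or some `a₃` breaks the proportion and
  -- forces all rows to be multiples of the single covector `α a₂`.
  by_cases hτ : ∀ a, β a r - t * α a r = 0
  · refine one_ne_zero (hcommon 1 t fun a x => ?_).1
    have := F2 a x
    rw [hτ, zero_mul] at this
    have := (mul_eq_zero.mp this).resolve_left hr
    linear_combination -this
  push Not at hτ
  obtain ⟨a₃, h3⟩ := hτ
  have F3 : ∀ x, α a₂ r * α a₃ x = α a₃ r * α a₂ x := by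
    intro x
    have e1 := E3 a₃ r x
    have e2 := F2 a₃ x
    refine mul_left_cancel₀ h3 ?_
    linear_combination -α a₂ r * e1 + α a₃ r * e2
  have F4 : ∀ a x, α a₂ r * α a x = α a r * α a₂ x := by
    intro a x
    have e1 := E4 a₃ a r x
    have e2 := F2 a x
    have e3 := F2 a₃ x
    have e4 := F3 x
    refine mul_left_cancel₀ h3 ?_
    linear_combination -α a₂ r * e1 + α a₃ r * e2 + α a r * e3 - (β a r - t * α a r) * e4
  -- Now every `B a` lies in `⋀²` of the span of `u`, `w` and `α a₂`, so that three values determine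
  -- it. They vanish together for some non-scalar `a`, since `A / K` has dimension four.
  let g : A →ₗ[K] (Fin 3 → K) :=
    { toFun := fun a => ![B a p q, B a p r, B a q r]
      map_add' := fun a a' => by ext i; fin_cases i <;> exact hadd a a' _ _
      map_smul' := fun c a => by
        have : ∀ b d, B (c • a) b d = c * B a b d := fun b d => by rw [map_smul]; rfl
        ext i; fin_cases i <;> exact this _ _ }
  obtain ⟨a, ha, hga⟩ := hsmall g
  have g0 : s a = 0 := (hs a).symm.trans (congrFun hga 0)
  have g1 : α a r = 0 := by
    have : B a p r = 0 := congrFun hga 1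
    rw [hα, g0] at this
    linear_combination this
  have g2 : β a r = 0 := by
    have : B a q r = 0 := congrFun hga 2
    rw [hβ, g0] at this
    linear_combination this
  have k1 : ∀ x, α a x = 0 := fun x => by
    have := F4 a x
    rw [g1, zero_mul] at this
    exact (mul_eq_zero.mp this).resolve_left hr
  have k2 : ∀ x, β a x = 0 := fun x => by
    have := F2 a x
    rw [g1, g2, k1] at this
    simpa [hr] using this
  refine hB a ha ?_
  ext b c
  rw [E2, g0, k1, k1, k2, k2]
  simp

/-- An algebra of dimension five whose pentaquadratic form vanishes is very degenerate. -/
theorem isVeryDegenerate_of_pfaff_eq_zero (hA : finrank K A = 5) {vol : L K A [⋀^Fin 4]→ₗ[K] K}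
    (hvol : ∀ v, LinearIndependent K v → vol v ≠ 0)
    (hF : ∀ a b c d e : A, pfaff (volProd vol) a b c d e = 0) : IsVeryDegenerate K A := by
  let B : A →ₗ[K] (A → A → K) :=
    { toFun := fun a => volProd vol a
      map_add' := fun a a' => by
        ext b c; simp only [volProd, map_add, vol_add_fst, Pi.add_apply]
      map_smul' := fun t a => by
        ext b c; simp only [volProd, map_smul, vol_smul_fst]; rfl }
  have hBd : ∀ a b c, B a b c = volProd vol a b c := fun _ _ _ => rfl
  have alt : ∀ a b c, B a b c = -B a c b := fun a b c => by
    rw [hBd, hBd, volProd, volProd, vol_swap_12, mul_comm]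
  obtain ⟨a, ha, hBa⟩ := exists_eq_zero_of_pfaff_eq_zero hA B alt
    (fun a b => by rw [hBd, volProd, vol_eq_zero_12])
    (fun a c => by rw [hBd, volProd, vol_eq_zero_01])
    (fun a b c hb => by
      rw [hBd, volProd, hb]
      exact vol.map_coord_zero 1 rfl)
    (fun a b c d e => by
      have := hF a b c d e
      rw [pfaff, ← hBd, ← hBd, ← hBd, ← hBd, ← hBd, ← hBd, alt a e c] at this
      linear_combination this)
  exact isVeryDegenerate_of_volProd_eq_zero hA hvol hF ha fun b c => by
    rw [← hBd, hBa]; rfl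

end VeryDegenerate

/-! ## Lattices in a coordinate space -/

section DetLattice

open scoped nonZeroDivisors
open Matrix

section Det
variable {R : Type u} [CommRing R] {K : Type k} [Field K] [Algebra R K] {n : ℕ}

/-- The `R`-submodule of `K` that is generated by the determinants of the `n`-tuples in `N`. -/
def detLattice (N : Submodule R (Fin n → K)) : Submodule R K :=
  Submodule.span R {t | ∃ x : Fin n → Fin n → K, (∀ i, x i ∈ N) ∧ t = (Matrix.of x).det}

theorem det_mem_detLattice {N : Submodule R (Fin n → K)} {x : Fin n → Fin n → K}
    (hx : ∀ i, x i ∈ N) : (Matrix.of x).det ∈ detLattice N :=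
  Submodule.subset_span ⟨x, hx, rfl⟩

theorem detLattice_le {N : Submodule R (Fin n → K)} {P : Submodule R K} :
    detLattice N ≤ P ↔ ∀ x : Fin n → Fin n → K, (∀ i, x i ∈ N) → (Matrix.of x).det ∈ P := by
  rw [detLattice, Submodule.span_le]
  exact ⟨fun h x hx => h ⟨x, hx, rfl⟩, fun h t ⟨x, hx, ht⟩ => ht ▸ h x hx⟩

theorem detLattice_mono {N N' : Submodule R (Fin n → K)} (h : N ≤ N') :
    detLattice N ≤ detLattice N' :=
  detLattice_le.mpr fun _ hx => det_mem_detLattice fun i => h (hx i)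

/-- Cramer's rule in vector form. It stands in for expansion in a basis, as lattices over `R` need
not be free. -/
theorem det_smul_eq_sum (x : Fin n → Fin n → K) (y : Fin n → K) :
    (Matrix.of x).det • y = ∑ i, (Matrix.of (Function.update x i y)).det • x i := by
  have h := mulVec_cramer (Matrix.of x)ᵀ y
  rw [det_transpose] at h
  rw [← h]
  ext j
  simp only [mulVec, dotProduct, transpose_apply, of_apply, Finset.sum_apply, Pi.smul_apply,
    smul_eq_mul, cramer_apply]
  refine Finset.sum_congr rfl fun i _ => ?_
  rw [mul_comm, updateCol_transpose, det_transpose]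
  rfl

end Det

variable {R : Type u} [CommRing R] [IsDedekindDomain R] {K : Type k} [Field K] [Algebra R K]
  [IsFractionRing R K] {n : ℕ}

/-- If all generators lay in `pJ`, cancelling the invertible `J` would give `1 ≤ p`. Arguments at a
prime thereby avoid localization: an element of `J` outside `pJ` is a generator at `p`. -/
theorem exists_notMem_mul {J : FractionalIdeal R⁰ K} (hJ : J ≠ 0) {X : Set K}
    (hX : (J : Submodule R K) = Submodule.span R X) {p : Ideal R} (hp : p ≠ ⊤) :
    ∃ x ∈ X, x ∉ (p : FractionalIdeal R⁰ K) * J := by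
  by_contra! hc
  have h1 : J ≤ (p : FractionalIdeal R⁰ K) * J := by
    rw [← FractionalIdeal.coe_le_coe, hX, Submodule.span_le]
    exact hc
  have h2 : (1 : FractionalIdeal R⁰ K) ≤ p := by
    have := mul_le_mul_left h1 J⁻¹
    rwa [mul_assoc, mul_inv_cancel₀ hJ, mul_one] at this
  rw [← FractionalIdeal.coeIdeal_top, FractionalIdeal.coeIdeal_le_coeIdeal] at h2
  exact hp (top_le_iff.mp h2)

theorem exists_coeIdeal_mul_eq {I J : FractionalIdeal R⁰ K} (hJ : J ≠ 0) (h : I ≤ J) :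
    ∃ b : Ideal R, I = b * J := by
  have h1 : I * J⁻¹ ≤ 1 := by
    have := mul_le_mul_left h J⁻¹
    rwa [mul_inv_cancel₀ hJ] at this
  obtain ⟨b, hb⟩ := FractionalIdeal.le_one_iff_exists_coeIdeal.mp h1
  exact ⟨b, by rw [hb, mul_assoc, inv_mul_cancel₀ hJ, mul_one]⟩

theorem exists_spanSingleton_eq_mul {J : FractionalIdeal R⁰ K} (hJ : J ≠ 0) {x : K} (hx : x ∈ J)
    {p : Ideal R} (hxp : x ∉ (p : FractionalIdeal R⁰ K) * J) :
    ∃ b : Ideal R, ¬ b ≤ p ∧ FractionalIdeal.spanSingleton R⁰ x = b * J := by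
  obtain ⟨b, hb⟩ := exists_coeIdeal_mul_eq hJ (FractionalIdeal.spanSingleton_le_iff_mem.mpr hx)
  refine ⟨b, fun hle => hxp ?_, hb⟩
  rw [← FractionalIdeal.spanSingleton_le_iff_mem, hb]
  exact mul_le_mul_left (FractionalIdeal.coeIdeal_le_coeIdeal K |>.mpr hle) J

theorem mul_le_mul_iff_of_ne_zero {I I' J : FractionalIdeal R⁰ K} (hJ : J ≠ 0) :
    I * J ≤ I' * J ↔ I ≤ I' := by
  refine ⟨fun h => ?_, fun h => mul_le_mul_left h J⟩
  have := mul_le_mul_left h J⁻¹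
  rwa [mul_assoc, mul_assoc, mul_inv_cancel₀ hJ, mul_one, mul_one] at this

/-- A lattice has a basis up to multiplication by an element outside of a given prime. -/
theorem exists_local_basis {N : Submodule R (Fin n → K)} {J : FractionalIdeal R⁰ K} (hJ : J ≠ 0)
    (hN : (J : Submodule R K) = detLattice N) {p : Ideal R} (hp : p ≠ ⊤) :
    ∃ x : Fin n → Fin n → K, (∀ i, x i ∈ N) ∧ (Matrix.of x).det ≠ 0 ∧
      ∃ s ∉ p, ∀ y ∈ N, ∃ c : Fin n → R, s • y = ∑ i, c i • x i := by
  -- Take a tuple whose determinant generates `J` at `p`, that is, `(det x) = bJ` with `b` not in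
  -- `p`. For `s` in `b` but not in `p`, the Cramer coefficients of `s • y` become integral.
  obtain ⟨_, ⟨x, hx, rfl⟩, hxp⟩ := exists_notMem_mul hJ hN hp
  have hxJ : (Matrix.of x).det ∈ J := by
    rw [← FractionalIdeal.mem_coe, hN]; exact det_mem_detLattice hx
  obtain ⟨b, hb, hbJ⟩ := exists_spanSingleton_eq_mul hJ hxJ hxp
  obtain ⟨s, hsb, hsp⟩ := Set.not_subset.mp hb
  have h0 : (Matrix.of x).det ≠ 0 := fun h => hxp (h ▸ FractionalIdeal.zero_mem _)
  refine ⟨x, hx, h0, s, hsp, fun y hy => ?_⟩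
  have hc : ∀ i, ∃ c : R, c • (Matrix.of x).det = s • (Matrix.of (Function.update x i y)).det := by
    intro i
    rw [← FractionalIdeal.mem_spanSingleton R⁰, hbJ, Algebra.smul_def]
    refine FractionalIdeal.mul_mem_mul (FractionalIdeal.mem_coeIdeal_of_mem _ hsb) ?_
    rw [← FractionalIdeal.mem_coe, hN]
    refine det_mem_detLattice fun j => ?_
    by_cases hj : j = i
    · subst hj; simpa using hy
    · simpa [hj] using hx j
  choose c hc using hc
  refine ⟨c, ?_⟩
  have h1 : (Matrix.of x).det • (s • y) = (Matrix.of x).det • ∑ i, c i • x i := by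
    rw [smul_comm, det_smul_eq_sum, Finset.smul_sum, Finset.smul_sum]
    refine Finset.sum_congr rfl fun i _ => ?_
    rw [← smul_assoc, ← hc, smul_comm, smul_assoc]
  exact smul_right_injective _ h0 h1

theorem det_mem_pow {𝔞 : FractionalIdeal R⁰ K} {A : Matrix (Fin n) (Fin n) K}
    (hA : ∀ i j, A i j ∈ 𝔞) : A.det ∈ 𝔞 ^ n := by
  have hprod : ∀ (s : Finset (Fin n)) (f : Fin n → K), (∀ i, f i ∈ 𝔞) →
      ∏ i ∈ s, f i ∈ 𝔞 ^ s.card := by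
    intro s f hf
    induction s using Finset.induction_on with
    | empty => simp
    | insert a s ha ih =>
      rw [Finset.prod_insert ha, Finset.card_insert_of_notMem ha, pow_succ']
      exact FractionalIdeal.mul_mem_mul (hf a) ih
  rw [det_apply, ← FractionalIdeal.mem_coe]
  refine Submodule.sum_mem _ fun σ _ => ?_
  have := hprod Finset.univ (fun i => A (σ i) i) fun i => hA _ _
  rw [Finset.card_univ, Fintype.card_fin] at this
  rcases Int.units_eq_one_or (Equiv.Perm.sign σ) with h | h <;> rw [h]
  · rw [one_smul]; exact this
  · rw [Units.neg_smul, one_smul]; exact Submodule.neg_mem _ this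

/-- The vectors that pair with `N` into `𝔞`. -/
def dualLattice (N : Submodule R (Fin n → K)) (𝔞 : FractionalIdeal R⁰ K) :
    Submodule R (Fin n → K) where
  carrier := {y | ∀ x ∈ N, x ⬝ᵥ y ∈ 𝔞}
  zero_mem' x _ := by rw [dotProduct_zero]; exact FractionalIdeal.zero_mem _
  add_mem' h h' x hx := by
    rw [dotProduct_add]; exact Submodule.add_mem (𝔞 : Submodule R K) (h x hx) (h' x hx)
  smul_mem' r y h x hx := by
    rw [dotProduct_smul]; exact Submodule.smul_mem (𝔞 : Submodule R K) r (h x hx)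

/-- One inclusion holds because `det x · det y` is the determinant of the matrix of pairings, which
has entries in `𝔞`. The other is checked at each prime, on the dual basis of a local basis. -/
theorem detLattice_dualLattice {N : Submodule R (Fin n → K)} {J 𝔞 : FractionalIdeal R⁰ K}
    (hJ : J ≠ 0) (hN : (J : Submodule R K) = detLattice N) (h𝔞 : 𝔞 ≠ 0) :
    detLattice (dualLattice N 𝔞) = ((𝔞 ^ n * J⁻¹ : FractionalIdeal R⁰ K) : Submodule R K) := by
  have h𝔞n : 𝔞 ^ n ≠ 0 := pow_ne_zero n h𝔞
  have hle : detLattice (dualLattice N 𝔞) ≤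
      ((𝔞 ^ n * J⁻¹ : FractionalIdeal R⁰ K) : Submodule R K) := by
    refine detLattice_le.mpr fun y hy => ?_
    have h1 : FractionalIdeal.spanSingleton R⁰ (Matrix.of y).det * J ≤ 𝔞 ^ n := by
      rw [FractionalIdeal.spanSingleton_mul_le_iff]
      intro z hz
      rw [← FractionalIdeal.mem_coe, hN] at hz
      rw [← FractionalIdeal.mem_coe]
      induction hz using Submodule.span_induction with
      | mem z hz =>
        obtain ⟨x, hx, rfl⟩ := hz
        rw [mul_comm, ← det_transpose (Matrix.of y), ← det_mul, FractionalIdeal.mem_coe]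
        exact det_mem_pow fun i j => hy j (x i) (hx i)
      | zero => rw [mul_zero]; exact zero_mem _
      | add z z' _ _ h h' => rw [mul_add]; exact add_mem h h'
      | smul r z _ h => rw [mul_smul_comm]; exact Submodule.smul_mem _ r h
    have h2 := mul_le_mul_left h1 J⁻¹
    rw [mul_assoc, mul_inv_cancel₀ hJ, mul_one] at h2
    exact FractionalIdeal.spanSingleton_le_iff_mem.mp h2
  refine le_antisymm hle ?_
  obtain ⟨𝔪, h𝔪⟩ : ∃ 𝔪 : FractionalIdeal R⁰ K, (𝔪 : Submodule R K) =
      detLattice (dualLattice N 𝔞) := ⟨⟨_, FractionalIdeal.isFractional_of_le hle⟩, rfl⟩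
  rw [← h𝔪, FractionalIdeal.coe_le_coe] at hle ⊢
  obtain ⟨I, hI⟩ := exists_coeIdeal_mul_eq (mul_ne_zero h𝔞n (inv_ne_zero hJ)) hle
  suffices I = ⊤ by rw [hI, this, FractionalIdeal.coeIdeal_top, one_mul]
  by_contra hI0
  -- At a prime `p` containing `I`, the columns of the inverse of a local basis, scaled by `s a`,
  -- belong to the dual. Their determinant gives `(s a)ⁿ ∈ I 𝔞ⁿ ⊆ p 𝔞ⁿ`, although `s` is not in `p`
  -- and `a` generates `𝔞` at `p`.
  obtain ⟨p, hp, hIp⟩ := Ideal.exists_le_maximal I hI0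
  obtain ⟨x, hxN, hx0, s, hs, hsx⟩ := exists_local_basis hJ hN hp.ne_top
  obtain ⟨a, ha𝔞, hap⟩ := exists_notMem_mul (X := (𝔞 : Set K)) h𝔞
    (Submodule.span_eq (𝔞 : Submodule R K)).symm hp.ne_top
  obtain ⟨b, hb, hb𝔞⟩ := exists_spanSingleton_eq_mul h𝔞 ha𝔞 hap
  set X := Matrix.of x with hX
  have hXu : IsUnit X.det := isUnit_iff_ne_zero.mpr hx0
  let Y : Fin n → Fin n → K := fun j i => X⁻¹ i j
  have hmem : ∀ j, (s • a) • Y j ∈ dualLattice N 𝔞 := by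
    intro j y hy
    obtain ⟨c, hc⟩ := hsx y hy
    have h1 : ∀ i, x i ⬝ᵥ Y j = (1 : Matrix (Fin n) (Fin n) K) i j := by
      intro i
      rw [← mul_nonsing_inv X hXu]
      rfl
    have h2 : s • (y ⬝ᵥ Y j) = algebraMap R K (c j) := by
      rw [← smul_dotProduct, hc, sum_dotProduct]
      simp only [smul_dotProduct, h1]
      simp [Matrix.one_apply, Algebra.smul_def]
    have e : y ⬝ᵥ ((s • a) • Y j) = c j • a := by
      rw [dotProduct_smul, Algebra.smul_def (c j), ← h2, smul_eq_mul, smul_mul_assoc,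
        smul_mul_assoc, mul_comm]
    rw [e]
    exact Submodule.smul_mem (𝔞 : Submodule R K) _ ha𝔞
  have h1 : (s • a) ^ n * X.det⁻¹ ∈ 𝔪 := by
    rw [← FractionalIdeal.mem_coe, h𝔪]
    have := det_mem_detLattice hmem
    convert this using 1
    have e : (Matrix.of fun j => (s • a) • Y j) = (s • a) • (X⁻¹)ᵀ := rfl
    rw [e, det_smul, Fintype.card_fin, det_transpose, det_nonsing_inv, Ring.inverse_eq_inv']
  have h2 : (s • a) ^ n ∈ 𝔪 * J := by
    have hXJ : X.det ∈ J := by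
      rw [← FractionalIdeal.mem_coe, hN]; exact det_mem_detLattice hxN
    have := FractionalIdeal.mul_mem_mul h1 hXJ
    rwa [mul_assoc, inv_mul_cancel₀ hx0, mul_one] at this
  have h3 : ((Ideal.span {s} ^ n * b ^ n : Ideal R) : FractionalIdeal R⁰ K) * 𝔞 ^ n ≤
      (p : FractionalIdeal R⁰ K) * 𝔞 ^ n := by
    rw [FractionalIdeal.coeIdeal_mul, FractionalIdeal.coeIdeal_pow, FractionalIdeal.coeIdeal_pow,
      mul_assoc, ← mul_pow (b : FractionalIdeal R⁰ K), ← hb𝔞,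
      FractionalIdeal.coeIdeal_span_singleton, ← mul_pow,
      FractionalIdeal.spanSingleton_mul_spanSingleton, FractionalIdeal.spanSingleton_pow,
      ← Algebra.smul_def, FractionalIdeal.spanSingleton_le_iff_mem]
    rw [hI, mul_assoc, mul_assoc, inv_mul_cancel₀ hJ, mul_one] at h2
    exact mul_le_mul_left (FractionalIdeal.coeIdeal_le_coeIdeal K |>.mpr hIp) (𝔞 ^ n) h2
  rw [mul_le_mul_iff_of_ne_zero h𝔞n, FractionalIdeal.coeIdeal_le_coeIdeal] at h3
  rcases hp.isPrime.mul_le.mp h3 with h | h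
  · exact hs (Ideal.span_singleton_le_iff_mem _ |>.mp (hp.isPrime.le_of_pow_le h))
  · exact hb (hp.isPrime.le_of_pow_le h)

/-- Nested lattices with the same determinant agree. -/
theorem eq_of_detLattice_eq {M N : Submodule R (Fin n → K)} (hMN : M ≤ N)
    {J : FractionalIdeal R⁰ K} (hJ : J ≠ 0) (hM : (J : Submodule R K) = detLattice M)
    (hN : (J : Submodule R K) = detLattice N) : M = N := by
  refine le_antisymm hMN fun y hy => ?_
  -- By Cramer's rule `det x • y` is a combination of vectors of `M`. Its coefficients are
  -- determinants of tuples in `N`, so they lie in `J`, and a factor in `J⁻¹` makes them integral.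
  have key : ∀ a ∈ (J : Submodule R K), ∀ b ∈ J⁻¹, (a * b) • y ∈ M := by
    intro a ha b hb
    rw [hM] at ha
    induction ha using Submodule.span_induction with
    | mem a ha =>
      obtain ⟨x, hx, rfl⟩ := ha
      rw [mul_comm, mul_smul, det_smul_eq_sum, Finset.smul_sum]
      refine Submodule.sum_mem _ fun i _ => ?_
      have hd : (Matrix.of (Function.update x i y)).det ∈ J := by
        rw [← FractionalIdeal.mem_coe, hN]
        refine det_mem_detLattice fun j => ?_
        by_cases hj : j = i
        · subst hj; simpa using hy
        · simpa [hj] using hMN (hx j)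
      have h1 := FractionalIdeal.mul_mem_mul hb hd
      rw [inv_mul_cancel₀ hJ, FractionalIdeal.mem_one_iff] at h1
      obtain ⟨r, hr⟩ := h1
      rw [smul_smul, ← hr, algebraMap_smul]
      exact M.smul_mem r (hx i)
    | zero => rw [zero_mul, zero_smul]; exact zero_mem _
    | add z z' _ _ h h' => rw [add_mul, add_smul]; exact add_mem h h'
    | smul r z _ h => rw [smul_mul_assoc, smul_assoc]; exact Submodule.smul_mem _ r h
  have h1 : (1 : K) ∈ J * J⁻¹ := by
    rw [mul_inv_cancel₀ hJ]; exact FractionalIdeal.one_mem_one R⁰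
  rw [← FractionalIdeal.mem_coe, FractionalIdeal.coe_mul] at h1
  have h2 : ∀ z ∈ (J : Submodule R K) * ((J⁻¹ : FractionalIdeal R⁰ K) : Submodule R K),
      z • y ∈ M := fun z hz => by
    induction hz using Submodule.mul_induction_on' with
    | mem_mul_mem a ha b hb => exact key a ha b hb
    | add a _ b _ h h' => rw [add_smul]; exact add_mem h h'
  rw [← one_smul K y]
  exact h2 1 h1

end DetLattice

/-! ### Counting the sublattices of a given index. -/

section Counting

open scoped nonZeroDivisors
open Matrix

variable {R : Type u} [CommRing R] [IsDedekindDomain R] {K : Type k} [Field K] [Algebra R K]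
  [IsFractionRing R K] {n : ℕ}

/-- The kernel of a functional on a lattice, as a sublattice. -/
def kerLattice {N : Submodule R (Fin n → K)} {V : Type*} [AddCommGroup V] [Module R V]
    (ℓ : N →ₗ[R] V) : Submodule R (Fin n → K) := (LinearMap.ker ℓ).map N.subtype

theorem mem_kerLattice {N : Submodule R (Fin n → K)} {V : Type*} [AddCommGroup V] [Module R V]
    {ℓ : N →ₗ[R] V} {y : Fin n → K} : y ∈ kerLattice ℓ ↔ ∃ h : y ∈ N, ℓ ⟨y, h⟩ = 0 := by
  simp [kerLattice]

/-- A row on which `ℓ` is nonzero clears the other rows into the kernel; scaling that row by an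
element of `p` shows that the determinant contains `pJ`. As `p` is maximal the determinant is `pJ`
or `J`, and `J` would make the kernel all of `N`. -/
theorem detLattice_kerLattice {N : Submodule R (Fin n → K)} {J : FractionalIdeal R⁰ K} (hJ : J ≠ 0)
    (hN : (J : Submodule R K) = detLattice N) {p : Ideal R} (hp : p.IsMaximal)
    {ℓ : N →ₗ[R] R ⧸ p} (hℓ : ℓ ≠ 0) :
    (((p : FractionalIdeal R⁰ K) * J : FractionalIdeal R⁰ K) : Submodule R K) =
      detLattice (kerLattice ℓ) := by
  have hHN : kerLattice ℓ ≤ N := fun y hy => (mem_kerLattice.mp hy).1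
  have hle := detLattice_mono hHN
  rw [← hN] at hle
  obtain ⟨𝔥, h𝔥⟩ : ∃ 𝔥 : FractionalIdeal R⁰ K, (𝔥 : Submodule R K) = detLattice (kerLattice ℓ) :=
    ⟨⟨_, FractionalIdeal.isFractional_of_le hle⟩, rfl⟩
  rw [← h𝔥, FractionalIdeal.coe_le_coe] at hle
  rw [← h𝔥, FractionalIdeal.coeToSubmodule_inj]
  obtain ⟨I, hI⟩ := exists_coeIdeal_mul_eq hJ hle
  have hsmul : ∀ t ∈ p, ∀ v : R ⧸ p, t • v = 0 := fun t ht v => by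
    rw [Algebra.smul_def, Ideal.Quotient.algebraMap_eq, Ideal.Quotient.eq_zero_iff_mem.mpr ht,
      zero_mul]
  have hsc : ∀ a b : R ⧸ p, a ≠ 0 → ∃ r : R, b = r • a := by
    let := Ideal.Quotient.field p
    intro a b ha
    obtain ⟨r, hr⟩ := Ideal.Quotient.mk_surjective (b / a)
    refine ⟨r, ?_⟩
    rw [Algebra.smul_def, Ideal.Quotient.algebraMap_eq, hr, div_mul_cancel₀ _ ha]
  have hp𝔥 : (p : FractionalIdeal R⁰ K) * J ≤ 𝔥 := by
    rw [FractionalIdeal.mul_le]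
    intro z hz d hd
    rw [FractionalIdeal.mem_coeIdeal] at hz
    obtain ⟨π, hπ, rfl⟩ := hz
    rw [← FractionalIdeal.mem_coe, hN] at hd
    rw [← FractionalIdeal.mem_coe, h𝔥, ← Algebra.smul_def]
    induction hd using Submodule.span_induction with
    | mem d hd =>
      obtain ⟨y, hy, rfl⟩ := hd
      by_cases hy0 : ∀ i, ℓ ⟨y i, hy i⟩ = 0
      · exact Submodule.smul_mem _ _ (det_mem_detLattice fun i => mem_kerLattice.mpr ⟨hy i, hy0 i⟩)
      push Not at hy0
      obtain ⟨i, hi⟩ := hy0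
      choose r hr using fun j => hsc _ (ℓ ⟨y j, hy j⟩) hi
      let h : Fin n → Fin n → K := Function.update (fun j => y j - r j • y i) i (y i)
      have hdet : (Matrix.of y).det = (Matrix.of h).det := by
        refine det_eq_of_forall_row_eq_smul_add_const
          (fun j => if j = i then 0 else algebraMap R K (r j)) i (if_pos rfl) fun j k => ?_
        by_cases hj : j = i
        · subst hj; simp [h]
        · simp [h, hj, Algebra.smul_def]
      have hdet' : π • (Matrix.of h).det =
          (Matrix.of (Function.update h i (π • y i))).det := by
        have := det_updateRow_smul (Matrix.of h) i (algebraMap R K π) (y i)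
        rw [Algebra.smul_def]
        have e1 : (Matrix.of h).updateRow i (y i) = Matrix.of h := by
          have : (Matrix.of h) i = y i := by
            change h i = y i
            exact Function.update_self ..
          rw [← this, updateRow_eq_self]
        rw [e1, algebraMap_smul] at this
        exact this.symm
      rw [hdet, hdet']
      refine det_mem_detLattice fun j => ?_
      by_cases hj : j = i
      · subst hj
        rw [Function.update_self]
        refine mem_kerLattice.mpr ⟨N.smul_mem _ (hy j), ?_⟩
        have : (⟨π • y j, N.smul_mem _ (hy j)⟩ : N) = π • ⟨y j, hy j⟩ := rfl
        rw [this, map_smul, hsmul π hπ]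
      · rw [Function.update_of_ne hj]
        simp only [h, Function.update_of_ne hj]
        refine mem_kerLattice.mpr ⟨N.sub_mem (hy j) (N.smul_mem _ (hy i)), ?_⟩
        have : (⟨y j - r j • y i, N.sub_mem (hy j) (N.smul_mem _ (hy i))⟩ : N) =
          ⟨y j, hy j⟩ - r j • ⟨y i, hy i⟩ := rfl
        rw [this, map_sub, map_smul, ← hr, sub_self]
    | zero => rw [smul_zero]; exact zero_mem _
    | add z z' _ _ h h' => rw [smul_add]; exact add_mem h h'
    | smul r z _ h => rw [smul_comm]; exact Submodule.smul_mem _ r h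
  rw [hI, mul_le_mul_iff_of_ne_zero hJ, FractionalIdeal.coeIdeal_le_coeIdeal] at hp𝔥
  have hIt : I ≠ ⊤ := by
    rintro rfl
    rw [FractionalIdeal.coeIdeal_top, one_mul] at hI
    have := eq_of_detLattice_eq hHN hJ (hI ▸ h𝔥) hN
    apply hℓ
    ext ⟨y, hy⟩
    rw [← this] at hy
    exact (mem_kerLattice.mp hy).2
  rw [hI, hp.eq_of_le hIt hp𝔥]

/-- The sublattices of prime index `p` are hyperplanes modulo `p`. -/
theorem ncard_kerLattice_le {N : Submodule R (Fin n → K)} {J : FractionalIdeal R⁰ K} (hJ : J ≠ 0)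
    (hN : (J : Submodule R K) = detLattice N) {p : Ideal R} (hp : p.IsMaximal)
    [Finite (R ⧸ p)] :
    {H | ∃ ℓ : N →ₗ[R] R ⧸ p, ℓ ≠ 0 ∧ H = kerLattice ℓ}.Finite ∧
    {H | ∃ ℓ : N →ₗ[R] R ⧸ p, ℓ ≠ 0 ∧ H = kerLattice ℓ}.ncard ≤
      ∑ i ∈ Finset.range n, Nat.card (R ⧸ p) ^ i := by
  classical
  let := Ideal.Quotient.field p
  have := Fintype.ofFinite (R ⧸ p)
  obtain ⟨x, hx, -, s, hs, hsx⟩ := exists_local_basis hJ hN hp.ne_top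
  set S := {H | ∃ ℓ : N →ₗ[R] R ⧸ p, ℓ ≠ 0 ∧ H = kerLattice ℓ} with hS
  choose ℓ hℓ0 hℓ using fun H : S => H.2
  have hdet : ∀ (f g : N →ₗ[R] R ⧸ p) (c d : R ⧸ p),
      (∀ i, c * f ⟨x i, hx i⟩ = d * g ⟨x i, hx i⟩) → ∀ y, c * f y = d * g y := by
    intro f g c d h y
    obtain ⟨e, he⟩ := hsx y y.2
    have hy : s • y = ∑ i, e i • (⟨x i, hx i⟩ : N) := by
      ext1; rw [Submodule.coe_smul, he]; simp
    have hs0 : algebraMap R (R ⧸ p) s ≠ 0 := by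
      rw [Ideal.Quotient.algebraMap_eq, Ne, Ideal.Quotient.eq_zero_iff_mem]; exact hs
    refine mul_left_cancel₀ hs0 ?_
    rw [← Algebra.smul_def, ← Algebra.smul_def, ← mul_smul_comm, ← mul_smul_comm, ← map_smul,
      ← map_smul, hy]
    simp only [map_sum, map_smul, Finset.mul_sum, mul_smul_comm, h]
  -- A hyperplane with a unit gives the values of a scaled functional on the local basis. They
  -- determine it because `s` is invertible modulo `p`. Injectivity yields `|S| (q - 1) ≤ qⁿ - 1`.
  let E : S × (R ⧸ p)ˣ → {v : Fin n → R ⧸ p // v ≠ 0} := fun a =>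
    ⟨fun i => (a.2 : R ⧸ p) * ℓ a.1 ⟨x i, hx i⟩, fun h0 => hℓ0 a.1 (by
      ext y
      have := hdet (ℓ a.1) 0 a.2 1 (fun i => by simpa using congrFun h0 i) y
      simpa using this)⟩
  have hE : Function.Injective E := by
    rintro ⟨H, c⟩ ⟨H', c'⟩ h
    have h1 : ∀ y, (c : R ⧸ p) * ℓ H y = c' * ℓ H' y :=
      hdet _ _ _ _ fun i => congrFun (congrArg Subtype.val h) i
    have h2 : ∀ y, ℓ H y = 0 ↔ ℓ H' y = 0 := by
      intro y
      have := h1 y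
      constructor
      · intro h; rw [h, mul_zero, zero_eq_mul] at this
        exact this.resolve_left c'.ne_zero
      · intro h; rw [h, mul_zero, mul_eq_zero] at this
        exact this.resolve_left c.ne_zero
    have h3 : H = H' := by
      apply Subtype.ext
      rw [hℓ H, hℓ H']
      ext y
      simp only [mem_kerLattice, h2]
    subst h3
    obtain ⟨y, hy⟩ : ∃ y, ℓ H y ≠ 0 := by
      by_contra! h; exact hℓ0 H (by ext y; exact h y)
    have := mul_right_cancel₀ hy (h1 y)
    rw [Units.ext this]
  have hfin : Finite (S × (R ⧸ p)ˣ) := Finite.of_injective E hE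
  have hSfin : Finite S := Finite.of_injective (fun H : S => (H, (1 : (R ⧸ p)ˣ)))
    fun _ _ h => (Prod.ext_iff.mp h).1
  refine ⟨Set.toFinite S, ?_⟩
  have h1 := Nat.card_le_card_of_injective E hE
  set q := Nat.card (R ⧸ p) with hq
  have hq1 : 1 < q := Finite.one_lt_card
  have h2 : Nat.card {v : Fin n → R ⧸ p // v ≠ 0} = q ^ n - 1 := by
    rw [Nat.card_eq_fintype_card, Fintype.card_subtype_compl, Fintype.card_subtype_eq,
      Fintype.card_fun, Fintype.card_fin, hq, Nat.card_eq_fintype_card]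
  rw [Nat.card_prod, h2, Nat.card_units, ← hq, ← geom_sum_mul_of_one_le hq1.le] at h1
  exact Nat.le_of_mul_le_mul_right h1 (by omega)

/-- The Cramer coefficients embed `N` in the noetherian module `Jⁿ`. -/
theorem finite_of_detLattice {N : Submodule R (Fin n → K)} {J : FractionalIdeal R⁰ K} (hJ : J ≠ 0)
    (hN : (J : Submodule R K) = detLattice N) : Module.Finite R N := by
  obtain ⟨x, hx, hx0⟩ : ∃ x : Fin n → Fin n → K, (∀ i, x i ∈ N) ∧ (Matrix.of x).det ≠ 0 := by
    by_contra! hc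
    refine hJ (FractionalIdeal.coeToSubmodule_eq_bot.mp ?_)
    rw [hN, eq_bot_iff, detLattice_le]
    exact hc
  let g : N →ₗ[R] (Fin n → (J : Submodule R K)) := LinearMap.pi fun i =>
    LinearMap.codRestrict _
      ((((detRowAlternating (R := K) (n := Fin n)).toMultilinearMap.toLinearMap
      x i).restrictScalars R) ∘ₗ N.subtype) fun y => by
        rw [hN]
        refine det_mem_detLattice (x := Function.update x i y) fun j => ?_
        by_cases hj : j = i
        · subst hj; simp
        · simpa [hj] using hx j
  have hg : Function.Injective g := by
    rw [injective_iff_map_eq_zero]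
    intro y hy
    have h1 := det_smul_eq_sum x (y : Fin n → K)
    have h2 : ∀ i, (Matrix.of (Function.update x i (y : Fin n → K))).det = 0 := fun i =>
      congrArg Subtype.val (congrFun hy i)
    simp only [h2, zero_smul, Finset.sum_const_zero] at h1
    ext1
    exact (smul_eq_zero.mp h1).resolve_left hx0
  have : IsNoetherian R (J : Submodule R K) := FractionalIdeal.isNoetherian J
  exact Module.Finite.of_injective g hg

/-- If `M + pN = N`, Nakayama's lemma gives `r ≡ 1` modulo `p` with `rN ⊆ M`; then `rⁿ J ⊆ pJ` and
`r ∈ p`, which is absurd. So the image of `M` in `N / pN` is proper and lies in a hyperplane. -/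
theorem exists_le_kerLattice {M N : Submodule R (Fin n → K)} (hMN : M ≤ N)
    {J : FractionalIdeal R⁰ K} (hJ : J ≠ 0) (hN : (J : Submodule R K) = detLattice N)
    {p : Ideal R} (hp : p.IsMaximal)
    (hM : detLattice M ≤
      (((p : FractionalIdeal R⁰ K) * J : FractionalIdeal R⁰ K) : Submodule R K)) :
    ∃ ℓ : N →ₗ[R] R ⧸ p, ℓ ≠ 0 ∧ M ≤ kerLattice ℓ := by
  have hfin := finite_of_detLattice hJ hN
  let := Ideal.Quotient.field p
  let N' : Submodule R N := M.comap N.subtype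
  have hlt : N' ⊔ p • (⊤ : Submodule R N) ≠ ⊤ := by
    intro htop
    obtain ⟨r, hr, hrn⟩ := Submodule.exists_sub_one_mem_and_smul_eq_zero_of_fg_of_le_smul p
      (⊤ : Submodule R (N ⧸ N')) Module.Finite.fg_top (by
        have := congrArg (Submodule.map N'.mkQ) htop
        rw [Submodule.map_sup, Submodule.map_smul'', Submodule.map_top, Submodule.range_mkQ,
          Submodule.mkQ_map_self, bot_sup_eq] at this
        exact this.ge)
    have hrM : ∀ y ∈ N, r • y ∈ M := fun y hy => by
      have := hrn (N'.mkQ ⟨y, hy⟩) trivial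
      rw [← map_smul, Submodule.mkQ_apply, Submodule.Quotient.mk_eq_zero] at this
      exact this
    have h1 : ((Ideal.span {r} ^ n : Ideal R) : FractionalIdeal R⁰ K) * J ≤
        (p : FractionalIdeal R⁰ K) * J := by
      rw [FractionalIdeal.coeIdeal_pow, FractionalIdeal.coeIdeal_span_singleton,
        FractionalIdeal.spanSingleton_pow, FractionalIdeal.spanSingleton_mul_le_iff]
      intro z hz
      rw [← FractionalIdeal.mem_coe, hN] at hz
      rw [← FractionalIdeal.mem_coe, ← map_pow, ← Algebra.smul_def]
      induction hz using Submodule.span_induction with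
      | mem z hz =>
        obtain ⟨x, hx, rfl⟩ := hz
        have e : r ^ n • (Matrix.of x).det = (Matrix.of fun i => r • x i).det := by
          have : (Matrix.of fun i => r • x i) = algebraMap R K r • Matrix.of x := by
            ext i j; simp [Algebra.smul_def]
          rw [this, det_smul, Fintype.card_fin, Algebra.smul_def, map_pow]
        rw [e]
        exact hM (det_mem_detLattice fun i => hrM _ (hx i))
      | zero => rw [smul_zero]; exact zero_mem _
      | add z z' _ _ h h' => rw [smul_add]; exact add_mem h h'
      | smul r z _ h => rw [smul_comm]; exact Submodule.smul_mem _ r h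
    rw [mul_le_mul_iff_of_ne_zero hJ, FractionalIdeal.coeIdeal_le_coeIdeal] at h1
    have hrp : r ∈ p := (Ideal.span_singleton_le_iff_mem _).mp (hp.isPrime.le_of_pow_le h1)
    exact hp.ne_top ((Ideal.eq_top_iff_one p).mpr (by simpa using p.sub_mem hrp hr))
  let W : Submodule (R ⧸ p) (N ⧸ p • (⊤ : Submodule R N)) :=
    { carrier := N'.map (Submodule.mkQ (p • (⊤ : Submodule R N)))
      zero_mem' := Submodule.zero_mem _
      add_mem' := Submodule.add_mem _
      smul_mem' := by
        intro c v hv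
        obtain ⟨c, rfl⟩ := Ideal.Quotient.mk_surjective c
        obtain ⟨z, hz, rfl⟩ := hv
        exact ⟨c • z, N'.smul_mem c hz, rfl⟩ }
  have hW : W < ⊤ := by
    refine lt_top_iff_ne_top.mpr fun h => hlt ?_
    rw [eq_top_iff]
    intro y _
    have hy : Submodule.mkQ (p • (⊤ : Submodule R N)) y ∈ W := h ▸ trivial
    obtain ⟨z, hz, hzy⟩ := hy
    have : y - z ∈ p • (⊤ : Submodule R N) := by
      rw [← Submodule.Quotient.mk_eq_zero, Submodule.Quotient.mk_sub, sub_eq_zero]; exact hzy.symm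
    rw [← add_sub_cancel z y]
    exact add_mem (Submodule.mem_sup_left hz) (Submodule.mem_sup_right this)
  obtain ⟨f, hf0, hf⟩ := W.exists_le_ker_of_lt_top hW
  refine ⟨f.restrictScalars R ∘ₗ Submodule.mkQ _, fun h => hf0 ?_, fun y hy => ?_⟩
  · refine LinearMap.ext fun v => ?_
    obtain ⟨y, rfl⟩ := Submodule.mkQ_surjective (p • (⊤ : Submodule R N)) v
    have := LinearMap.congr_fun h y
    rw [LinearMap.comp_apply, LinearMap.restrictScalars_apply, LinearMap.zero_apply] at this
    rw [this, LinearMap.zero_apply]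
  · exact mem_kerLattice.mpr ⟨hMN hy, hf ⟨⟨y, hMN hy⟩, hy, rfl⟩⟩

/-- The number of sublattices of a given index. -/
theorem ncard_sublattices_le (s : Multiset (Ideal R))
    (hs : ∀ p ∈ s, p.IsMaximal ∧ p ≠ ⊥ ∧ Finite (R ⧸ p)) {N : Submodule R (Fin n → K)}
    {J : FractionalIdeal R⁰ K} (hJ : J ≠ 0) (hN : (J : Submodule R K) = detLattice N) :
    {M | M ≤ N ∧ detLattice M = ((((s.prod : Ideal R) : FractionalIdeal R⁰ K) * J :
      FractionalIdeal R⁰ K) : Submodule R K)}.Finite ∧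
    {M | M ≤ N ∧ detLattice M = ((((s.prod : Ideal R) : FractionalIdeal R⁰ K) * J :
      FractionalIdeal R⁰ K) : Submodule R K)}.ncard ≤
      (s.map fun p => ∑ i ∈ Finset.range n, Nat.card (R ⧸ p) ^ i).prod := by
  induction s using Multiset.induction_on generalizing N J with
  | empty =>
    have : {M | M ≤ N ∧ detLattice M = ((((Multiset.prod 0 : Ideal R) : FractionalIdeal R⁰ K) * J :
        FractionalIdeal R⁰ K) : Submodule R K)} ⊆ {N} := by
      rintro M ⟨hMN, hM⟩
      rw [Multiset.prod_zero, Ideal.one_eq_top, FractionalIdeal.coeIdeal_top, one_mul] at hM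
      exact eq_of_detLattice_eq hMN hJ hM.symm hN
    refine ⟨(Set.finite_singleton N).subset this, ?_⟩
    refine (Set.ncard_le_ncard this (Set.finite_singleton N)).trans ?_
    simp
  | cons p s ih =>
    obtain ⟨hp, hp0, hpf⟩ := hs p (Multiset.mem_cons_self p s)
    obtain ⟨hfin, hcard⟩ := ncard_kerLattice_le hJ hN hp
    set T := {H | ∃ ℓ : N →ₗ[R] R ⧸ p, ℓ ≠ 0 ∧ H = kerLattice ℓ} with hT
    have hpJ : (p : FractionalIdeal R⁰ K) * J ≠ 0 :=
      mul_ne_zero (FractionalIdeal.coeIdeal_ne_zero.mpr hp0) hJ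
    have hstep : ∀ H ∈ T, _ := fun H hH => ih (N := H) (J := (p : FractionalIdeal R⁰ K) * J)
      (fun q hq => hs q (Multiset.mem_cons_of_mem hq)) hpJ (by
        obtain ⟨ℓ, hℓ, rfl⟩ := hH
        exact detLattice_kerLattice hJ hN hp hℓ)
    set S : Submodule R (Fin n → K) → Set (Submodule R (Fin n → K)) := fun H =>
      {M | M ≤ H ∧ detLattice M = ((((s.prod : Ideal R) : FractionalIdeal R⁰ K) *
        ((p : FractionalIdeal R⁰ K) * J) : FractionalIdeal R⁰ K) : Submodule R K)} with hS
    -- `M` lies in a sublattice `H` of index `p`, relative to which its index is the product of the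
    -- remaining primes. It may lie in several such `H`, so this gives only an upper bound.
    have hsub : {M | M ≤ N ∧ detLattice M = (((((p ::ₘ s).prod : Ideal R) :
        FractionalIdeal R⁰ K) * J : FractionalIdeal R⁰ K) : Submodule R K)} ⊆
        ⋃ H ∈ hfin.toFinset, S H := by
      rintro M ⟨hMN, hM⟩
      have e : (((p ::ₘ s).prod : Ideal R) : FractionalIdeal R⁰ K) * J =
          ((s.prod : Ideal R) : FractionalIdeal R⁰ K) * ((p : FractionalIdeal R⁰ K) * J) := by
        rw [Multiset.prod_cons, FractionalIdeal.coeIdeal_mul]; ring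
      rw [e] at hM
      obtain ⟨ℓ, hℓ, hle⟩ := exists_le_kerLattice hMN hJ hN hp (by
        rw [hM, FractionalIdeal.coe_le_coe]
        calc _ ≤ 1 * ((p : FractionalIdeal R⁰ K) * J) :=
              mul_le_mul_left FractionalIdeal.coeIdeal_le_one _
          _ = _ := one_mul _)
      simp only [Set.mem_iUnion]
      exact ⟨kerLattice ℓ, hfin.mem_toFinset.mpr ⟨ℓ, hℓ, rfl⟩, hle, hM⟩
    have hUfin : (⋃ H ∈ hfin.toFinset, S H).Finite :=
      hfin.toFinset.finite_toSet.biUnion fun H hH => (hstep H (hfin.mem_toFinset.mp hH)).1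
    refine ⟨hUfin.subset hsub, (Set.ncard_le_ncard hsub hUfin).trans ?_⟩
    refine (hfin.toFinset.set_ncard_biUnion_le S).trans ?_
    refine (Finset.sum_le_card_nsmul _ _ _ fun H hH =>
      (hstep H (hfin.mem_toFinset.mp hH)).2).trans ?_
    rw [Multiset.map_cons, Multiset.prod_cons, smul_eq_mul, ← Set.ncard_eq_toFinset_card T hfin]
    exact Nat.mul_le_mul_right _ hcard

end Counting

/-! ## Determinant forms on exterior powers -/

section DetForm

open Matrix

section Defs
variable {S : Type u} [CommRing S] {K : Type k} [CommRing K] [Algebra S K]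
  {M : Type v} [AddCommGroup M] [Module S M] {n : ℕ}

/-- The alternating form `v ↦ det (gⱼ(vᵢ))`. -/
def detForm (g : Fin n → M →ₗ[S] K) : M [⋀^Fin n]→ₗ[S] K :=
  { ((detRowAlternating (R := K) (n := Fin n)).toMultilinearMap.restrictScalars S).compLinearMap
      (fun _ => LinearMap.pi g) with
    map_eq_zero_of_eq' := fun _ _ _ h hij =>
      (detRowAlternating (R := K) (n := Fin n)).map_eq_zero_of_eq _
        (congrArg (LinearMap.pi g) h) hij }

theorem detForm_apply (g : Fin n → M →ₗ[S] K) (v : Fin n → M) :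
    detForm g v = (Matrix.of fun i j => g j (v i)).det := rfl

/-- The linear form on `⋀ⁿ M` that is induced by `detForm`. -/
def detPairing (g : Fin n → M →ₗ[S] K) : ⋀[S]^n M →ₗ[S] K :=
  exteriorPower.alternatingMapLinearEquiv (detForm g)

theorem detPairing_ιMulti (g : Fin n → M →ₗ[S] K) (v : Fin n → M) :
    detPairing g (exteriorPower.ιMulti S n v) = (Matrix.of fun i j => g j (v i)).det :=
  exteriorPower.alternatingMapLinearEquiv_apply_ιMulti _ _

theorem detPairing_bivec (f g : M →ₗ[S] K) (a b : M) :
    detPairing ![f, g] (bivec a b) = f a * g b - g a * f b := by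
  rw [bivec, detPairing_ιMulti, det_fin_two]
  simp

theorem wedge_bivec (a b c d : M) : wedge (bivec a b : ⋀[S]^2 M) (bivec c d) =
    exteriorPower.ιMulti S 4 ![a, b, c, d] := by
  ext
  simp [ExteriorAlgebra.ιMulti_apply, mul_assoc]

theorem bivec_induction {p : ⋀[S]^2 M → Prop} (bivec : ∀ a b, p (bivec a b)) (zero : p 0)
    (add : ∀ μ ν, p μ → p ν → p (μ + ν)) (smul : ∀ (r : S) μ, p μ → p (r • μ)) (μ : ⋀[S]^2 M) :
    p μ := by
  have h : μ ∈ Submodule.span S (Set.range (exteriorPower.ιMulti S 2 (M := M))) := by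
    rw [exteriorPower.ιMulti_span]; trivial
  induction h using Submodule.span_induction with
  | mem x hx =>
    obtain ⟨f, rfl⟩ := hx
    convert bivec (f 0) (f 1) using 2
    ext i; fin_cases i <;> rfl
  | zero => exact zero
  | add x y _ _ hx hy => exact add x y hx hy
  | smul r x _ hx => exact smul r x hx

theorem wedge_add_left {m l : ℕ} (a a' : ⋀[S]^m M) (b : ⋀[S]^l M) :
    wedge (a + a') b = wedge a b + wedge a' b := by ext; simp [add_mul]

theorem wedge_add_right {m l : ℕ} (a : ⋀[S]^m M) (b b' : ⋀[S]^l M) :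
    wedge a (b + b') = wedge a b + wedge a b' := by ext; simp [mul_add]

theorem wedge_smul_left {m l : ℕ} (r : S) (a : ⋀[S]^m M) (b : ⋀[S]^l M) :
    wedge (r • a) b = r • wedge a b := by ext; simp

theorem wedge_smul_right {m l : ℕ} (r : S) (a : ⋀[S]^m M) (b : ⋀[S]^l M) :
    wedge a (r • b) = r • wedge a b := by ext; simp

/-- The polar form of the Pfaffian, which controls `box` on sums. -/
theorem detPairing_wedge (f g h l : M →ₗ[S] K) (μ ν : ⋀[S]^2 M) :
    detPairing ![f, g, h, l] (wedge μ ν) =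
      detPairing ![f, g] μ * detPairing ![h, l] ν + detPairing ![f, g] ν * detPairing ![h, l] μ -
      detPairing ![f, h] μ * detPairing ![g, l] ν - detPairing ![f, h] ν * detPairing ![g, l] μ +
      detPairing ![f, l] μ * detPairing ![g, h] ν +
      detPairing ![f, l] ν * detPairing ![g, h] μ := by
  induction μ using bivec_induction with
  | bivec a b =>
    induction ν using bivec_induction with
    | bivec c d =>
      rw [wedge_bivec, detPairing_ιMulti]
      simp only [detPairing_bivec]
      rw [det_succ_row_zero]
      simp [Fin.sum_univ_succ, det_fin_three, submatrix, Fin.succAbove]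
      ring
    | zero =>
      have : wedge (bivec a b : ⋀[S]^2 M) (0 : ⋀[S]^2 M) = 0 := by ext; simp
      simp [this]
    | add μ ν h1 h2 => simp only [wedge_add_right, map_add, h1, h2]; ring
    | smul r μ h1 =>
      simp only [wedge_smul_right, map_smul, h1, Algebra.smul_def]; ring
  | zero =>
    have : wedge (0 : ⋀[S]^2 M) ν = 0 := by ext; simp
    simp [this]
  | add μ ν h1 h2 => simp only [wedge_add_left, map_add, h1, h2]; ring
  | smul r μ h1 =>
    simp only [wedge_smul_left, map_smul, h1, Algebra.smul_def]; ring

/-- The Pfaffian identity. -/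
theorem detPairing_box (f g h l : M →ₗ[S] K) (μ : ⋀[S]^2 M) :
    detPairing ![f, g, h, l] (box μ) =
      detPairing ![f, g] μ * detPairing ![h, l] μ - detPairing ![f, h] μ * detPairing ![g, l] μ +
      detPairing ![f, l] μ * detPairing ![g, h] μ := by
  induction μ using bivec_induction with
  | bivec a b =>
    rw [box_bivec, map_zero]
    simp only [detPairing_bivec]; ring
  | zero => simp [box]
  | add μ ν h1 h2 => simp only [box_add, map_add, h1, h2, detPairing_wedge]; ring
  | smul r μ h1 => simp only [box_smul, map_smul, h1, Algebra.smul_def, map_pow]; ring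

theorem wedgeVec_add (ω ω' : ⋀[S]^4 M) (x : M) :
    wedgeVec (ω + ω') x = wedgeVec ω x + wedgeVec ω' x := wedge_add_left _ _ _

theorem wedgeVec_smul (r : S) (ω : ⋀[S]^4 M) (x : M) :
    wedgeVec (r • ω) x = r • wedgeVec ω x := wedge_smul_left _ _ _

theorem wedgeVec_zero (x : M) : wedgeVec (0 : ⋀[S]^4 M) x = 0 := by
  ext; simp [wedgeVec]

theorem wedgeVec_ιMulti (y : Fin 4 → M) (x : M) :
    wedgeVec (exteriorPower.ιMulti S 4 y) x =
      exteriorPower.ιMulti S 5 (Fin.snoc y x) := by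
  ext
  have : (Fin.snoc y x : Fin 5 → M) = ![y 0, y 1, y 2, y 3, x] := by
    ext i; fin_cases i <;> rfl
  rw [this]
  simp [wedgeVec, ExteriorAlgebra.ιMulti_apply, mul_assoc, Matrix.vecTail]

/-- Elements of exterior powers of projective modules are determined by determinant forms. -/
theorem eq_zero_of_detPairing_eq_zero [Module.Finite S M] [Module.Projective S M] {ω : ⋀[S]^n M}
    (h : ∀ g : Fin n → M →ₗ[S] S, detPairing g ω = 0) : ω = 0 := by
  obtain ⟨m, π, i, -, -, hi⟩ := Module.Finite.exists_comp_eq_id_of_projective S M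
  have hinj := exteriorPower.map_injective (n := n) π hi
  refine hinj ?_
  rw [map_zero]
  refine ((Pi.basisFun S (Fin m)).exteriorPower n).repr.injective ?_
  ext s
  rw [exteriorPower.basis_repr_apply, map_zero, Finsupp.zero_apply]
  have : exteriorPower.ιMultiDual S n (Pi.basisFun S (Fin m)) s ∘ₗ exteriorPower.map n i =
      detPairing fun j => (Pi.basisFun S (Fin m)).coord
        (Set.powersetCard.ofFinEmbEquiv.symm s j) ∘ₗ i := by
    apply exteriorPower.linearMap_ext
    ext v
    simp [detPairing_ιMulti]
  rw [← LinearMap.comp_apply, this]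
  exact h _

end Defs

variable {S : Type u} [CommRing S] [IsDomain S] {K : Type k} [Field K] [Algebra S K]
  [FaithfulSMul S K] {M : Type v} [AddCommGroup M] [Module S M] [Module.Finite S M]
  [Module.IsTorsionFree S M] {n : ℕ}

omit [FaithfulSMul S K] [Module.IsTorsionFree S M] in
theorem exists_smul_eq_sum (hM : Module.finrank S M = n) {e : Fin n → M}
    (he : LinearIndependent S e) (v : M) :
    ∃ r : S, r ≠ 0 ∧ ∃ c : Fin n → S, r • v = ∑ i, c i • e i := by
  have hn : ¬ LinearIndependent S (Fin.cons v e : Fin (n + 1) → M) := fun h => by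
    have := h.fintype_card_le_finrank
    rw [Fintype.card_fin] at this
    omega
  rw [Fintype.not_linearIndependent_iff] at hn
  obtain ⟨g, hg, i, hi⟩ := hn
  rw [Fin.sum_univ_succ] at hg
  simp only [Fin.cons_zero, Fin.cons_succ] at hg
  refine ⟨g 0, fun h0 => ?_, fun i => -g i.succ, ?_⟩
  · rw [h0, zero_smul, zero_add] at hg
    have := Fintype.linearIndependent_iff.mp he _ hg
    refine Fin.cases (fun h => h h0) (fun j h => h (this j)) i hi
  · simp only [neg_smul, Finset.sum_neg_distrib]
    exact eq_neg_of_add_eq_zero_left hg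

/-- After scaling, any tuple lies in the span of `e`, where a form of top degree is determined by
its value at `e`. -/
theorem alternatingMap_eq_zero (hM : Module.finrank S M = n) {e : Fin n → M}
    (he : LinearIndependent S e) {H : M [⋀^Fin n]→ₗ[S] K} (h : H e = 0) : H = 0 := by
  let E := Submodule.span S (Set.range e)
  let b := Module.Basis.span he
  have hE : H.compLinearMap E.subtype = 0 := by
    refine b.ext_alternating fun v hv => ?_
    have hb : ∀ i, (b i : M) = e i := fun i =>
      congrArg Subtype.val (Module.Basis.span_apply he i)
    let σ := Equiv.ofBijective v (Finite.injective_iff_bijective.mp hv)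
    have : H (e ∘ σ) = Equiv.Perm.sign σ • H e := H.map_perm e σ
    rw [h, smul_zero] at this
    rw [AlternatingMap.compLinearMap_apply, AlternatingMap.zero_apply, ← this]
    congr 1; ext i; exact hb _
  ext x
  choose r hr c hc using fun i => exists_smul_eq_sum hM he (x i)
  have h1 : H (fun i => r i • x i) = 0 := by
    have := congrArg (fun F => F fun i => (⟨r i • x i, by
      rw [hc]; exact Submodule.sum_mem _ fun j _ => Submodule.smul_mem _ _
        (Submodule.subset_span ⟨j, rfl⟩)⟩ : E)) hE
    exact this
  rw [AlternatingMap.map_smul_univ] at h1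
  exact (smul_eq_zero.mp h1).resolve_left (Finset.prod_ne_zero_iff.mpr fun i _ => hr i)

theorem linearIndependent_of_det_ne_zero {P : Fin n → M →ₗ[S] K} {e : Fin n → M}
    (h : (Matrix.of fun i j => P j (e i)).det ≠ 0) : LinearIndependent S e := by
  by_contra hn
  exact h ((detForm P).map_linearDependent e hn)

/-- If `P₁, …, Pₙ` are independent functionals on a module of rank `n`, then they generate. -/
theorem exists_eq_sum_mul (hM : Module.finrank S M = n) {P : Fin n → M →ₗ[S] K} {e : Fin n → M}
    (h : (Matrix.of fun i j => P j (e i)).det ≠ 0) (g : M →ₗ[S] K) :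
    ∃ c : Fin n → K, ∀ v, g v = ∑ i, c i * P i v := by
  have he := linearIndependent_of_det_ne_zero h
  set A := Matrix.of fun i j => P j (e i) with hA
  have hu : IsUnit A.det := isUnit_iff_ne_zero.mpr h
  refine ⟨A⁻¹ *ᵥ fun i => g (e i), fun v => ?_⟩
  set c := A⁻¹ *ᵥ fun i => g (e i) with hc
  have hce : ∀ i, g (e i) = ∑ j, c j * P j (e i) := by
    intro i
    have : A *ᵥ c = fun i => g (e i) := by
      rw [hc, mulVec_mulVec, mul_nonsing_inv A hu, one_mulVec]
    rw [← congrFun this i]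
    simp [mulVec, dotProduct, hA, mul_comm]
  obtain ⟨r, hr, d, hd⟩ := exists_smul_eq_sum hM he v
  have hr' : algebraMap S K r ≠ 0 := by
    rwa [Ne, FaithfulSMul.algebraMap_eq_zero_iff]
  refine mul_left_cancel₀ hr' ?_
  rw [← Algebra.smul_def, ← map_smul, hd, Finset.mul_sum]
  have : ∀ i, algebraMap S K r * (c i * P i v) = c i * P i (r • v) := fun i => by
    rw [map_smul, Algebra.smul_def]; ring
  simp only [this, hd, map_sum, map_smul, hce, Finset.mul_sum, Finset.smul_sum]
  rw [Finset.sum_comm]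
  simp only [mul_smul_comm]

theorem eq_zero_of_forall_apply_eq_zero (hM : Module.finrank S M = n) {P : Fin n → M →ₗ[S] K}
    {e : Fin n → M} (h : (Matrix.of fun i j => P j (e i)).det ≠ 0) {v : M} (hv : ∀ i, P i v = 0) :
    v = 0 := by
  have he := linearIndependent_of_det_ne_zero h
  obtain ⟨r, hr, d, hd⟩ := exists_smul_eq_sum hM he v
  set A := Matrix.of fun i j => P j (e i) with hA
  have h1 : (fun i => algebraMap S K (d i)) ᵥ* A = 0 := by
    ext j
    have := congrArg (P j) hd
    rw [map_smul, hv, smul_zero, map_sum] at this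
    rw [Pi.zero_apply, this]
    simp [vecMul, dotProduct, hA, Algebra.smul_def]
  have h2 := eq_zero_of_vecMul_eq_zero h h1
  have h3 : ∀ i, d i = 0 := fun i => by
    have := congrFun h2 i
    rwa [Pi.zero_apply, FaithfulSMul.algebraMap_eq_zero_iff] at this
  simp only [h3, zero_smul, Finset.sum_const_zero] at hd
  exact (smul_eq_zero.mp hd).resolve_left hr

/-- The Laplace expansion that identifies `⋀⁴ M` with functionals on a module `M` of rank five. -/
theorem det_cons_wedgeVec (hM : Module.finrank S M = 5) (η : ⋀[S]^5 M →ₗ[S] K) (ω : ⋀[S]^4 M)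
    (f : Fin 4 → M →ₗ[S] K) (v : Fin 5 → M) :
    (Matrix.of fun i j => (Fin.cons (η ∘ₗ wedgeVec ω) f : Fin 5 → M →ₗ[S] K) j (v i)).det =
      detPairing f ω * η (exteriorPower.ιMulti S 5 v) := by
  have hexp : ∀ ω : ⋀[S]^4 M, ∀ v : Fin 5 → M, (Matrix.of fun i j =>
      (Fin.cons (η ∘ₗ wedgeVec ω) f : Fin 5 → M →ₗ[S] K) j (v i)).det =
      ∑ i : Fin 5, (-1) ^ (i : ℕ) * η (wedgeVec ω (v i)) *
        (Matrix.of fun k j => f j (v (i.succAbove k))).det := by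
    intro ω v
    rw [det_succ_column_zero]
    rfl
  have h : ω ∈ Submodule.span S (Set.range (exteriorPower.ιMulti S 4 (M := M))) := by
    rw [exteriorPower.ιMulti_span]; trivial
  induction h using Submodule.span_induction with
  | mem x hx =>
    obtain ⟨y, rfl⟩ := hx
    by_cases hy : LinearIndependent S y
    -- Both sides are forms of top degree in `v`, so they are compared at the single tuple `e = (y,
    -- t)`. There only the last term of the expansion survives, since `y ∧ yᵢ = 0`, and its sign is
    -- `(-1)⁴`.
    · obtain ⟨t, ht⟩ := exists_linearIndependent_snoc_of_lt_finrank hy (by omega)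
      set e : Fin 5 → M := Fin.snoc y t with he
      have hcs : ∀ i : Fin 4, e i.castSucc = y i := fun i =>
        Fin.snoc_castSucc (α := fun _ => M) _ _ _
      let η' : M [⋀^Fin 5]→ₗ[S] K := exteriorPower.alternatingMapLinearEquiv.symm η
      have hη' : ∀ v, η' v = η (exteriorPower.ιMulti S 5 v) := fun v =>
        exteriorPower.alternatingMapLinearEquiv_symm_apply _ _
      set g : Fin 5 → M →ₗ[S] K :=
        Fin.cons (η ∘ₗ wedgeVec (exteriorPower.ιMulti S 4 y)) f with hg
      by_cases h0 : η' e = 0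
      · have h1 := alternatingMap_eq_zero hM ht h0
        have h2 : ∀ v, η (exteriorPower.ιMulti S 5 v) = 0 := fun v => by
          rw [← hη', h1]; rfl
        rw [hexp]
        simp [wedgeVec_ιMulti, h2]
      · have hge : detForm g e =
            detPairing f (exteriorPower.ιMulti S 4 y) * η' e := by
          rw [detForm_apply, hg, hexp, Fin.sum_univ_castSucc]
          have h1 : ∀ i : Fin 4, η (wedgeVec (exteriorPower.ιMulti S 4 y) (e i.castSucc)) = 0 := by
            intro i
            rw [wedgeVec_ιMulti, ← hη']
            refine η'.map_eq_zero_of_eq _ (i := i.castSucc) (j := Fin.last 4) ?_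
              (Fin.castSucc_lt_last i).ne
            rw [hcs, Fin.snoc_castSucc (α := fun _ => M), Fin.snoc_last (α := fun _ => M)]
          simp only [h1, mul_zero, zero_mul, Finset.sum_const_zero, zero_add]
          have h2 : e (Fin.last 4) = t := Fin.snoc_last (α := fun _ => M) _ _
          rw [h2, wedgeVec_ιMulti, ← he, hη', detPairing_ιMulti]
          have h3 : ∀ k : Fin 4, e ((Fin.last 4).succAbove k) = y k := fun k => by
            rw [Fin.succAbove_last, hcs]
          simp only [h3]
          norm_num
          ring
        have hH : (η' e) • detForm g - (detForm g e) • η' = 0 :=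
          alternatingMap_eq_zero hM ht (by
            simp only [AlternatingMap.sub_apply, AlternatingMap.smul_apply, smul_eq_mul]; ring)
        have := congrArg (fun F => F v) hH
        simp only [AlternatingMap.sub_apply, AlternatingMap.smul_apply, smul_eq_mul,
          AlternatingMap.zero_apply, hge] at this
        rw [← detForm_apply, ← hη']
        refine mul_left_cancel₀ h0 ?_
        linear_combination this
    · have h1 : detPairing f (exteriorPower.ιMulti S 4 y) = 0 := by
        rw [detPairing_ιMulti]
        exact (detForm f).map_linearDependent y hy
      have h3 : ∀ x, η (wedgeVec (exteriorPower.ιMulti S 4 y) x) = 0 := by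
        intro x
        rw [wedgeVec_ιMulti]
        refine (exteriorPower.alternatingMapLinearEquiv.symm η).map_linearDependent _
          fun h => hy ?_
        have := h.comp Fin.castSucc (Fin.castSucc_injective 4)
        have e : (Fin.snoc y x : Fin 5 → M) ∘ Fin.castSucc = y :=
          funext fun i => Fin.snoc_castSucc (α := fun _ => M) _ _ _
        rwa [e] at this
      rw [hexp, h1, zero_mul]
      simp [h3]
  | zero =>
    rw [hexp, map_zero, zero_mul]
    simp [wedgeVec_zero]
  | add x y _ _ hx hy =>
    rw [hexp] at hx hy ⊢
    simp only [wedgeVec_add, map_add, mul_add, add_mul, Finset.sum_add_distrib, hx, hy]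
  | smul r x _ hx =>
    rw [hexp] at hx ⊢
    simp only [wedgeVec_smul, map_smul]
    rw [smul_mul_assoc, ← hx, Finset.smul_sum]
    refine Finset.sum_congr rfl fun i _ => ?_
    simp only [Algebra.smul_def]; ring

end DetForm

/-! ## The functionals attached to a resolvent -/

section ResolventData

open Matrix

variable {S : Type u} [CommRing S] {K : Type k} [Field K] [Algebra S K]
  {A : Type v} [CommRing A] [Algebra S A]

/-- The linear form on `D^{⊗ 3}` that is induced by a linear form on `D`. -/
def tripleForm (δ : D S A →ₗ[S] K) : D S A ⊗[S] (D S A ⊗[S] D S A) →ₗ[S] K :=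
  LinearMap.mul' S K ∘ₗ TensorProduct.map δ (LinearMap.mul' S K ∘ₗ TensorProduct.map δ δ)

theorem tripleForm_tmul (δ : D S A →ₗ[S] K) (a b c : D S A) :
    tripleForm δ (a ⊗ₜ (b ⊗ₜ c)) = δ a * (δ b * δ c) := rfl

/-- The form `δ(x ∧ y ∧ z ∧ yz)`. -/
def wedgeForm (δ : D S A →ₗ[S] K) (x y z : A) : K := δ (wedgeProd S x y z)

theorem wedgeForm_swap (δ : D S A →ₗ[S] K) (x y z : A) :
    wedgeForm δ x z y = -wedgeForm δ x y z := by
  have h : ∀ a b c d : L S A, exteriorPower.ιMulti S 4 ![a, c, b, d] =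
      -exteriorPower.ιMulti S 4 ![a, b, c, d] := by
    intro a b c d
    have := (exteriorPower.ιMulti S 4 (M := L S A)).map_swap ![a, b, c, d]
      (show (1 : Fin 4) ≠ 2 by decide)
    rw [← this]
    congr 1
    ext i; fin_cases i <;> rfl
  rw [wedgeForm, wedgeForm, wedgeProd, wedgeProd, mul_comm z y, h, map_neg]

/-- The pentaquadratic form that is attached to a linear form on `D`. -/
def pfaffForm (δ : D S A →ₗ[S] K) (X : Fin 5 → A) : K :=
  pfaff (wedgeForm δ) (X 0) (X 1) (X 2) (X 3) (X 4)

/-- The vector of coordinates `F(x₁, …, x, …, x₅) / F(x₁, …, x₅)`. -/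
def coords (δ : D S A →ₗ[S] K) (X : Fin 5 → A) (x : A) (i : Fin 5) : K :=
  pfaffForm δ (Function.update X i x) / pfaffForm δ X

namespace Resolvent

variable (ρ : Resolvent.{u, v, w} S A) (δ : D S A →ₗ[S] K)

/-- The linear form on `⋀⁵ M` that is given by `θ`. -/
def eta : ⋀[S]^5 ρ.M →ₗ[S] K := tripleForm δ ∘ₗ ρ.θ

/-- The functional `φ(l ⊗ x)^□ ∧ ·` on `M`. -/
def boxFunctional (t : D S A ⊗[S] L S A) : ρ.M →ₗ[S] K := ρ.eta δ ∘ₗ wedgeVec (box (ρ.φ t))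

theorem boxFunctional_smul (r : S) (t : D S A ⊗[S] L S A) :
    ρ.boxFunctional δ (r • t) = (algebraMap S K r) ^ 2 • ρ.boxFunctional δ t := by
  ext v
  simp only [boxFunctional, map_smul, box_smul, wedgeVec_smul, LinearMap.comp_apply,
    LinearMap.smul_apply, Algebra.smul_def, map_pow, Algebra.algebraMap_self,
    RingHom.id_apply]

theorem mul'_map_contraction (η : ⋀[S]^5 ρ.M →ₗ[S] K) (α β : ⋀[S]^4 ρ.M) (μ : ⋀[S]^2 ρ.M) :
    LinearMap.mul' S K (TensorProduct.map η η (contraction α β μ)) =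
      detPairing ![η ∘ₗ wedgeVec α, η ∘ₗ wedgeVec β] μ := by
  induction μ using bivec_induction with
  | bivec a b =>
    rw [contraction_bivec, detPairing_bivec]
    simp [mul_comm]
  | zero => simp
  | add x y hx hy => simp only [map_add, hx, hy]
  | smul r x hx => simp only [map_smul, hx]

theorem detPairing_boxFunctional (l₁ l₂ l₃ : D S A) (x y z : A) :
    detPairing ![ρ.boxFunctional δ (l₂ ⊗ₜ toL S A y), ρ.boxFunctional δ (l₃ ⊗ₜ toL S A z)]
      (ρ.φ (l₁ ⊗ₜ toL S A x)) = δ l₁ * δ l₂ ^ 2 * δ l₃ ^ 2 * wedgeForm δ x y z := by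
  rw [boxFunctional, boxFunctional, ← mul'_map_contraction, eta, TensorProduct.map_comp,
    LinearMap.comp_apply, ρ.identity]
  simp only [TensorProduct.map_tmul, tripleForm_tmul, LinearMap.mul'_apply, wedgeForm]
  ring

/-- The functional `δ(l)⁻² φ(l ⊗ x)^□ ∧ ·` on `M`. -/
def functional (l : D S A) (x : A) : ρ.M →ₗ[S] K :=
  (δ l ^ 2)⁻¹ • ρ.boxFunctional δ (l ⊗ₜ toL S A x)

theorem detPairing_smul_smul (a b : K) (f g : ρ.M →ₗ[S] K) (μ : ⋀[S]^2 ρ.M) :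
    detPairing ![a • f, b • g] μ = a * b * detPairing ![f, g] μ := by
  induction μ using bivec_induction with
  | bivec x y =>
    rw [detPairing_bivec, detPairing_bivec]
    simp only [LinearMap.smul_apply, smul_eq_mul]; ring
  | zero => simp
  | add x y hx hy => simp only [map_add, hx, hy, mul_add]
  | smul r x hx => simp only [map_smul, hx, mul_smul_comm]

variable {δ} {l : D S A}

theorem detPairing_functional (hl : δ l ≠ 0) (l' : D S A) (x y z : A) :
    detPairing ![ρ.functional δ l y, ρ.functional δ l z] (ρ.φ (l' ⊗ₜ toL S A x)) =
      δ l' * wedgeForm δ x y z := by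
  rw [functional, functional, detPairing_smul_smul, detPairing_boxFunctional]
  field_simp

/-- `l` and `l'` have a common multiple because `δ` is injective, and `φ(l ⊗ x)^□` is quadratic in
`l`. Hence P_x does not depend on the choice of `l`. -/
theorem boxFunctional_eq [IsDomain S] [IsFractionRing S K] (hδ : Function.Injective δ)
    (hl : δ l ≠ 0) (l' : D S A) (x : A) :
    ρ.boxFunctional δ (l' ⊗ₜ toL S A x) = δ l' ^ 2 • ρ.functional δ l x := by
  obtain ⟨s, t, ht, hst⟩ := IsFractionRing.div_surjective (A := S) (δ l' / δ l)
  have ht' : algebraMap S K t ≠ 0 := IsFractionRing.to_map_ne_zero_of_mem_nonZeroDivisors ht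
  have h1 : t • l' = s • l := hδ (by
    rw [map_smul, map_smul, Algebra.smul_def, Algebra.smul_def]
    field_simp at hst
    linear_combination -hst)
  have h2 : (algebraMap S K t) ^ 2 • ρ.boxFunctional δ (l' ⊗ₜ toL S A x) =
      (algebraMap S K s) ^ 2 • ρ.boxFunctional δ (l ⊗ₜ toL S A x) := by
    rw [← boxFunctional_smul, ← boxFunctional_smul, TensorProduct.smul_tmul', h1,
      TensorProduct.smul_tmul']
  have h3 : ρ.boxFunctional δ (l' ⊗ₜ toL S A x) =
      ((algebraMap S K t) ^ 2)⁻¹ • (algebraMap S K s) ^ 2 •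
        ρ.boxFunctional δ (l ⊗ₜ toL S A x) := by
    rw [← h2, smul_smul, inv_mul_cancel₀ (pow_ne_zero 2 ht'), one_smul]
  rw [h3, functional, smul_smul, smul_smul]
  congr 1
  have : δ l' = algebraMap S K s / algebraMap S K t * δ l := by
    rw [hst]; field_simp
  rw [this]
  field_simp

variable [IsDomain S] [IsFractionRing S K]

/-- The Laplace expansion reduces the determinant to the pairing of `φ(l ⊗ a)^□` with P_b, P_c, P_d,
P_e. The Pfaffian identity expresses that pairing in the values `φ(l ⊗ a)(P_y, P_z)`, which the
resolvent identity provides. -/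
theorem det_functional (hl : δ l ≠ 0) (a b c d e : A) (v : Fin 5 → ρ.M) :
    (Matrix.of fun i j => ρ.functional δ l (![a, b, c, d, e] j) (v i)).det =
      pfaff (wedgeForm δ) a b c d e * ρ.eta δ (exteriorPower.ιMulti S 5 v) := by
  have := ρ.finite
  have := ρ.torsionFree
  have h := det_cons_wedgeVec ρ.rank (ρ.eta δ) (box (ρ.φ (l ⊗ₜ toL S A a)))
    ![ρ.functional δ l b, ρ.functional δ l c, ρ.functional δ l d, ρ.functional δ l e] v
  rw [detPairing_box] at h
  simp only [ρ.detPairing_functional hl] at h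
  -- The first column is not normalized. Its factor `δ(l)²` matches the two factors `δ(l)` in each
  -- product of the Pfaffian.
  have h1 : (Matrix.of fun i j => (Fin.cons (ρ.eta δ ∘ₗ wedgeVec (box (ρ.φ (l ⊗ₜ toL S A a))))
      ![ρ.functional δ l b, ρ.functional δ l c, ρ.functional δ l d, ρ.functional δ l e] :
      Fin 5 → ρ.M →ₗ[S] K) j (v i)) =
      Matrix.of fun i j => (![δ l ^ 2, 1, 1, 1, 1] : Fin 5 → K) j *
        (Matrix.of fun i j => ρ.functional δ l (![a, b, c, d, e] j) (v i)) i j := by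
    ext i j
    fin_cases j
    · simp only [functional, boxFunctional, Matrix.of_apply]
      simp [hl]
    all_goals simp
  rw [h1, Matrix.det_mul_row] at h
  have h2 : ∏ i, (![δ l ^ 2, 1, 1, 1, 1] : Fin 5 → K) i = δ l ^ 2 := by
    simp [Fin.prod_univ_succ]
  rw [h2] at h
  refine mul_left_cancel₀ (pow_ne_zero 2 hl) (h.trans ?_)
  rw [pfaff, wedgeForm_swap δ a c e]
  ring

theorem exists_eta_ne_zero (hl : δ l ≠ 0) {x y z : A} (h : wedgeForm δ x y z ≠ 0) :
    ∃ v : Fin 5 → ρ.M, ρ.eta δ (exteriorPower.ιMulti S 5 v) ≠ 0 := by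
  by_contra! hv
  have h0 : ρ.eta δ = 0 := by
    apply exteriorPower.linearMap_ext
    ext v
    exact hv v
  have h1 := ρ.detPairing_functional hl l x y z
  have h2 : ∀ y, ρ.functional δ l y = 0 := fun y => by
    ext m
    simp [functional, boxFunctional, h0]
  rw [h2, h2] at h1
  have h3 : detPairing ![(0 : ρ.M →ₗ[S] K), 0] (ρ.φ (l ⊗ₜ toL S A x)) = 0 := by
    have := ρ.detPairing_smul_smul (0 : K) 0 0 0 (ρ.φ (l ⊗ₜ toL S A x))
    simpa using this
  rw [h3] at h1
  exact mul_ne_zero hl h h1.symm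

theorem det_functional' (hl : δ l ≠ 0) (X : Fin 5 → A) (v : Fin 5 → ρ.M) :
    (Matrix.of fun i j => ρ.functional δ l (X j) (v i)).det =
      pfaffForm δ X *
        ρ.eta δ (exteriorPower.ιMulti S 5 v) := by
  rw [pfaffForm, ← ρ.det_functional hl]
  congr 1
  ext i j
  fin_cases j <;> rfl

variable {X : Fin 5 → A}

theorem exists_det_ne_zero (hl : δ l ≠ 0)
    (hX : pfaffForm δ X ≠ 0) :
    ∃ v : Fin 5 → ρ.M, ρ.eta δ (exteriorPower.ιMulti S 5 v) ≠ 0 ∧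
      (Matrix.of fun i j => ρ.functional δ l (X j) (v i)).det ≠ 0 := by
  have : ∃ x y z : A, wedgeForm δ x y z ≠ 0 := by
    by_contra! h
    exact hX (by simp [pfaffForm, pfaff, h])
  obtain ⟨x, y, z, h⟩ := this
  obtain ⟨v, hv⟩ := ρ.exists_eta_ne_zero hl h
  refine ⟨v, hv, ?_⟩
  rw [ρ.det_functional' hl]
  exact mul_ne_zero hX hv

/-- Cramer's rule: putting P_x in place of P_{X_i} multiplies the determinant by the i-th
coefficient and changes F(X) into F at the modified tuple. The coefficients are therefore the same
for all resolvents. -/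
theorem functional_eq_sum (hl : δ l ≠ 0)
    (hX : pfaffForm δ X ≠ 0) (x : A) (m : ρ.M) :
    ρ.functional δ l x m = ∑ i, coords δ X x i * ρ.functional δ l (X i) m := by
  have := ρ.finite
  have := ρ.torsionFree
  obtain ⟨v, hv, hdet⟩ := ρ.exists_det_ne_zero hl hX
  obtain ⟨c, hc⟩ := exists_eq_sum_mul ρ.rank hdet (ρ.functional δ l x)
  suffices ∀ i, c i = coords δ X x i by rw [hc]; simp only [this]
  intro i
  have h1 := ρ.det_functional' hl (Function.update X i x) v
  have h2 := ρ.det_functional' hl X v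
  have h3 : (Matrix.of fun a b => ρ.functional δ l (Function.update X i x b) (v a)) =
      Matrix.updateCol (Matrix.of fun a b => ρ.functional δ l (X b) (v a)) i
        ((Matrix.of fun a b => ρ.functional δ l (X b) (v a)) *ᵥ c) := by
    ext a b
    by_cases hb : b = i
    · subst hb
      simp [hc, mulVec, dotProduct, mul_comm]
    · simp [hb]
  have h4 : (Matrix.updateCol (Matrix.of fun a b => ρ.functional δ l (X b) (v a)) i
      ((Matrix.of fun a b => ρ.functional δ l (X b) (v a)) *ᵥ c)).det =
      c i * (Matrix.of fun a b => ρ.functional δ l (X b) (v a)).det := by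
    have := Matrix.cramer_apply (Matrix.of fun a b => ρ.functional δ l (X b) (v a))
      ((Matrix.of fun a b => ρ.functional δ l (X b) (v a)) *ᵥ c) i
    rw [← this, Matrix.cramer_eq_adjugate_mulVec, mulVec_mulVec, adjugate_mul, smul_mulVec,
      one_mulVec]
    simp [mul_comm]
  rw [h3, h4, h2] at h1
  rw [coords, eq_div_iff hX]
  refine mul_right_cancel₀ hv ?_
  linear_combination h1

/-- The conclusion concerns `A` alone, but it is obtained by comparing determinants of functionals
on a resolvent. -/
theorem det_coords (ρ : Resolvent.{u, v, w} S A) (hl : δ l ≠ 0) (hX : pfaffForm δ X ≠ 0)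
    (Y : Fin 5 → A) :
    (Matrix.of fun i => coords δ X (Y i)).det * pfaffForm δ X = pfaffForm δ Y := by
  obtain ⟨v, hv, -⟩ := ρ.exists_det_ne_zero hl hX
  have h1 := ρ.det_functional' hl Y v
  have h2 : (Matrix.of fun i j => ρ.functional δ l (Y j) (v i)) =
      (Matrix.of fun i j => ρ.functional δ l (X j) (v i)) *
        (Matrix.of fun i => coords δ X (Y i))ᵀ := by
    ext i j
    rw [Matrix.of_apply, ρ.functional_eq_sum hl hX, Matrix.mul_apply]
    exact Finset.sum_congr rfl fun k _ => mul_comm _ _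
  rw [h2, det_mul, det_transpose, ρ.det_functional' hl] at h1
  refine mul_right_cancel₀ hv ?_
  linear_combination h1

theorem eq_zero_of_forall_functional (hl : δ l ≠ 0)
    (hX : pfaffForm δ X ≠ 0) {m : ρ.M}
    (hm : ∀ i, ρ.functional δ l (X i) m = 0) : m = 0 := by
  have := ρ.finite
  have := ρ.torsionFree
  obtain ⟨v, hv, hdet⟩ := ρ.exists_det_ne_zero hl hX
  exact eq_zero_of_forall_apply_eq_zero ρ.rank hdet hm

end Resolvent

end ResolventData

/-! ## The lattice `Q / R` and its volume form -/

section VolumeForm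

open scoped nonZeroDivisors
open Module

variable {R : Type u} [CommRing R] [IsDedekindDomain R] {Q : Type v} [CommRing Q] [Algebra R Q]
  (K : Type k) [Field K] [Algebra R K] [IsFractionRing R K]

theorem projective_of_isTorsionFree {M : Type w} [AddCommGroup M] [Module R M] [Module.Finite R M]
    [IsTorsionFree R M] : Projective R M := by
  have := Module.finitePresentation_of_finite R M
  exact Flat.projective_of_finitePresentation

theorem exists_smul_eq_tmul (t : baseChange R K Q) :
    ∃ r : R, r ≠ 0 ∧ ∃ q : Q, algebraMap R K r • t = (1 : K) ⊗ₜ[R] q := by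
  obtain ⟨⟨q, s⟩, h⟩ := IsLocalizedModule.surj R⁰ (TensorProduct.mk R K Q 1) t
  refine ⟨s, nonZeroDivisors.ne_zero s.2, q, ?_⟩
  rw [algebraMap_smul]
  exact h

theorem finrank_baseChange_eq : finrank K (baseChange R K Q) = finrank R Q :=
  (TensorProduct.isBaseChange R Q K).finrank_eq

/-- If `r q = s` with `s` in `R`, then `q` is integral over `R` and equal to the fraction `s / r`,
which lies in `R` because `R` is integrally closed. -/
theorem IsQuinticRing.isTorsionFree_L (hQ : IsQuinticRing R Q) : IsTorsionFree R (L R Q) := by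
  have := hQ.finite
  have := hQ.torsionFree
  have hnt : Nontrivial Q := by
    by_contra h
    rw [not_nontrivial_iff_subsingleton] at h
    have := hQ.rank
    rw [finrank_zero_of_subsingleton] at this
    exact absurd this (by norm_num)
  refine IsTorsionFree.of_smul_eq_zero fun r m h => ?_
  by_cases hr : r = 0
  · exact Or.inl hr
  right
  obtain ⟨q, rfl⟩ := Submodule.Quotient.mk_surjective _ m
  rw [← Submodule.Quotient.mk_smul, Submodule.Quotient.mk_eq_zero, Submodule.mem_one] at h
  rw [Submodule.Quotient.mk_eq_zero, Submodule.mem_one]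
  obtain ⟨s, hs⟩ := h
  let F := FractionRing R
  have hinj : Function.Injective (Algebra.TensorProduct.includeRight : Q →ₐ[R] F ⊗[R] Q) := by
    have := Algebra.TensorProduct.includeRight_injective (R := R) (A := F) (B := Q)
      (IsFractionRing.injective R F)
    exact this
  have hnt' : Nontrivial (F ⊗[R] Q) := hinj.nontrivial
  have hF : Function.Injective (IsScalarTower.toAlgHom R F (F ⊗[R] Q)) :=
    (algebraMap F (F ⊗[R] Q)).injective
  have hr' : algebraMap R F r ≠ 0 := by
    rwa [Ne, FaithfulSMul.algebraMap_eq_zero_iff]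
  have hq : IsScalarTower.toAlgHom R F (F ⊗[R] Q) (algebraMap R F s / algebraMap R F r) =
      (1 : F) ⊗ₜ[R] q := by
    have h1 : algebraMap R F r • ((1 : F) ⊗ₜ[R] q) =
        algebraMap R F s • ((1 : F) ⊗ₜ[R] (1 : Q)) := by
      rw [algebraMap_smul, algebraMap_smul, ← TensorProduct.tmul_smul, ← TensorProduct.tmul_smul,
        ← hs, Algebra.algebraMap_eq_smul_one]
    have h2 : (1 : F) ⊗ₜ[R] q = (algebraMap R F r)⁻¹ • algebraMap R F r • ((1 : F) ⊗ₜ[R] q) := by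
      rw [smul_smul, inv_mul_cancel₀ hr', one_smul]
    rw [h2, h1, smul_smul, ← Algebra.TensorProduct.one_def, div_eq_inv_mul,
      IsScalarTower.toAlgHom_apply, Algebra.algebraMap_eq_smul_one]
  have hint : IsIntegral R (algebraMap R F s / algebraMap R F r) := by
    rw [← isIntegral_algHom_iff _ hF, hq]
    exact (Algebra.IsIntegral.isIntegral q).map
      (Algebra.TensorProduct.includeRight : Q →ₐ[R] F ⊗[R] Q)
  obtain ⟨t, ht⟩ := IsIntegrallyClosed.isIntegral_iff.mp hint
  refine ⟨t, ?_⟩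
  apply hinj
  rw [AlgHom.commutes, Algebra.TensorProduct.includeRight_apply, ← hq, ← ht]
  rfl

variable (R Q) in
/-- The map from `Q / R` to `Q_K / K`. -/
def toBaseChangeL : L R Q →ₗ[R] L K (baseChange R K Q) :=
  (1 : Submodule R Q).liftQ
    (((toL K (baseChange R K Q)).restrictScalars R) ∘ₗ TensorProduct.mk R K Q 1) (by
      intro x hx
      obtain ⟨r, rfl⟩ := Submodule.mem_one.mp hx
      rw [LinearMap.mem_ker, LinearMap.comp_apply, LinearMap.restrictScalars_apply,
        toL_eq_zero]
      refine ⟨algebraMap R K r, ?_⟩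
      rw [TensorProduct.mk_apply, Algebra.algebraMap_eq_smul_one (A := Q), TensorProduct.tmul_smul,
        algebraMap_smul]
      rfl)

theorem toBaseChangeL_toL (q : Q) :
    toBaseChangeL R Q K (toL R Q q) = toL K (baseChange R K Q) (1 ⊗ₜ[R] q) := rfl

theorem range_toBaseChangeL : LinearMap.range (toBaseChangeL R Q K) = latL R K Q := by
  rw [latL]
  refine le_antisymm ?_ (Submodule.span_le.mpr ?_)
  · rintro _ ⟨x, rfl⟩
    obtain ⟨q, rfl⟩ := Submodule.Quotient.mk_surjective _ x
    exact Submodule.subset_span ⟨q, rfl⟩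
  · rintro _ ⟨q, rfl⟩
    exact ⟨toL R Q q, rfl⟩

theorem finrank_L_baseChange (hQ : IsQuinticRing R Q) :
    finrank K (L K (baseChange R K Q)) = 4 := by
  have h5 : finrank K (baseChange R K Q) = 5 := (finrank_baseChange_eq K).trans hQ.rank
  have : Module.Finite K (baseChange R K Q) := finite_of_finrank_pos (by omega)
  have : Nontrivial (baseChange R K Q) := nontrivial_of_finrank_pos (R := K) (by omega)
  have h1 : finrank K (L K (baseChange R K Q)) +
      finrank K (1 : Submodule K (baseChange R K Q)) = finrank K (baseChange R K Q) :=
    Submodule.finrank_quotient_add_finrank _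
  have h2 : finrank K (1 : Submodule K (baseChange R K Q)) = 1 := by
    rw [Submodule.one_eq_span]
    exact finrank_span_singleton one_ne_zero
  omega

theorem finrank_L (hQ : IsQuinticRing R Q) : finrank R (L R Q) = 4 := by
  have := hQ.finite
  have := hQ.torsionFree
  have : Nontrivial Q := nontrivial_of_finrank_pos (R := R) (by rw [hQ.rank]; norm_num)
  have h1 : finrank R (L R Q) + finrank R (1 : Submodule R Q) = finrank R Q :=
    Submodule.finrank_quotient_add_finrank _
  have h2 : finrank R (1 : Submodule R Q) = 1 := by
    rw [Submodule.one_eq_range]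
    have hinj : Function.Injective (Algebra.linearMap R Q) :=
      FaithfulSMul.algebraMap_injective R Q
    rw [LinearMap.finrank_range_of_inj hinj, finrank_self]
  rw [hQ.rank] at h1
  omega

/-- Compatible volume forms on `Q / R` and `Q_K / K`. -/
structure VolumeForms (δK : D K (baseChange R K Q) →ₗ[K] K) (δ : D R Q →ₗ[R] K) : Prop where
  injective_baseChange : Function.Injective δK
  injective : Function.Injective δ
  ne_zero : δ ≠ 0
  ιMulti_ne_zero : ∀ v, LinearIndependent K v → δK (exteriorPower.ιMulti K 4 v) ≠ 0
  compat : ∀ x : Fin 4 → L R Q, δ (exteriorPower.ιMulti R 4 x) =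
    δK (exteriorPower.ιMulti K 4 (toBaseChangeL R Q K ∘ x))

theorem exists_volumeForms (hQ : IsQuinticRing R Q) :
    ∃ (δK : D K (baseChange R K Q) →ₗ[K] K) (δ : D R Q →ₗ[R] K), VolumeForms K δK δ := by
  have := hQ.finite
  have := hQ.isTorsionFree_L
  have : Projective R (L R Q) := projective_of_isTorsionFree
  have h4 := finrank_L_baseChange K hQ
  have : Module.Finite K (L K (baseChange R K Q)) := finite_of_finrank_pos (by omega)
  let b : Basis (Fin 4) K (L K (baseChange R K Q)) := finBasisOfFinrankEq _ _ h4
  let vol : L R Q [⋀^Fin 4]→ₗ[R] K :=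
    { (b.det.toMultilinearMap.restrictScalars R).compLinearMap
        (fun _ => toBaseChangeL R Q K) with
      map_eq_zero_of_eq' := fun _ _ _ h hij =>
        b.det.map_eq_zero_of_eq _ (congrArg (toBaseChangeL R Q K) h) hij }
  have hvol : ∀ x, vol x = b.det (toBaseChangeL R Q K ∘ x) := fun _ => rfl
  have hE : ∃ e, vol e ≠ 0 := by
    choose y hy using fun i => Submodule.Quotient.mk_surjective _ (b i)
    choose r hr q hq using fun i => exists_smul_eq_tmul K (y i)
    refine ⟨fun i => toL R Q (q i), ?_⟩
    rw [hvol]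
    have : toBaseChangeL R Q K ∘ (fun i => toL R Q (q i)) =
        fun i => algebraMap R K (r i) • b i := by
      ext i
      rw [Function.comp_apply, toBaseChangeL_toL, ← hq, map_smul, ← hy i]
      rfl
    rw [this, AlternatingMap.map_smul_univ, b.det_self, smul_eq_mul, mul_one]
    exact Finset.prod_ne_zero_iff.mpr fun i _ => by
      rw [Ne, FaithfulSMul.algebraMap_eq_zero_iff]; exact hr i
  obtain ⟨e, he⟩ := hE
  have hli : LinearIndependent R e := by
    by_contra h
    exact he (vol.map_linearDependent e h)
  refine ⟨exteriorPower.alternatingMapLinearEquiv b.det,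
    exteriorPower.alternatingMapLinearEquiv vol, ?_, ?_, ?_, ?_, ?_⟩
  · rw [← LinearMap.ker_eq_bot, LinearMap.ker_eq_bot']
    intro ω hω
    refine eq_zero_of_detPairing_eq_zero fun g => ?_
    have h1 : detPairing g = (detForm g b) • exteriorPower.alternatingMapLinearEquiv b.det := by
      rw [detPairing, ← map_smul]
      congr 1
      exact AlternatingMap.eq_smul_basis_det b (detForm g)
    rw [h1, LinearMap.smul_apply, hω, smul_zero]
  · rw [← LinearMap.ker_eq_bot, LinearMap.ker_eq_bot']
    intro ω hω
    refine eq_zero_of_detPairing_eq_zero fun g => ?_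
    let g' : Fin 4 → L R Q →ₗ[R] K := fun i => Algebra.linearMap R K ∘ₗ g i
    have h0 : detPairing g' = Algebra.linearMap R K ∘ₗ detPairing g := by
      apply exteriorPower.linearMap_ext
      ext x
      simp only [LinearMap.compAlternatingMap_apply, LinearMap.comp_apply, detPairing_ιMulti,
        Algebra.linearMap_apply, RingHom.map_det]
      rfl
    -- Every form of top degree is proportional to `vol`, so all determinant forms vanish on the
    -- kernel of `δ`.
    have h1 : vol e • detForm g' - detForm g' e • vol = 0 :=
      alternatingMap_eq_zero (finrank_L hQ) hli (by
        simp only [AlternatingMap.sub_apply, AlternatingMap.smul_apply, smul_eq_mul]; ring)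
    have h2 : vol e • detPairing g' - detForm g' e • exteriorPower.alternatingMapLinearEquiv vol
        = 0 := by
      apply exteriorPower.linearMap_ext
      ext x
      have := congrArg (fun F => F x) h1
      simpa [detPairing] using this
    have h3 := LinearMap.congr_fun h2 ω
    rw [LinearMap.sub_apply, LinearMap.smul_apply, LinearMap.smul_apply, hω, smul_zero, sub_zero,
      LinearMap.zero_apply, smul_eq_mul] at h3
    have h4 := (mul_eq_zero.mp h3).resolve_left he
    rw [h0, LinearMap.comp_apply, Algebra.linearMap_apply,
      FaithfulSMul.algebraMap_eq_zero_iff] at h4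
    exact h4
  · intro h
    have := LinearMap.congr_fun h (exteriorPower.ιMulti R 4 e)
    rw [exteriorPower.alternatingMapLinearEquiv_apply_ιMulti] at this
    exact he this
  · intro v hv
    rw [exteriorPower.alternatingMapLinearEquiv_apply_ιMulti]
    exact ((b.is_basis_iff_det).mp ⟨hv, by
      apply hv.span_eq_top_of_card_eq_finrank; simp [h4]⟩).ne_zero
  · intro x
    rw [exteriorPower.alternatingMapLinearEquiv_apply_ιMulti,
      exteriorPower.alternatingMapLinearEquiv_apply_ιMulti]
    rfl

end VolumeForm

/-! ## The ideals attached to a quintic ring -/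

section Ideals

open scoped nonZeroDivisors
open Module Matrix

section Span

variable {R : Type u} [CommRing R]

theorem mem_of_forall_mem_span {ι : Type*} [Fintype ι] {M N : Type*}
    [AddCommGroup M] [Module R M] [AddCommGroup N] [Module R N]
    (f : MultilinearMap R (fun _ : ι => M) N) {s : Set M} {P : Submodule R N}
    (h : ∀ x, (∀ i, x i ∈ s) → f x ∈ P) {x : ι → M} (hx : ∀ i, x i ∈ Submodule.span R s) :
    f x ∈ P := by
  classical
  suffices H : ∀ (T : Finset ι) (x : ι → M), (∀ i ∈ T, x i ∈ Submodule.span R s) →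
      (∀ i ∉ T, x i ∈ s) → f x ∈ P from
    H Finset.univ x (fun i _ => hx i) (fun i hi => absurd (Finset.mem_univ i) hi)
  intro T
  induction T using Finset.induction_on with
  | empty => exact fun x _ hx => h x fun i => hx i (Finset.notMem_empty i)
  | insert a T ha ih =>
    intro x h1 h2
    have key : ∀ y ∈ Submodule.span R s, f (Function.update x a y) ∈ P := by
      intro y hy
      induction hy using Submodule.span_induction with
      | mem y hy =>
        refine ih _ (fun i hi => ?_) (fun i hi => ?_)
        · rw [Function.update_of_ne (by rintro rfl; exact ha hi)]
          exact h1 i (Finset.mem_insert_of_mem hi)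
        · by_cases hia : i = a
          · subst hia; rwa [Function.update_self]
          · rw [Function.update_of_ne hia]
            exact h2 i (by simp [hia, hi])
      | zero => rw [f.map_update_zero]; exact P.zero_mem
      | add y z _ _ hy hz => rw [f.map_update_add]; exact P.add_mem hy hz
      | smul r y _ hy => rw [f.map_update_smul]; exact P.smul_mem r hy
    simpa using key (x a) (h1 a (Finset.mem_insert_self a T))

theorem detLattice_span {K : Type k} [Field K] [Algebra R K] {n : ℕ} (s : Set (Fin n → K)) :
    detLattice (Submodule.span R s) =
      Submodule.span R {t | ∃ x : Fin n → Fin n → K, (∀ i, x i ∈ s) ∧ t = (Matrix.of x).det} := by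
  refine le_antisymm (detLattice_le.mpr fun x hx => ?_) (Submodule.span_mono ?_)
  · have h : ∀ y : Fin n → Fin n → K, (∀ i, y i ∈ s) →
        ((detRowAlternating (R := K) (n := Fin n)).toMultilinearMap.restrictScalars R) y ∈
          Submodule.span R {t | ∃ x : Fin n → Fin n → K,
            (∀ i, x i ∈ s) ∧ t = (Matrix.of x).det} :=
      fun y hy => Submodule.subset_span ⟨y, hy, rfl⟩
    exact mem_of_forall_mem_span _ h hx
  · rintro _ ⟨x, hx, rfl⟩
    exact ⟨x, fun i => Submodule.subset_span (hx i), rfl⟩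

theorem range_mul'_comp_map {K : Type k} [CommRing K] [Algebra R K] {M N : Type*} [AddCommMonoid M]
    [Module R M] [AddCommMonoid N] [Module R N] (f : M →ₗ[R] K) (g : N →ₗ[R] K) :
    LinearMap.range (LinearMap.mul' R K ∘ₗ TensorProduct.map f g) =
      LinearMap.range f * LinearMap.range g := by
  refine le_antisymm ?_ (Submodule.mul_le.mpr ?_)
  · rintro _ ⟨t, rfl⟩
    induction t with
    | zero => simp
    | tmul m n => exact Submodule.mul_mem_mul ⟨m, rfl⟩ ⟨n, rfl⟩
    | add x y hx hy => rw [map_add]; exact add_mem hx hy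
  · rintro _ ⟨m, rfl⟩ _ ⟨n, rfl⟩
    exact ⟨m ⊗ₜ n, rfl⟩

/-- The multiplication `K ⊗ K → K` is bijective over `R`, and flatness keeps `f ⊗ g` injective. -/
theorem injective_mul'_comp_map [IsDomain R] {K : Type k} [Field K] [Algebra R K]
    [IsFractionRing R K] {M N : Type*} [AddCommGroup M] [Module R M] [AddCommGroup N] [Module R N]
    [Flat R N] {f : M →ₗ[R] K} {g : N →ₗ[R] K} (hf : Function.Injective f)
    (hg : Function.Injective g) :
    Function.Injective (LinearMap.mul' R K ∘ₗ TensorProduct.map f g) := by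
  have : Flat R K := IsLocalization.flat K R⁰
  rw [LinearMap.coe_comp]
  refine (IsLocalization.bijective_linearMap_mul' R⁰ K).1.comp ?_
  have : TensorProduct.map f g = LinearMap.lTensor K g ∘ₗ LinearMap.rTensor N f := by
    rw [LinearMap.lTensor_comp_rTensor]
  rw [this, LinearMap.coe_comp]
  exact (Flat.lTensor_preserves_injective_linearMap g hg).comp
    (Flat.rTensor_preserves_injective_linearMap f hf)

end Span

/-! ### Ideals generated by squares. -/

section Squares

variable {R : Type u} [CommRing R] [IsDedekindDomain R] {K : Type k} [Field K] [Algebra R K]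
  [IsFractionRing R K]

/-- Since `I + I = I` for ideals, `(x + y)³ = (x² + y²)(x + y)`. Cancelling `x + y` gives `xy ≤ x² +
y²`. -/
theorem mul_mem_span_sq (a b : K) : a * b ∈ Submodule.span R {a ^ 2, b ^ 2} := by
  by_cases ha : a = 0
  · rw [ha, zero_mul]; exact zero_mem _
  set x := FractionalIdeal.spanSingleton R⁰ a with hx
  set y := FractionalIdeal.spanSingleton R⁰ b with hy
  have hidem : ∀ I : FractionalIdeal R⁰ K, I + I = I := fun I => by
    rw [← FractionalIdeal.sup_eq_add, sup_idem]
  have h1 : (x + y) * (x + y) * (x + y) = (x * x + y * y) * (x + y) := by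
    have : (x + y) * (x + y) * (x + y) =
        x * x * x + y * y * y + (x * x * y + x * x * y + x * x * y) +
          (x * y * y + x * y * y + x * y * y) := by ring
    rw [this]
    simp only [hidem]
    ring
  have h0 : x + y ≠ 0 := by
    intro h
    have h2 : x ≤ 0 := by rw [← h, ← FractionalIdeal.sup_eq_add]; exact le_sup_left
    have h3 : a ∈ (0 : FractionalIdeal R⁰ K) := h2 (FractionalIdeal.mem_spanSingleton_self R⁰ a)
    exact ha ((FractionalIdeal.mem_zero_iff _).mp h3)
  have h2 := mul_right_cancel₀ h0 h1
  have h3 : x * y ≤ x * x + y * y := by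
    rw [← h2]
    have : (x + y) * (x + y) = x * y + (x * x + x * y + y * y) := by ring
    rw [this, ← FractionalIdeal.sup_eq_add]
    exact le_sup_left
  have h4 : a * b ∈ x * y := by
    rw [hx, hy, FractionalIdeal.spanSingleton_mul_spanSingleton]
    exact FractionalIdeal.mem_spanSingleton_self _ _
  have h5 := h3 h4
  rw [hx, hy, FractionalIdeal.spanSingleton_mul_spanSingleton,
    FractionalIdeal.spanSingleton_mul_spanSingleton, ← FractionalIdeal.mem_coe,
    FractionalIdeal.coe_add, FractionalIdeal.coe_spanSingleton,
    FractionalIdeal.coe_spanSingleton] at h5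
  rw [Submodule.span_insert, sq, sq]
  exact h5

/-- The squares of the elements of `𝔡` generate `𝔡²`. This is what makes the quadratic dependence of
`φ(l ⊗ x)^□` on `l` harmless. -/
theorem mem_of_forall_sq_mul_mem {𝔡 : FractionalIdeal R⁰ K} (h𝔡 : 𝔡 ≠ 0) {p : K}
    (h : ∀ d ∈ 𝔡, d ^ 2 * p ∈ 𝔡 ^ 3) : p ∈ 𝔡 := by
  have h1 : 𝔡 * 𝔡 * FractionalIdeal.spanSingleton R⁰ p ≤ 𝔡 ^ 3 := by
    rw [mul_comm, FractionalIdeal.spanSingleton_mul_le_iff]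
    intro z hz
    refine FractionalIdeal.mul_induction_on hz (fun i hi j hj => ?_) (fun x y hx hy => ?_)
    · have := mul_mem_span_sq (R := R) i j
      obtain ⟨r, s, hrs⟩ := Submodule.mem_span_pair.mp this
      have e : p * (i * j) = r • (i ^ 2 * p) + s • (j ^ 2 * p) := by
        rw [← hrs]; simp only [Algebra.smul_def]; ring
      rw [e, ← FractionalIdeal.mem_coe]
      exact add_mem (Submodule.smul_mem _ r (h i hi)) (Submodule.smul_mem _ s (h j hj))
    · rw [mul_add]; exact Submodule.add_mem (↑(𝔡 ^ 3) : Submodule R K) hx hy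
  have h2 : FractionalIdeal.spanSingleton R⁰ p * (𝔡 * 𝔡) ≤ 𝔡 * (𝔡 * 𝔡) := by
    rw [mul_comm _ (𝔡 * 𝔡)]
    convert h1 using 1
    ring
  rw [mul_le_mul_iff_of_ne_zero (mul_ne_zero h𝔡 h𝔡)] at h2
  exact FractionalIdeal.spanSingleton_le_iff_mem.mp h2

end Squares

end Ideals

/-! ### The fractional ideals of values of the volume form and of the pentaquadratic form. -/

section Index

open scoped nonZeroDivisors
open Module Matrix

section Forms

variable {S : Type u} [CommRing S] {K : Type k} [Field K] [Algebra S K]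
  {A : Type v} [CommRing A] [Algebra S A]

/-- The linear form on `D^{⊗ 2}` that is induced by a linear form on `D`. -/
def pairForm (δ : D S A →ₗ[S] K) : D S A ⊗[S] D S A →ₗ[S] K :=
  LinearMap.mul' S K ∘ₗ TensorProduct.map δ δ

theorem pairForm_pentaForm (δ : D S A →ₗ[S] K) (a b c d e : A) :
    pairForm δ (pentaForm S a b c d e) = pfaff (wedgeForm δ) a b c d e := by
  simp [pairForm, pentaForm, pfaff, wedgeForm]

theorem pairForm_injective [IsDomain S] [IsFractionRing S K] [Flat S (D S A)]
    {δ : D S A →ₗ[S] K} (hδ : Function.Injective δ) : Function.Injective (pairForm δ) :=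
  injective_mul'_comp_map hδ hδ

theorem tripleForm_injective [IsDomain S] [IsFractionRing S K] [Flat S (D S A)]
    {δ : D S A →ₗ[S] K} (hδ : Function.Injective δ) : Function.Injective (tripleForm δ) :=
  injective_mul'_comp_map hδ (injective_mul'_comp_map hδ hδ)

theorem range_pairForm (δ : D S A →ₗ[S] K) :
    LinearMap.range (pairForm δ) = LinearMap.range δ * LinearMap.range δ :=
  range_mul'_comp_map δ δ

theorem range_tripleForm (δ : D S A →ₗ[S] K) :
    LinearMap.range (tripleForm δ) =
      LinearMap.range δ * (LinearMap.range δ * LinearMap.range δ) :=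
  (range_mul'_comp_map _ _).trans (congrArg _ (range_mul'_comp_map δ δ))

end Forms

variable {R : Type u} [CommRing R] [IsDedekindDomain R] {Q : Type v} [CommRing Q] [Algebra R Q]
  {K : Type k} [Field K] [Algebra R K] [IsFractionRing R K]

section VolumeIdeal

variable [Module.Finite R Q] (δ : D R Q →ₗ[R] K)

/-- The fractional ideal `δ(D)`. -/
def volIdeal : FractionalIdeal R⁰ K :=
  ⟨LinearMap.range δ, FractionalIdeal.isFractional_of_fg (Module.Finite.iff_fg.mp inferInstance)⟩

theorem coe_volIdeal : (volIdeal δ : Submodule R K) = LinearMap.range δ := rfl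

theorem volIdeal_ne_zero {δ : D R Q →ₗ[R] K} (h : δ ≠ 0) : volIdeal δ ≠ 0 := by
  intro h0
  refine h (LinearMap.ext fun d => ?_)
  have : δ d ∈ volIdeal δ := ⟨d, rfl⟩
  rw [h0] at this
  exact (FractionalIdeal.mem_zero_iff _).mp this

theorem pfaffForm_mem (X : Fin 5 → Q) : pfaffForm δ X ∈ volIdeal δ * volIdeal δ := by
  rw [← FractionalIdeal.mem_coe, FractionalIdeal.coe_mul, coe_volIdeal, ← range_pairForm,
    pfaffForm, ← pairForm_pentaForm]
  exact ⟨_, rfl⟩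

/-- The fractional ideal that is generated by the values of the pentaquadratic form. -/
def pfaffIdeal : FractionalIdeal R⁰ K :=
  ⟨Submodule.span R (Set.range (pfaffForm δ)),
    FractionalIdeal.isFractional_of_le (J := volIdeal δ * volIdeal δ) (Submodule.span_le.mpr (by
      rintro _ ⟨X, rfl⟩
      exact pfaffForm_mem δ X))⟩

theorem coe_pfaffIdeal : (pfaffIdeal δ : Submodule R K) =
    Submodule.span R (Set.range (pfaffForm δ)) := rfl

theorem pfaffIdeal_le : pfaffIdeal δ ≤ volIdeal δ * volIdeal δ := by
  rw [← FractionalIdeal.coe_le_coe, coe_pfaffIdeal, Submodule.span_le]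
  rintro _ ⟨X, rfl⟩
  exact pfaffForm_mem δ X

theorem map_span_pentaForm : (Submodule.span R {t : D R Q ⊗[R] D R Q |
      ∃ a b c d e : Q, t = pentaForm R a b c d e}).map (pairForm δ) =
    (pfaffIdeal δ : Submodule R K) := by
  rw [coe_pfaffIdeal, Submodule.map_span]
  congr 1
  ext t
  constructor
  · rintro ⟨_, ⟨a, b, c, d, e, rfl⟩, rfl⟩
    exact ⟨![a, b, c, d, e], (pairForm_pentaForm δ a b c d e).symm⟩
  · rintro ⟨X, rfl⟩
    exact ⟨_, ⟨X 0, X 1, X 2, X 3, X 4, rfl⟩, pairForm_pentaForm δ _ _ _ _ _⟩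

variable {δ}

theorem flat_D (hδ : Function.Injective δ) : Flat R (D R Q) := by
  have : IsTorsionFree R (D R Q) := hδ.moduleIsTorsionFree δ (map_smul δ)
  infer_instance

theorem mem_indexIdeal_iff (hδ : Function.Injective δ) {r : R} : r ∈ indexIdeal R Q ↔
    FractionalIdeal.spanSingleton R⁰ (algebraMap R K r) * (volIdeal δ * volIdeal δ) ≤
      pfaffIdeal δ := by
  have := flat_D hδ
  rw [indexIdeal, Submodule.mem_colon, FractionalIdeal.spanSingleton_mul_le_iff]
  constructor
  · intro h z hz
    rw [← FractionalIdeal.mem_coe, FractionalIdeal.coe_mul, coe_volIdeal, ← range_pairForm] at hz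
    obtain ⟨t, rfl⟩ := hz
    rw [← FractionalIdeal.mem_coe, ← map_span_pentaForm, ← Algebra.smul_def, ← map_smul]
    exact Submodule.mem_map_of_mem (h t trivial)
  · intro h t _
    have h1 := h (pairForm δ t) (by
      rw [← FractionalIdeal.mem_coe, FractionalIdeal.coe_mul, coe_volIdeal, ← range_pairForm]
      exact ⟨t, rfl⟩)
    rw [← FractionalIdeal.mem_coe, ← map_span_pentaForm, ← Algebra.smul_def, ← map_smul] at h1
    obtain ⟨s, hs, hst⟩ := h1
    rwa [← pairForm_injective hδ hst]

/-- The relation 𝔤 = 𝔠 𝔡². As 𝔡² is invertible, the colon ideal is a quotient of fractional ideals.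
-/
theorem indexIdeal_mul (hδ : Function.Injective δ) (h0 : δ ≠ 0) :
    pfaffIdeal δ = (indexIdeal R Q : FractionalIdeal R⁰ K) * (volIdeal δ * volIdeal δ) := by
  have h1 : volIdeal δ * volIdeal δ ≠ 0 :=
    mul_ne_zero (volIdeal_ne_zero h0) (volIdeal_ne_zero h0)
  obtain ⟨b, hb⟩ := exists_coeIdeal_mul_eq h1 (pfaffIdeal_le δ)
  have : indexIdeal R Q = b := by
    ext r
    rw [mem_indexIdeal_iff hδ, hb, mul_le_mul_iff_of_ne_zero h1,
      FractionalIdeal.spanSingleton_le_iff_mem, FractionalIdeal.mem_coeIdeal]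
    constructor
    · rintro ⟨x, hx, hxr⟩
      rwa [← IsFractionRing.injective R K hxr]
    · exact fun hr => ⟨r, hr, rfl⟩
  rw [this, hb]

theorem pfaffIdeal_ne_zero {X : Fin 5 → Q} (hX : pfaffForm δ X ≠ 0) : pfaffIdeal δ ≠ 0 := by
  intro h0
  have : pfaffForm δ X ∈ pfaffIdeal δ := Submodule.subset_span ⟨X, rfl⟩
  rw [h0] at this
  exact hX ((FractionalIdeal.mem_zero_iff _).mp this)

theorem indexIdeal_ne_bot (hδ : Function.Injective δ) (h0 : δ ≠ 0) {X : Fin 5 → Q}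
    (hX : pfaffForm δ X ≠ 0) : indexIdeal R Q ≠ ⊥ := by
  intro h
  have := indexIdeal_mul hδ h0
  rw [h, FractionalIdeal.coeIdeal_bot, zero_mul] at this
  exact pfaffIdeal_ne_zero hX this

variable (δ) in
/-- The lattice dual to the coordinate vectors of the elements of `Q`. -/
def coordDual (X : Fin 5 → Q) : Submodule R (Fin 5 → K) :=
  dualLattice (Submodule.span R (Set.range (coords δ X))) (volIdeal δ)

theorem mem_coordDual {X : Fin 5 → Q} {y : Fin 5 → K} :
    y ∈ coordDual δ X ↔ ∀ x : Q, coords δ X x ⬝ᵥ y ∈ volIdeal δ := by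
  refine ⟨fun h x => h _ (Submodule.subset_span ⟨x, rfl⟩), fun h x hx => ?_⟩
  induction hx using Submodule.span_induction with
  | mem x hx => obtain ⟨q, rfl⟩ := hx; exact h q
  | zero => rw [zero_dotProduct]; exact FractionalIdeal.zero_mem _
  | add x z _ _ hx hz =>
    rw [add_dotProduct]; exact Submodule.add_mem (volIdeal δ : Submodule R K) hx hz
  | smul r x _ hx =>
    rw [smul_dotProduct]; exact Submodule.smul_mem (volIdeal δ : Submodule R K) r hx

/-- By `hdet` the coordinate vectors span a lattice of determinant F(X)⁻¹ 𝔤, and `coordDual` is its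
dual with values in 𝔡. -/
theorem detLattice_coordDual (h0 : δ ≠ 0) {X : Fin 5 → Q} (hX : pfaffForm δ X ≠ 0)
    (hdet : ∀ Y : Fin 5 → Q,
      (Matrix.of fun i => coords δ X (Y i)).det * pfaffForm δ X = pfaffForm δ Y) :
    detLattice (coordDual δ X) = ((volIdeal δ ^ 5 * (pfaffIdeal δ)⁻¹ *
      FractionalIdeal.spanSingleton R⁰ (pfaffForm δ X) : FractionalIdeal R⁰ K) :
        Submodule R K) := by
  have hJ : FractionalIdeal.spanSingleton R⁰ (pfaffForm δ X)⁻¹ * pfaffIdeal δ ≠ 0 :=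
    mul_ne_zero (FractionalIdeal.spanSingleton_ne_zero_iff.mpr (inv_ne_zero hX))
      (pfaffIdeal_ne_zero hX)
  rw [coordDual, detLattice_dualLattice hJ _ (volIdeal_ne_zero h0)]
  · congr 1
    rw [mul_inv, FractionalIdeal.spanSingleton_inv, inv_inv]
    ring
  · rw [detLattice_span, FractionalIdeal.coe_mul, FractionalIdeal.coe_spanSingleton,
      coe_pfaffIdeal, Submodule.span_mul_span]
    congr 1
    ext t
    rw [Set.singleton_mul]
    constructor
    · rintro ⟨_, ⟨Y, rfl⟩, rfl⟩
      refine ⟨fun i => coords δ X (Y i), fun i => ⟨Y i, rfl⟩, ?_⟩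
      rw [← hdet Y]
      field_simp
    · rintro ⟨x, hx, rfl⟩
      choose Y hY using hx
      refine ⟨_, ⟨Y, rfl⟩, ?_⟩
      dsimp only
      rw [← hdet Y, mul_comm, mul_assoc, mul_inv_cancel₀ hX, mul_one]
      congr 2
      ext i : 1
      exact hY i

end VolumeIdeal

end Index

/-! ## The bounding index -/

section BoundingIndex

open scoped nonZeroDivisors
open Module Matrix

variable {R : Type u} [CommRing R] [IsDedekindDomain R] {Q : Type v} [CommRing Q] [Algebra R Q]
  {K : Type k} [Field K] [Algebra R K] [IsFractionRing R K]
  {δK : D K (baseChange R K Q) →ₗ[K] K} {δ : D R Q →ₗ[R] K}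

theorem mul_mul_le {R : Type*} [CommSemiring R] {A : Type*} [CommSemiring A] [Algebra R A]
    {N P : Submodule R A} (h : ∀ a ∈ N, ∀ b ∈ N, ∀ c ∈ N, a * (b * c) ∈ P) : N * (N * N) ≤ P := by
  refine Submodule.mul_le.mpr fun a ha n hn => ?_
  induction hn using Submodule.mul_induction_on' with
  | mem_mul_mem b hb c hc => exact h a ha b hb c hc
  | add y _ z _ hy hz => rw [mul_add]; exact add_mem hy hz

namespace VolumeForms

theorem wedgeForm_eq (hV : VolumeForms K δK δ) (x y z : Q) :
    wedgeForm δ x y z = wedgeForm δK (1 ⊗ₜ x : baseChange R K Q) (1 ⊗ₜ y) (1 ⊗ₜ z) := by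
  have h : (1 ⊗ₜ y : baseChange R K Q) * (1 ⊗ₜ z) = 1 ⊗ₜ (y * z) := by
    rw [Algebra.TensorProduct.tmul_mul_tmul, one_mul]
  rw [wedgeForm, wedgeForm, wedgeProd, wedgeProd, hV.compat, h]
  congr 2

theorem pfaffForm_eq (hV : VolumeForms K δK δ) (X : Fin 5 → Q) :
    pfaffForm δ X = pfaffForm δK (fun i => (1 ⊗ₜ X i : baseChange R K Q)) := by
  simp only [pfaffForm, pfaff, hV.wedgeForm_eq]

theorem coords_eq (hV : VolumeForms K δK δ) (X : Fin 5 → Q) (x : Q) :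
    coords δ X x = coords δK (fun i => (1 ⊗ₜ X i : baseChange R K Q)) (1 ⊗ₜ x) := by
  ext i
  rw [coords, coords, hV.pfaffForm_eq, hV.pfaffForm_eq]
  congr 2
  ext j
  by_cases h : j = i
  · subst h; simp
  · simp [h]

/-- F is quadratic in each argument, so clearing denominators carries its vanishing from `Q` to
`Q_K`. -/
theorem exists_pfaffForm_ne_zero (hV : VolumeForms K δK δ) (hQ : IsQuinticRing R Q)
    (hnd : ¬ IsVeryDegenerate K (baseChange R K Q)) : ∃ X : Fin 5 → Q, pfaffForm δ X ≠ 0 := by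
  by_contra! h
  refine hnd (isVeryDegenerate_of_pfaff_eq_zero
    (vol := δK.compAlternatingMap (exteriorPower.ιMulti K 4))
    ((finrank_baseChange_eq K).trans hQ.rank) hV.ιMulti_ne_zero fun a b c d e => ?_)
  obtain ⟨ra, hra, a', ha⟩ := exists_smul_eq_tmul K a
  obtain ⟨rb, hrb, b', hb⟩ := exists_smul_eq_tmul K b
  obtain ⟨rc, hrc, c', hc⟩ := exists_smul_eq_tmul K c
  obtain ⟨rd, hrd, d', hd⟩ := exists_smul_eq_tmul K d
  obtain ⟨re, hre, e', he⟩ := exists_smul_eq_tmul K e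
  have h1 := h ![a', b', c', d', e']
  rw [hV.pfaffForm_eq] at h1
  have h2 : pfaff (wedgeForm δK) (1 ⊗ₜ a' : baseChange R K Q) (1 ⊗ₜ b') (1 ⊗ₜ c') (1 ⊗ₜ d')
    (1 ⊗ₜ e') = 0 := h1
  rw [← ha, ← hb, ← hc, ← hd, ← he] at h2
  have hs : ∀ (s t r : K) (x y z : baseChange R K Q), wedgeForm δK (s • x) (t • y) (r • z) =
      s * t ^ 2 * r ^ 2 * wedgeForm δK x y z := by
    intro s t r x y z
    have : ∀ x y z : baseChange R K Q, wedgeForm δK x y z =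
      (δK.compAlternatingMap (exteriorPower.ιMulti K 4))
        ![toL K _ x, toL K _ y, toL K _ z, toL K _ (y * z)] := fun _ _ _ => rfl
    rw [this, this, smul_mul_smul_comm]
    simp only [map_smul, vol_smul_fst, vol_smul_snd, vol_smul_trd, vol_smul_fth]
    ring
  have hne : ∀ {r : R}, r ≠ 0 → algebraMap R K r ≠ 0 := fun {r} hr => by
    rwa [Ne, FaithfulSMul.algebraMap_eq_zero_iff]
  have h3 : (algebraMap R K ra * algebraMap R K rb * algebraMap R K rc * algebraMap R K rd *
      algebraMap R K re) ^ 2 * pfaff (wedgeForm δK) a b c d e = 0 := by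
    rw [← h2]
    simp only [pfaff, hs]
    ring
  refine (mul_eq_zero.mp h3).resolve_left (pow_ne_zero 2 ?_)
  exact mul_ne_zero (mul_ne_zero (mul_ne_zero (mul_ne_zero (hne hra) (hne hrb)) (hne hrc))
    (hne hrd)) (hne hre)

theorem map_latD (hV : VolumeForms K δK δ) :
    (latD R K Q).map (δK.restrictScalars R) = LinearMap.range δ := by
  refine le_antisymm ?_ ?_
  · rw [latD, Submodule.map_span, Submodule.span_le]
    rintro _ ⟨_, ⟨x, hx, rfl⟩, rfl⟩
    simp only [← range_toBaseChangeL] at hx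
    choose y hy using hx
    refine ⟨exteriorPower.ιMulti R 4 y, ?_⟩
    have : toBaseChangeL R Q K ∘ y = x := funext hy
    rw [hV.compat, this]
    rfl
  · rw [LinearMap.range_eq_map, ← exteriorPower.ιMulti_span, Submodule.map_span, Submodule.span_le]
    rintro _ ⟨_, ⟨y, rfl⟩, rfl⟩
    refine ⟨_, Submodule.subset_span ⟨toBaseChangeL R Q K ∘ y, fun i => ?_, rfl⟩,
      (hV.compat y).symm⟩
    rw [← range_toBaseChangeL]
    exact ⟨y i, rfl⟩

theorem map_latD3 (hV : VolumeForms K δK δ) :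
    (latD3 R K Q).map ((tripleForm δK).restrictScalars R) =
      LinearMap.range δ * (LinearMap.range δ * LinearMap.range δ) := by
  rw [← hV.map_latD]
  refine le_antisymm ?_ (mul_mul_le ?_)
  · rw [latD3, Submodule.map_span, Submodule.span_le]
    rintro _ ⟨_, ⟨a, ha, b, hb, c, hc, rfl⟩, rfl⟩
    have h : ∀ d ∈ latD R K Q, δK d ∈ (latD R K Q).map (δK.restrictScalars R) :=
      fun d hd => ⟨d, hd, rfl⟩
    exact Submodule.mul_mem_mul (h a ha) (Submodule.mul_mem_mul (h b hb) (h c hc))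
  · rintro _ ⟨a, ha, rfl⟩ _ ⟨b, hb, rfl⟩ _ ⟨c, hc, rfl⟩
    exact ⟨a ⊗ₜ[K] (b ⊗ₜ[K] c), Submodule.subset_span ⟨a, ha, b, hb, c, hc, rfl⟩, rfl⟩

end VolumeForms

theorem coe_volIdeal_pow_three [Module.Finite R Q] (δ : D R Q →ₗ[R] K) :
    ((volIdeal δ ^ 3 : FractionalIdeal R⁰ K) : Submodule R K) =
      LinearMap.range δ * (LinearMap.range δ * LinearMap.range δ) := by
  rw [FractionalIdeal.coe_pow, pow_succ', pow_two]
  rfl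

theorem VolumeForms.mem_latD3 [Module.Finite R Q] (hV : VolumeForms K δK δ)
    {t : D K (baseChange R K Q) ⊗[K] (D K (baseChange R K Q) ⊗[K] D K (baseChange R K Q))} :
    t ∈ latD3 R K Q ↔ tripleForm δK t ∈ volIdeal δ ^ 3 := by
  rw [← FractionalIdeal.mem_coe, coe_volIdeal_pow_three, ← hV.map_latD3]
  refine ⟨fun h => Submodule.mem_map_of_mem (f := (tripleForm δK).restrictScalars R) h, ?_⟩
  rintro ⟨s, hs, hst⟩
  rwa [← tripleForm_injective hV.injective_baseChange hst]

namespace Resolvent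

variable (ρ : Resolvent.{k, max k v, w} K (baseChange R K Q)) [Module R ρ.M]
  [IsScalarTower R K ρ.M]

theorem mem_thetaLattice [Module.Finite R Q] (hV : VolumeForms K δK δ) {t : ⋀[K]^5 ρ.M} :
    t ∈ ρ.thetaLattice R ↔ ρ.eta δK t ∈ volIdeal δ ^ 3 := hV.mem_latD3

theorem boxFunctional_add (a b : D K (baseChange R K Q) ⊗[K] L K (baseChange R K Q)) (v : ρ.M) :
    ρ.boxFunctional δK (a + b) v = ρ.boxFunctional δK a v + ρ.boxFunctional δK b v +
      ρ.eta δK (wedgeVec (wedge (ρ.φ a) (ρ.φ b)) v) := by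
  have h : ∀ α β γ : ⋀[K]^4 ρ.M, ρ.eta δK (wedgeVec (α + β + γ) v) =
      ρ.eta δK (wedgeVec α v) + ρ.eta δK (wedgeVec β v) + ρ.eta δK (wedgeVec γ v) :=
    fun α β γ => by simp only [wedgeVec_add, map_add]
  rw [boxFunctional, LinearMap.comp_apply, map_add, box_add]
  exact h _ _ _

/-- The polarization of `boxFunctional`. -/
def polarFunctional (δK : D K (baseChange R K Q) →ₗ[K] K) (v : ρ.M)
    (a b : D K (baseChange R K Q) ⊗[K] L K (baseChange R K Q)) : K :=
  ρ.eta δK (wedgeVec (wedge (ρ.φ a) (ρ.φ b)) v)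

theorem polarFunctional_add_left (v : ρ.M)
    (a a' b : D K (baseChange R K Q) ⊗[K] L K (baseChange R K Q)) :
    ρ.polarFunctional δK v (a + a') b =
      ρ.polarFunctional δK v a b + ρ.polarFunctional δK v a' b := by
  have h : ∀ α β : ⋀[K]^4 ρ.M, ρ.eta δK (wedgeVec (α + β) v) =
      ρ.eta δK (wedgeVec α v) + ρ.eta δK (wedgeVec β v) :=
    fun α β => by rw [wedgeVec_add, map_add]
  rw [polarFunctional, map_add, wedge_add_left]
  exact h _ _

theorem polarFunctional_add_right (v : ρ.M)
    (a b b' : D K (baseChange R K Q) ⊗[K] L K (baseChange R K Q)) :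
    ρ.polarFunctional δK v a (b + b') =
      ρ.polarFunctional δK v a b + ρ.polarFunctional δK v a b' := by
  have h : ∀ α β : ⋀[K]^4 ρ.M, ρ.eta δK (wedgeVec (α + β) v) =
      ρ.eta δK (wedgeVec α v) + ρ.eta δK (wedgeVec β v) :=
    fun α β => by rw [wedgeVec_add, map_add]
  rw [polarFunctional, map_add, wedge_add_right]
  exact h _ _

theorem polarFunctional_smul_left (v : ρ.M) (c : K)
    (a b : D K (baseChange R K Q) ⊗[K] L K (baseChange R K Q)) :
    ρ.polarFunctional δK v (c • a) b = c * ρ.polarFunctional δK v a b := by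
  have h : ∀ α : ⋀[K]^4 ρ.M, ρ.eta δK (wedgeVec (c • α) v) =
      c * ρ.eta δK (wedgeVec α v) := fun α => by rw [wedgeVec_smul, map_smul, smul_eq_mul]
  rw [polarFunctional, map_smul, wedge_smul_left]
  exact h _

theorem polarFunctional_smul_right (v : ρ.M) (c : K)
    (a b : D K (baseChange R K Q) ⊗[K] L K (baseChange R K Q)) :
    ρ.polarFunctional δK v a (c • b) = c * ρ.polarFunctional δK v a b := by
  have h : ∀ α : ⋀[K]^4 ρ.M, ρ.eta δK (wedgeVec (c • α) v) =
      c * ρ.eta δK (wedgeVec α v) := fun α => by rw [wedgeVec_smul, map_smul, smul_eq_mul]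
  rw [polarFunctional, map_smul, wedge_smul_right]
  exact h _

theorem boxFunctional_tmul (hV : VolumeForms K δK δ) {l : D K (baseChange R K Q)} (hl : δK l ≠ 0)
    (v : ρ.M) (d : D K (baseChange R K Q)) (q : Q) :
    ρ.boxFunctional δK (d ⊗ₜ toL K (baseChange R K Q) (1 ⊗ₜ q)) v =
      δK d ^ 2 * ρ.functional δK l (1 ⊗ₜ q) v := by
  rw [ρ.boxFunctional_eq hV.injective_baseChange hl]; rfl

/-- `δK` is injective, so both tensors are multiples of tensors with the same first factor `l`. On
these, the polar form is that of the quadratic map `x ↦ P_x(v)`. -/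
theorem polarFunctional_tmul (hV : VolumeForms K δK δ) {l : D K (baseChange R K Q)}
    (hl : δK l ≠ 0) (v : ρ.M) (d d' : D K (baseChange R K Q)) (q q' : Q) :
    ρ.polarFunctional δK v (d ⊗ₜ toL K (baseChange R K Q) (1 ⊗ₜ q))
      (d' ⊗ₜ toL K (baseChange R K Q) (1 ⊗ₜ q')) =
      δK d * (δK d' * (ρ.functional δK l (1 ⊗ₜ (q + q')) v - ρ.functional δK l (1 ⊗ₜ q) v -
        ρ.functional δK l (1 ⊗ₜ q') v)) := by
  have hd : ∀ d, (δK d / δK l) • l = d := fun d => hV.injective_baseChange (by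
    rw [map_smul, smul_eq_mul, div_mul_cancel₀ _ hl])
  have h1 := ρ.boxFunctional_add (δK := δK) (l ⊗ₜ toL K (baseChange R K Q) (1 ⊗ₜ q))
    (l ⊗ₜ toL K (baseChange R K Q) (1 ⊗ₜ q')) v
  rw [← TensorProduct.tmul_add, ← map_add, ← TensorProduct.tmul_add,
    ρ.boxFunctional_tmul hV hl, ρ.boxFunctional_tmul hV hl, ρ.boxFunctional_tmul hV hl] at h1
  have h3 : ρ.polarFunctional δK v (l ⊗ₜ toL K (baseChange R K Q) (1 ⊗ₜ q))
      (l ⊗ₜ toL K (baseChange R K Q) (1 ⊗ₜ q')) =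
      δK l ^ 2 * (ρ.functional δK l (1 ⊗ₜ (q + q')) v -
        ρ.functional δK l (1 ⊗ₜ q) v - ρ.functional δK l (1 ⊗ₜ q') v) := by
    rw [polarFunctional]; linear_combination -h1
  have h4 : ∀ d (x : L K (baseChange R K Q)), d ⊗ₜ[K] x = (δK d / δK l) • (l ⊗ₜ[K] x) :=
    fun d x => by rw [TensorProduct.smul_tmul', hd]
  rw [h4 d, h4 d', polarFunctional_smul_left, polarFunctional_smul_right, h3]
  field_simp

theorem _root_.QuinticResolvent.VolumeForms.mem_volIdeal [Module.Finite R Q]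
    (hV : VolumeForms K δK δ) {d : D K (baseChange R K Q)} (hd : d ∈ latD R K Q) :
    δK d ∈ volIdeal δ := by
  rw [← FractionalIdeal.mem_coe, coe_volIdeal, ← hV.map_latD]
  exact Submodule.mem_map_of_mem (f := δK.restrictScalars R) hd

theorem _root_.QuinticResolvent.exists_eq_toL {x : L K (baseChange R K Q)}
    (hx : x ∈ latL R K Q) : ∃ q : Q, x = toL K (baseChange R K Q) (1 ⊗ₜ q) := by
  rw [← range_toBaseChangeL] at hx
  obtain ⟨y, rfl⟩ := hx
  obtain ⟨q, rfl⟩ := Submodule.Quotient.mk_surjective _ y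
  exact ⟨q, rfl⟩

/-- The bounding lattice also tests sums of pure tensors, and `box` of a sum produces these cross
terms. -/
theorem polarFunctional_mem [Module.Finite R Q] (hV : VolumeForms K δK δ)
    {l : D K (baseChange R K Q)} (hl : δK l ≠ 0) {v : ρ.M}
    (hv : ∀ x : Q, ρ.functional δK l (1 ⊗ₜ x) v ∈ volIdeal δ)
    {a b : D K (baseChange R K Q) ⊗[K] L K (baseChange R K Q)} (ha : a ∈ latDL R K Q)
    (hb : b ∈ latDL R K Q) : ρ.polarFunctional δK v a b ∈ volIdeal δ ^ 3 := by
  induction ha using Submodule.span_induction with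
  | mem a ha =>
    induction hb using Submodule.span_induction with
    | mem b hb =>
      obtain ⟨d, hdm, x, hx, rfl⟩ := ha
      obtain ⟨d', hdm', x', hx', rfl⟩ := hb
      obtain ⟨q, rfl⟩ := exists_eq_toL hx
      obtain ⟨q', rfl⟩ := exists_eq_toL hx'
      rw [ρ.polarFunctional_tmul hV hl, pow_succ', pow_two]
      refine FractionalIdeal.mul_mem_mul (hV.mem_volIdeal hdm)
        (FractionalIdeal.mul_mem_mul (hV.mem_volIdeal hdm') ?_)
      exact Submodule.sub_mem (volIdeal δ : Submodule R K)
        (Submodule.sub_mem (volIdeal δ : Submodule R K) (hv _) (hv _)) (hv _)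
    | zero =>
      rw [← zero_smul K (0 : D K (baseChange R K Q) ⊗[K] L K (baseChange R K Q)),
        polarFunctional_smul_right, zero_mul]
      exact FractionalIdeal.zero_mem _
    | add b b' _ _ h h' =>
      rw [polarFunctional_add_right]
      exact Submodule.add_mem (↑(volIdeal δ ^ 3) : Submodule R K) h h'
    | smul r b _ h =>
      rw [← algebraMap_smul K r b, polarFunctional_smul_right, ← Algebra.smul_def]
      exact Submodule.smul_mem (↑(volIdeal δ ^ 3) : Submodule R K) r h
  | zero =>
    rw [← zero_smul K (0 : D K (baseChange R K Q) ⊗[K] L K (baseChange R K Q)),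
      polarFunctional_smul_left, zero_mul]
    exact FractionalIdeal.zero_mem _
  | add a a' _ _ h h' =>
    rw [polarFunctional_add_left]
    exact Submodule.add_mem (↑(volIdeal δ ^ 3) : Submodule R K) h h'
  | smul r a _ h =>
    rw [← algebraMap_smul K r a, polarFunctional_smul_left, ← Algebra.smul_def]
    exact Submodule.smul_mem (↑(volIdeal δ ^ 3) : Submodule R K) r h

/-- A pure tensor gives `δK(d)² P_x(v) ∈ 𝔡³`, and the squares generate `𝔡²`, hence `P_x(v) ∈ 𝔡`.
Conversely, the condition on pure tensors extends to sums by polarization. -/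
theorem mem_boundingLattice [Module.Finite R Q] (hV : VolumeForms K δK δ)
    {l : D K (baseChange R K Q)} (hl : δK l ≠ 0) {v : ρ.M} :
    v ∈ ρ.boundingLattice R ↔ ∀ x : Q, ρ.functional δK l (1 ⊗ₜ x) v ∈ volIdeal δ := by
  have key : v ∈ ρ.boundingLattice R ↔
      ∀ a ∈ latDL R K Q, ρ.boxFunctional δK a v ∈ volIdeal δ ^ 3 :=
    forall₂_congr fun a _ => ρ.mem_thetaLattice hV
  rw [key]
  constructor
  · intro h x
    refine mem_of_forall_sq_mul_mem (volIdeal_ne_zero hV.ne_zero) fun d hd => ?_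
    rw [← FractionalIdeal.mem_coe, coe_volIdeal, ← hV.map_latD] at hd
    obtain ⟨e, he, rfl⟩ := hd
    rw [LinearMap.restrictScalars_apply, ← ρ.boxFunctional_tmul hV hl]
    exact h _ (Submodule.subset_span ⟨e, he, _, Submodule.subset_span ⟨x, rfl⟩, rfl⟩)
  · intro hv a ha
    induction ha using Submodule.span_induction with
    | mem a ha =>
      obtain ⟨d, hdm, x, hx, rfl⟩ := ha
      obtain ⟨q, rfl⟩ := exists_eq_toL hx
      rw [ρ.boxFunctional_tmul hV hl, pow_succ, pow_two, pow_two]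
      exact FractionalIdeal.mul_mem_mul
        (FractionalIdeal.mul_mem_mul (hV.mem_volIdeal hdm) (hV.mem_volIdeal hdm)) (hv q)
    | zero =>
      have : ρ.boxFunctional δK 0 v = 0 := by
        simp [boxFunctional, box, wedgeVec_zero]
      rw [this]; exact FractionalIdeal.zero_mem _
    | add a b ha hb h h' =>
      rw [boxFunctional_add]
      exact Submodule.add_mem (↑(volIdeal δ ^ 3) : Submodule R K)
        (Submodule.add_mem (↑(volIdeal δ ^ 3) : Submodule R K) h h')
        (ρ.polarFunctional_mem hV hl hv ha hb)
    | smul r a _ h =>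
      rw [← algebraMap_smul K r a, boxFunctional_smul, LinearMap.smul_apply,
        Algebra.algebraMap_self, RingHom.id_apply, smul_eq_mul, ← map_pow, ← Algebra.smul_def]
      exact Submodule.smul_mem (↑(volIdeal δ ^ 3) : Submodule R K) _ h

/-- The coordinates P_{X_i} carry the bounding lattice onto `coordDual`, and their determinant is
F(X) η. The index therefore compares F(X) 𝔡⁵ 𝔤⁻¹ with F(X) 𝔡³, or equivalently 𝔡² with 𝔤. -/
theorem boundingIndex_eq (hQ : IsQuinticRing R Q) (hV : VolumeForms K δK δ) {X : Fin 5 → Q}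
    (hX : pfaffForm δ X ≠ 0) : ρ.boundingIndex R = indexIdeal R Q := by
  have := hQ.finite
  have := ρ.finite
  have := ρ.torsionFree
  set 𝔡 := volIdeal δ with h𝔡
  have h𝔡0 : 𝔡 ≠ 0 := volIdeal_ne_zero hV.ne_zero
  have h𝔤0 := pfaffIdeal_ne_zero hX
  obtain ⟨l, hl⟩ : ∃ l, δK l ≠ 0 := by
    by_contra! h
    obtain ⟨d, hd⟩ := DFunLike.ne_iff.mp hV.ne_zero
    have : δ d ∈ LinearMap.range δ := ⟨d, rfl⟩
    rw [← hV.map_latD] at this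
    obtain ⟨e, -, he⟩ := this
    exact hd (he.symm.trans (h e))
  set X' : Fin 5 → baseChange R K Q := fun i => 1 ⊗ₜ X i with hX'
  have hXK : pfaffForm δK X' ≠ 0 := by rwa [hX', ← hV.pfaffForm_eq]
  have hdet : ∀ Y : Fin 5 → Q,
      (Matrix.of fun i => coords δ X (Y i)).det * pfaffForm δ X = pfaffForm δ Y := fun Y => by
    simp only [hV.coords_eq, hV.pfaffForm_eq]
    exact det_coords ρ hl hXK _
  have hJ := detLattice_coordDual hV.ne_zero hX hdet
  let j : ρ.M →ₗ[K] (Fin 5 → K) := LinearMap.pi fun i => ρ.functional δK l (X' i)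
  have hj : Function.Surjective j := by
    rw [← LinearMap.injective_iff_surjective_of_finrank_eq_finrank (by rw [ρ.rank]; simp)]
    rw [← LinearMap.ker_eq_bot, LinearMap.ker_eq_bot']
    exact fun m hm => ρ.eq_zero_of_forall_functional hl hXK fun i => congrFun hm i
  have hjdet : ∀ v : Fin 5 → ρ.M, (Matrix.of fun i => j (v i)).det =
      pfaffForm δ X * ρ.eta δK (exteriorPower.ιMulti K 5 v) := fun v => by
    rw [hV.pfaffForm_eq]
    exact ρ.det_functional' hl X' v
  have hjmem : ∀ v, j v ∈ coordDual δ X ↔ v ∈ ρ.boundingLattice R := fun v => by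
    rw [mem_coordDual, ρ.mem_boundingLattice hV hl]
    refine forall_congr' fun x => ?_
    rw [ρ.functional_eq_sum hl hXK, hV.coords_eq]
    rfl
  ext r
  have h1 : r ∈ ρ.boundingIndex R ↔ FractionalIdeal.spanSingleton R⁰ (algebraMap R K r) *
      (𝔡 ^ 5 * (pfaffIdeal δ)⁻¹ * FractionalIdeal.spanSingleton R⁰ (pfaffForm δ X)) ≤
        FractionalIdeal.spanSingleton R⁰ (pfaffForm δ X) * 𝔡 ^ 3 := by
    rw [boundingIndex, Submodule.mem_colon, FractionalIdeal.spanSingleton_mul_le_iff]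
    constructor
    · intro h z hz
      rw [← FractionalIdeal.mem_coe, ← hJ] at hz
      induction hz using Submodule.span_induction with
      | mem z hz =>
        obtain ⟨w, hw, rfl⟩ := hz
        choose v hv using fun i => hj (w i)
        obtain rfl : (fun i => j (v i)) = w := funext hv
        have h2 := h _ (Submodule.subset_span ⟨v, fun i => (hjmem _).mp (hw i), rfl⟩)
        rw [ρ.mem_thetaLattice hV, ← algebraMap_smul K r, map_smul, smul_eq_mul] at h2
        rw [FractionalIdeal.mem_singleton_mul]
        exact ⟨_, h2, by rw [hjdet]; ring⟩
      | zero => rw [mul_zero]; exact FractionalIdeal.zero_mem _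
      | add x y _ _ hx hy =>
        rw [mul_add]
        exact Submodule.add_mem (((FractionalIdeal.spanSingleton R⁰ (pfaffForm δ X) * 𝔡 ^ 3 :
          FractionalIdeal R⁰ K)) : Submodule R K) hx hy
      | smul c x _ hx =>
        rw [mul_smul_comm]
        exact Submodule.smul_mem (((FractionalIdeal.spanSingleton R⁰ (pfaffForm δ X) * 𝔡 ^ 3 :
          FractionalIdeal R⁰ K)) : Submodule R K) c hx
    · intro h s hs
      induction hs using Submodule.span_induction with
      | mem s hs =>
        obtain ⟨v, hv, rfl⟩ := hs
        have h2 := h _ (by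
          rw [← FractionalIdeal.mem_coe, ← hJ]
          exact det_mem_detLattice fun i => (hjmem _).mpr (hv i))
        rw [FractionalIdeal.mem_singleton_mul] at h2
        obtain ⟨y, hy, hyz⟩ := h2
        rw [ρ.mem_thetaLattice hV, ← algebraMap_smul K r, map_smul, smul_eq_mul]
        rw [hjdet] at hyz
        have : y = algebraMap R K r * ρ.eta δK (exteriorPower.ιMulti K 5 v) :=
          mul_left_cancel₀ hX (by linear_combination -hyz)
        rwa [← this]
      | zero => rw [smul_zero]; exact zero_mem _
      | add x y _ _ hx hy => rw [smul_add]; exact add_mem hx hy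
      | smul c x _ hx => rw [smul_comm]; exact Submodule.smul_mem _ c hx
  have h2 : 𝔡 ^ 3 * (pfaffIdeal δ)⁻¹ * FractionalIdeal.spanSingleton R⁰ (pfaffForm δ X) ≠ 0 :=
    mul_ne_zero (mul_ne_zero (pow_ne_zero 3 h𝔡0) (inv_ne_zero h𝔤0))
      (FractionalIdeal.spanSingleton_ne_zero_iff.mpr hX)
  have e1 : FractionalIdeal.spanSingleton R⁰ (algebraMap R K r) *
      (𝔡 ^ 5 * (pfaffIdeal δ)⁻¹ * FractionalIdeal.spanSingleton R⁰ (pfaffForm δ X)) =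
      FractionalIdeal.spanSingleton R⁰ (algebraMap R K r) * (𝔡 * 𝔡) *
      (𝔡 ^ 3 * (pfaffIdeal δ)⁻¹ * FractionalIdeal.spanSingleton R⁰ (pfaffForm δ X)) := by ring
  have e2 : FractionalIdeal.spanSingleton R⁰ (pfaffForm δ X) * 𝔡 ^ 3 =
      pfaffIdeal δ *
      (𝔡 ^ 3 * (pfaffIdeal δ)⁻¹ * FractionalIdeal.spanSingleton R⁰ (pfaffForm δ X)) := by
    have e3 : pfaffIdeal δ * (pfaffIdeal δ)⁻¹ = 1 := mul_inv_cancel₀ h𝔤0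
    calc _ = pfaffIdeal δ * (pfaffIdeal δ)⁻¹ *
          (FractionalIdeal.spanSingleton R⁰ (pfaffForm δ X) * 𝔡 ^ 3) := by rw [e3, one_mul]
      _ = _ := by ring
  rw [h1, e1, e2, mul_le_mul_iff_of_ne_zero h2, mem_indexIdeal_iff hV.injective]

end Resolvent

end BoundingIndex

/-! ## Counting numerical resolvents -/

section Numerical

open scoped nonZeroDivisors
open Module Matrix

section Naturality

variable {S : Type u} [CommRing S] {K : Type k} [CommRing K] [Algebra S K]
  {M : Type v} [AddCommGroup M] [Module S M] {N : Type w} [AddCommGroup N] [Module S N]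

theorem detPairing_map {n : ℕ} (g : Fin n → N →ₗ[S] K) (f : M →ₗ[S] N) (ω : ⋀[S]^n M) :
    detPairing g (exteriorPower.map n f ω) = detPairing (fun i => g i ∘ₗ f) ω := by
  have : detPairing g ∘ₗ exteriorPower.map n f = detPairing fun i => g i ∘ₗ f := by
    apply exteriorPower.linearMap_ext
    ext v
    simp [detPairing_ιMulti]
  exact LinearMap.congr_fun this ω

theorem detPairing_eq_sum {ι : Type*} [Fintype ι] {g : Fin 2 → M →ₗ[S] K} {P : ι → M →ₗ[S] K}
    {c : Fin 2 → ι → K} (h : ∀ j m, g j m = ∑ i, c j i * P i m) (ω : ⋀[S]^2 M) :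
    detPairing g ω = ∑ i, ∑ j, c 0 i * c 1 j * detPairing ![P i, P j] ω := by
  have hg : g = ![g 0, g 1] := by ext i : 1; fin_cases i <;> rfl
  induction ω using bivec_induction with
  | bivec a b =>
    rw [hg, detPairing_bivec]
    simp only [detPairing_bivec, h, Finset.sum_mul_sum]
    rw [← Finset.sum_sub_distrib, Finset.sum_comm, ← Finset.sum_comm]
    rw [Finset.sum_sub_distrib, Finset.sum_comm (f := fun i j => c 1 i * P i a * (c 0 j * P j b)),
      ← Finset.sum_sub_distrib]
    refine Finset.sum_congr rfl fun i _ => ?_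
    rw [← Finset.sum_sub_distrib]
    exact Finset.sum_congr rfl fun j _ => by ring
  | zero => simp
  | add x y hx hy => simp only [map_add, hx, hy, mul_add, Finset.sum_add_distrib]
  | smul r x hx => simp only [map_smul, hx, mul_smul_comm, Finset.smul_sum]

end Naturality

variable {R : Type u} [CommRing R] [IsDedekindDomain R] {Q : Type v} [CommRing Q] [Algebra R Q]
  {K : Type k} [Field K] [Algebra R K] [IsFractionRing R K] {δ : D R Q →ₗ[R] K}

/-! ### Resolvents over `R` as sublattices of a coordinate space. -/

namespace Resolvent

variable (ρ σ : Resolvent.{u, v, w} R Q)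

variable (δ) in
/-- The functionals of five elements of `Q`, as a map to a coordinate space. -/
def coordMap (l : D R Q) (X : Fin 5 → Q) : ρ.M →ₗ[R] (Fin 5 → K) :=
  LinearMap.pi fun i => ρ.functional δ l (X i)

variable {l : D R Q} {X : Fin 5 → Q}

theorem eta_mem [Module.Finite R Q] (ω : ⋀[R]^5 ρ.M) : ρ.eta δ ω ∈ volIdeal δ ^ 3 := by
  rw [← FractionalIdeal.mem_coe, coe_volIdeal_pow_three, ← range_tripleForm]
  exact ⟨_, rfl⟩

/-- η has values in 𝔡³, so `δ(d)² P_x(m)` lies in 𝔡³ for every `d`. -/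
theorem functional_mem [Module.Finite R Q] (hδ : Function.Injective δ) (hl : δ l ≠ 0) (x : Q)
    (m : ρ.M) : ρ.functional δ l x m ∈ volIdeal δ := by
  have h0 : δ ≠ 0 := fun h => hl (by rw [h]; rfl)
  refine mem_of_forall_sq_mul_mem (volIdeal_ne_zero h0) fun d hd => ?_
  obtain ⟨e, rfl⟩ := hd
  have h : ρ.boxFunctional δ (e ⊗ₜ toL R Q x) m = δ e ^ 2 * ρ.functional δ l x m := by
    rw [ρ.boxFunctional_eq hδ hl]; rfl
  rw [← h]
  exact ρ.eta_mem _

theorem coordMap_injective (hl : δ l ≠ 0) (hX : pfaffForm δ X ≠ 0) :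
    Function.Injective (ρ.coordMap δ l X) := by
  rw [← LinearMap.ker_eq_bot, LinearMap.ker_eq_bot']
  exact fun m hm => ρ.eq_zero_of_forall_functional hl hX fun i => congrFun hm i

theorem range_coordMap_le [Module.Finite R Q] (hδ : Function.Injective δ) (hl : δ l ≠ 0)
    (hX : pfaffForm δ X ≠ 0) : LinearMap.range (ρ.coordMap δ l X) ≤ coordDual δ X := by
  rintro _ ⟨m, rfl⟩
  rw [mem_coordDual]
  intro x
  have := ρ.functional_mem hδ hl x m
  rwa [ρ.functional_eq_sum hl hX] at this

theorem det_coordMap (hl : δ l ≠ 0) (v : Fin 5 → ρ.M) :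
    (Matrix.of fun i => ρ.coordMap δ l X (v i)).det =
      pfaffForm δ X * ρ.eta δ (exteriorPower.ιMulti R 5 v) :=
  ρ.det_functional' hl X v

/-- The determinant of the coordinates is F(X) η, and surjectivity of θ makes η fill all of 𝔡³. -/
theorem detLattice_range_coordMap [Module.Finite R Q] (hρ : ρ.IsNumerical) (hl : δ l ≠ 0) :
    detLattice (LinearMap.range (ρ.coordMap δ l X)) =
      ((FractionalIdeal.spanSingleton R⁰ (pfaffForm δ X) * volIdeal δ ^ 3 :
        FractionalIdeal R⁰ K) : Submodule R K) := by
  refine le_antisymm (detLattice_le.mpr fun x hx => ?_) ?_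
  · choose v hv using hx
    obtain rfl : (fun i => ρ.coordMap δ l X (v i)) = x := funext hv
    rw [ρ.det_coordMap hl, FractionalIdeal.mem_coe, FractionalIdeal.mem_singleton_mul]
    exact ⟨_, ρ.eta_mem _, rfl⟩
  · intro z hz
    rw [FractionalIdeal.mem_coe, FractionalIdeal.mem_singleton_mul] at hz
    obtain ⟨y, hy, rfl⟩ := hz
    rw [← FractionalIdeal.mem_coe, coe_volIdeal_pow_three, ← range_tripleForm] at hy
    obtain ⟨t, rfl⟩ := hy
    obtain ⟨ω, rfl⟩ := hρ.2 t
    have hω : ω ∈ Submodule.span R (Set.range (exteriorPower.ιMulti R 5 (M := ρ.M))) := by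
      rw [exteriorPower.ιMulti_span]; trivial
    change pfaffForm δ X * ρ.eta δ ω ∈ _
    induction hω using Submodule.span_induction with
    | mem ω hω =>
      obtain ⟨v, rfl⟩ := hω
      rw [← ρ.det_coordMap hl]
      exact det_mem_detLattice fun i => ⟨v i, rfl⟩
    | zero => rw [map_zero, mul_zero]; exact zero_mem _
    | add x y _ _ hx hy => rw [map_add, mul_add]; exact add_mem hx hy
    | smul r x _ hx => rw [map_smul, mul_smul_comm]; exact Submodule.smul_mem _ r hx

variable {ρ σ}

/-- A resolvent is determined by its image in the coordinate space. -/
theorem isIso_of_range_coordMap_eq [Module.Finite R Q] (hδ : Function.Injective δ) (hl : δ l ≠ 0)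
    (hX : pfaffForm δ X ≠ 0)
    (h : LinearMap.range (ρ.coordMap δ l X) = LinearMap.range (σ.coordMap δ l X)) :
    ρ.IsIso σ := by
  have := flat_D hδ
  have := σ.finite
  have := σ.torsionFree
  have : Projective R σ.M := projective_of_isTorsionFree
  let f : ρ.M ≃ₗ[R] σ.M :=
    (LinearEquiv.ofInjective _ (ρ.coordMap_injective hl hX)).trans
      ((LinearEquiv.ofEq _ _ h).trans
        (LinearEquiv.ofInjective _ (σ.coordMap_injective hl hX)).symm)
  have hf : ∀ m, σ.coordMap δ l X (f m) = ρ.coordMap δ l X m := by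
    intro m
    have h1 := LinearEquiv.apply_symm_apply
      (LinearEquiv.ofInjective _ (σ.coordMap_injective hl hX))
      (LinearEquiv.ofEq _ _ h (LinearEquiv.ofInjective _ (ρ.coordMap_injective hl hX) m))
    exact congrArg Subtype.val h1
  have hf' : ∀ i, σ.functional δ l (X i) ∘ₗ f.toLinearMap = ρ.functional δ l (X i) :=
    fun i => LinearMap.ext fun m => congrFun (hf m) i
  refine ⟨f, ?_, ?_⟩
  -- A bivector is determined by its values on pairs of functionals, all of which are combinations
  -- of the P_{X_i}. On pairs of these, the resolvent identity prescribes the values of `φ` in terms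
  -- of `Q` alone.
  · refine TensorProduct.ext' fun l' y => ?_
    obtain ⟨q, rfl⟩ := Submodule.Quotient.mk_surjective _ y
    rw [LinearMap.comp_apply, ← sub_eq_zero]
    refine eq_zero_of_detPairing_eq_zero fun g => ?_
    obtain ⟨v, -, hdet⟩ := σ.exists_det_ne_zero hl hX
    let g' : Fin 2 → σ.M →ₗ[R] K := fun i => Algebra.linearMap R K ∘ₗ g i
    choose c hc using fun j => exists_eq_sum_mul σ.rank hdet (g' j)
    have h0 : detPairing g' = Algebra.linearMap R K ∘ₗ detPairing g := by
      apply exteriorPower.linearMap_ext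
      ext x
      simp only [LinearMap.compAlternatingMap_apply, LinearMap.comp_apply, detPairing_ιMulti,
        Algebra.linearMap_apply, RingHom.map_det]
      rfl
    have h1 : ∀ i j, detPairing ![σ.functional δ l (X i), σ.functional δ l (X j)]
        (exteriorPower.map 2 f.toLinearMap (ρ.φ (l' ⊗ₜ toL R Q q)) - σ.φ (l' ⊗ₜ toL R Q q)) =
          0 := by
      intro i j
      have h2 : (fun k => (![σ.functional δ l (X i), σ.functional δ l (X j)] :
          Fin 2 → σ.M →ₗ[R] K) k ∘ₗ f.toLinearMap) =
          ![ρ.functional δ l (X i), ρ.functional δ l (X j)] := by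
        ext k : 1
        fin_cases k
        · exact hf' i
        · exact hf' j
      rw [map_sub, detPairing_map, h2, ρ.detPairing_functional hl, σ.detPairing_functional hl,
        sub_self]
    have h3 := detPairing_eq_sum hc
      (exteriorPower.map 2 f.toLinearMap (ρ.φ (l' ⊗ₜ toL R Q q)) - σ.φ (l' ⊗ₜ toL R Q q))
    simp only [h1, mul_zero, Finset.sum_const_zero] at h3
    rw [h0, LinearMap.comp_apply, Algebra.linearMap_apply,
      FaithfulSMul.algebraMap_eq_zero_iff] at h3
    exact h3
  -- Equal coordinates have equal determinants F(X) η, so the two η agree, and `tripleForm δ` is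
  -- injective.
  · have h4 : σ.eta δ ∘ₗ exteriorPower.map 5 f.toLinearMap = ρ.eta δ := by
      apply exteriorPower.linearMap_ext
      ext v
      have h1 := ρ.det_coordMap (X := X) hl v
      have h2 := σ.det_coordMap (X := X) hl (fun i => f (v i))
      simp only [hf] at h2
      rw [h1] at h2
      have h3 := mul_left_cancel₀ hX h2
      simp only [LinearMap.compAlternatingMap_apply, LinearMap.comp_apply,
        exteriorPower.map_apply_ιMulti]
      exact h3.symm
    exact LinearMap.ext fun ω => tripleForm_injective hδ (LinearMap.congr_fun h4 ω)

end Resolvent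

open Classical in
theorem resolventBound_eq {c : Ideal R}
    (hc : ∀ p ∈ UniqueFactorizationMonoid.normalizedFactors c, p ≠ ⊤ ∧ Finite (R ⧸ p)) :
    resolventBound c = (((UniqueFactorizationMonoid.normalizedFactors c).map fun p =>
      ∑ i ∈ Finset.range 5, Nat.card (R ⧸ p) ^ i).prod : ℕ) := by
  rw [resolventBound, Finset.prod_multiset_map_count, Nat.cast_prod]
  refine Finset.prod_congr rfl fun p hp => ?_
  obtain ⟨hpt, hfin⟩ := hc p (Multiset.mem_toFinset.mp hp)
  have : Nontrivial (R ⧸ p) := Ideal.Quotient.nontrivial_iff.mpr hpt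
  have h1 : (Nat.card (R ⧸ p) : ℚ) ≠ 1 := by
    exact_mod_cast (Finite.one_lt_card (α := R ⧸ p)).ne'
  rw [Nat.cast_pow, Nat.cast_sum, ← geom_sum_eq h1]
  simp only [Nat.cast_pow]

theorem finite_numericalResolventClass (hQ : IsQuinticRing R Q)
    (hδ : Function.Injective δ) (h0 : δ ≠ 0) (hX : ∃ X : Fin 5 → Q, pfaffForm δ X ≠ 0)
    (hfin : ∀ p : Ideal R, p.IsPrime → indexIdeal R Q ≤ p → Finite (R ⧸ p)) :
    Finite (NumericalResolventClass.{u, v, w} R Q) ∧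
      (Nat.card (NumericalResolventClass.{u, v, w} R Q) : ℚ) ≤
        resolventBound (indexIdeal R Q) := by
  have := hQ.finite
  obtain ⟨X, hX⟩ := hX
  obtain ⟨l, hl⟩ : ∃ l, δ l ≠ 0 := DFunLike.ne_iff.mp h0
  have hc := indexIdeal_ne_bot hδ h0 hX
  set c := indexIdeal R Q with hc'
  set s := UniqueFactorizationMonoid.normalizedFactors c with hs
  have hprime : ∀ p ∈ s, Prime p := fun p hp =>
    UniqueFactorizationMonoid.prime_of_normalized_factor p hp
  have hs' : ∀ p ∈ s, p.IsMaximal ∧ p ≠ ⊥ ∧ Finite (R ⧸ p) := fun p hp => by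
    have hp' := Ideal.isPrime_of_prime (hprime p hp)
    have hp0 := (hprime p hp).ne_zero
    exact ⟨hp'.isMaximal hp0, hp0, hfin p hp'
      (Ideal.le_of_dvd (UniqueFactorizationMonoid.dvd_of_mem_normalizedFactors hp))⟩
  have hprod : s.prod = c :=
    associated_iff_eq.mp (UniqueFactorizationMonoid.prod_normalizedFactors hc)
  rw [resolventBound_eq fun p hp => ⟨(hs' p hp).1.ne_top, (hs' p hp).2.2⟩, Nat.cast_le]
  -- With no numerical resolvent the bound is trivial. Otherwise one of them supplies the identity
  -- `det_coords`, which gives the determinant of `coordDual`.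
  rcases isEmpty_or_nonempty (NumericalResolventClass.{u, v, w} R Q) with hE | hE
  · exact ⟨inferInstance, by rw [Nat.card_of_isEmpty]; exact Nat.zero_le _⟩
  obtain ⟨ρ₀, -⟩ := Quotient.exists_rep hE.some
  have hJ := detLattice_coordDual h0 hX (fun Y => Resolvent.det_coords ρ₀.1 hl hX Y)
  have h𝔤0 := pfaffIdeal_ne_zero hX
  have hF0 := FractionalIdeal.spanSingleton_ne_zero_iff (R := R) (S := R⁰).mpr hX
  set J : FractionalIdeal R⁰ K := volIdeal δ ^ 5 * (pfaffIdeal δ)⁻¹ *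
      FractionalIdeal.spanSingleton R⁰ (pfaffForm δ X) with hJdef
  have hJ0 : J ≠ 0 := mul_ne_zero (mul_ne_zero (pow_ne_zero 5 (volIdeal_ne_zero h0))
    (inv_ne_zero h𝔤0)) hF0
  obtain ⟨hfinite, hcard⟩ := ncard_sublattices_le s hs' hJ0 hJ.symm
  rw [hprod] at hfinite hcard
  -- Numerical resolvents have index exactly `c` in `coordDual`: 𝔤 = 𝔠 𝔡² turns 𝔠 F(X) 𝔡⁵ 𝔤⁻¹ into
  -- F(X) 𝔡³.
  have hcJ : (c : FractionalIdeal R⁰ K) * J =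
      FractionalIdeal.spanSingleton R⁰ (pfaffForm δ X) * volIdeal δ ^ 3 := by
    have e := indexIdeal_mul hδ h0
    have e' : pfaffIdeal δ * (pfaffIdeal δ)⁻¹ = 1 := mul_inv_cancel₀ h𝔤0
    calc (c : FractionalIdeal R⁰ K) * J =
        ((c : FractionalIdeal R⁰ K) * (volIdeal δ * volIdeal δ)) * (pfaffIdeal δ)⁻¹ *
          (FractionalIdeal.spanSingleton R⁰ (pfaffForm δ X) * volIdeal δ ^ 3) := by
          rw [hJdef]; ring
      _ = _ := by rw [← e, e', one_mul]
  set T := {M | M ≤ coordDual δ X ∧ detLattice M =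
    (((c : FractionalIdeal R⁰ K) * J : FractionalIdeal R⁰ K) : Submodule R K)} with hT
  let Φ : NumericalResolventClass.{u, v, w} R Q → T := fun q =>
    ⟨LinearMap.range ((Quotient.out q).1.coordMap δ l X),
      (Quotient.out q).1.range_coordMap_le hδ hl hX, by
        rw [hcJ]; exact (Quotient.out q).1.detLattice_range_coordMap (Quotient.out q).2 hl⟩
  have hΦ : Function.Injective Φ := fun q q' h => by
    have h1 := Resolvent.isIso_of_range_coordMap_eq hδ hl hX (congrArg Subtype.val h)
    rw [← Quotient.out_eq q, ← Quotient.out_eq q']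
    exact Quotient.sound h1
  have : Finite T := hfinite.to_subtype
  exact ⟨Finite.of_injective Φ hΦ, (Nat.card_le_card_of_injective Φ hΦ).trans hcard⟩

end Numerical

end QuinticResolvent

end

theorem mainTheorem5 :
    (∀ (R : Type u) [CommRing R] [IsDedekindDomain R]
      (K : Type k) [Field K] [Algebra R K] [IsFractionRing R K]
      (Q : Type v) [CommRing Q] [Algebra R Q],
      QuinticResolvent.IsQuinticRing R Q →
      ¬ QuinticResolvent.IsVeryDegenerate K (QuinticResolvent.baseChange R K Q) →
        QuinticResolvent.indexIdeal R Q ≠ ⊥ ∧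
        (∀ (ρ : QuinticResolvent.Resolvent.{k, max k v, w} K (QuinticResolvent.baseChange R K Q))
          [Module R ρ.M] [IsScalarTower R K ρ.M],
          ρ.boundingIndex R = QuinticResolvent.indexIdeal R Q) ∧
        ((∀ p : Ideal R, p.IsPrime → QuinticResolvent.indexIdeal R Q ≤ p → Finite (R ⧸ p)) →
          Finite (QuinticResolvent.NumericalResolventClass.{u, v, w} R Q) ∧
          (Nat.card (QuinticResolvent.NumericalResolventClass.{u, v, w} R Q) : ℚ) ≤
            QuinticResolvent.resolventBound (QuinticResolvent.indexIdeal R Q))) ∧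
    (∀ (F : Type u) [Field F] [NumberField F]
      (Q : Type v) [CommRing Q] [Algebra (NumberField.RingOfIntegers F) Q],
      QuinticResolvent.IsQuinticRing (NumberField.RingOfIntegers F) Q →
      ¬ QuinticResolvent.IsVeryDegenerate F
          (QuinticResolvent.baseChange (NumberField.RingOfIntegers F) F Q) →
        Finite (QuinticResolvent.NumericalResolventClass.{u, v, w}
          (NumberField.RingOfIntegers F) Q)) := by
  refine ⟨fun R _ _ K _ _ _ Q _ _ hQ hnd => ?_, fun F _ _ Q _ _ hQ hnd => ?_⟩
  · obtain ⟨δK, δ, hV⟩ := QuinticResolvent.exists_volumeForms K hQ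
    have hX := hV.exists_pfaffForm_ne_zero hQ hnd
    have := hQ.finite
    refine ⟨?_, ?_, QuinticResolvent.finite_numericalResolventClass hQ hV.injective hV.ne_zero hX⟩
    · exact QuinticResolvent.indexIdeal_ne_bot hV.injective hV.ne_zero hX.choose_spec
    · intro ρ _ _
      exact ρ.boundingIndex_eq hQ hV hX.choose_spec
  · obtain ⟨δK, δ, hV⟩ := QuinticResolvent.exists_volumeForms F hQ
    have hX := hV.exists_pfaffForm_ne_zero hQ hnd
    have := hQ.finite
    have hc := QuinticResolvent.indexIdeal_ne_bot hV.injective hV.ne_zero hX.choose_spec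
    refine (QuinticResolvent.finite_numericalResolventClass hQ hV.injective hV.ne_zero hX
      fun p _ hp => ?_).1
    -- A prime containing the nonzero index ideal is nonzero, so its residue ring is finite.
    exact Ideal.finiteQuotientOfFreeOfNeBot p fun h => hc (le_bot_iff.mp (h ▸ hp))
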